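/- Let $d\ge 1$, $\Omega=\prod_{i=1}^d(a_i,b_i)\subset\mathbb R^d$ with $a_i<b_i$ (in particular $\Omega=(0,1)^d$) and $T>0$. Consider the linear problem $$\partial_t u=\mathbf L[u]:=\sum_{i,j}A_{ij}\,\partial_{x_ix_j}u+\sum_i\mu_i\,\partial_{x_i}u+\upsilon u\ \text{ on }\Omega\times[0,T],\qquad u(\cdot,0)=\varphi\ \text{ on }\Omega,\qquad u=\psi\ \text{ on }\partial\Omega\times[0,T],$$ with real coefficients $A_{ij},\mu_i,\upsilon$ continuous on $\overline\Omega\times[0,T]$ (for instance $A=\tfrac12\sigma\sigma^{\top}$ with $\sigma,\mu,\upsilon$ affine in $x$). For a smooth function $v$ put $\mathcal R_i[v]=\partial_t v-\mathbf L[v]$, $\mathcal R_s[v]=v-\psi$ on $\partial\Omega\times[0,T]$, $\mathcal R_t[v]=v(\cdot,0)-\varphi$ on $\Omega$. Let $(T^t,T^{x_1},\dots,T^{x_d})$ be a conserved vector of the equation: functions of $(x,t)$, of $u$ and of the derivatives of $u$ of order at most $2$ in the variables $(x,t)$, of class $C^2$ in all arguments for $(x,t)$ in a neighbourhood of $\overline\Omega\times[0,T]$,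 which either involve no second derivatives of $u$ or are affine in $u$ and its derivatives, such that the Lie conservation residual $$\mathcal R_{Lie}[v]=D_tT^t(v)+\sum_i D_{x_i}T^{x_i}(v)$$ (total derivatives) satisfies: for every $v\in C^\infty$ and every point of $\Omega\times(0,T)$ at which $\mathcal R_i[v]=0$, also $\mathcal R_{Lie}[v]=0$ there. For $\lambda_1,\dots,\lambda_4\ge0$ the LSN structural risk of a function $v$ is $$\mathcal E(v)=\lambda_1\!\int_{\Omega\times[0,T]}\!|\mathcal R_i[v]|^2\,dx\,dt+\lambda_2\!\int_{\partial\Omega\times[0,T]}\!|\mathcal R_s[v]|^2+\lambda_3\!\int_\Omega|\mathcal R_t[v]|^2\,dx+\lambda_4\!\int_{\Omega\times[0,T]}\!|\mathcal R_{Lie}[v]|^2\,dx\,dt ,$$ where $\partial\Omega\times[0,T]$ carries surface measure. Let $\gamma,s\in\mathbb N=\{0,1,2,\dots\}$ with $s\ge 2+\gamma$, and let $u\in W^{s,\infty}(\Omega\times(0,T))$, identified with its representative that is continuous on $\overline\Omega\times[0,T]$, be a solution of the problem (the equation holding almost everywhere with weak derivatives). Then: 1. For every $\varepsilon>0$ there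 is a tanh neural network $\widehat u^{\varepsilon}:\mathbb R^{d+1}\to\mathbb R$ with two hidden layers, each of positive width at most $w(\varepsilon)$, such that $\mathcal E(\widehat u^{\varepsilon})\le\varepsilon$; here $w(\varepsilon)<\infty$ and, if $s>2+\gamma$, $w(\varepsilon)=\mathcal O\big(\varepsilon^{-d/(s-2-\gamma)}\big)$ as $\varepsilon\to0^+$. (For $s=2+\gamma$ the exponent is infinite and no rate is claimed.) 2. If the conserved vector is affine in $u$ and its derivatives, there is $M>0$ such that for all $v\in C^3(\mathbb R^{d+1})$ one has $|\mathcal R_{Lie}[v]|^2\le M\,|\mathcal R_i[v]|^2$ on $\overline\Omega\times[0,T]$, and hence $\|\mathcal R_{Lie}[v]\|^2_{L^2(\Omega\times[0,T])}\le M\,\|\mathcal R_i[v]\|^2_{L^2(\Omega\times[0,T])}$. 3. (Black–Scholes.) Let $r\in\mathbb R$, $\sigma>0$, $0<x_{\min}<x_{\max}$, $T>0$, $\Omega=(x_{\min},x_{\max})$, $a,b\in\mathbb R$, $l\in C^3(\mathbb R)$, $g\in C^2(\mathbb R)$. Then $$T^t=-u_x\,l(t)+\frac ax+\frac{2bu}{\sigma^2x}e^{-rt},\qquad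 T^x=u_t\,l(t)+u\,l'(t)+g(t)-bu\,e^{-rt}+b\Big(u_x+\frac{2ru}{\sigma^2x}\Big)x\,e^{-rt}$$ is a conserved vector, in the above sense, of $u_t+\tfrac12\sigma^2x^2u_{xx}+rxu_x-ru=0$ on $\Omega\times[0,T]$. For $b=x_{\min}$ and every $v\in C^2(\mathbb R^2)$ the two inequalities of 2. hold, with $\mathcal R_i[v]=v_t+\tfrac12\sigma^2x^2v_{xx}+rxv_x-rv$, with the constant $M=\big(2\max\{1,e^{-rT}\}/\sigma^2\big)^2$. -/

import Mathlib

open MeasureTheory Filter Topology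
open scoped ContDiff

noncomputable section

/-- Points `z = (x₁, …, x_d, t)` of space-time; the last coordinate is the time `t`. -/
abbrev Spacetime (d : ℕ) := Fin (d + 1) → ℝ

/-! ### Classical and weak partial derivatives -/

/-- The classical partial derivative `∂_i f`. -/
def partialD {n : ℕ} (i : Fin n) (f : (Fin n → ℝ) → ℝ) : (Fin n → ℝ) → ℝ :=
  fun z => fderiv ℝ f z (Pi.single i 1)

/-- The iterated partial derivative `∂_{i₁} ⋯ ∂_{i_m} f` for the list `[i₁, …, i_m]`. -/
def iterPartialD {n : ℕ} : List (Fin n) → ((Fin n → ℝ) → ℝ) → ((Fin n → ℝ) → ℝ)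
  | [], f => f
  | i :: l, f => partialD i (iterPartialD l f)

/-- `g` is the weak derivative `∂_{i₁} ⋯ ∂_{i_m} u` on the open set `U`, for `l = [i₁, …, i_m]`. -/
def IsWeakDeriv {n : ℕ} (U : Set (Fin n → ℝ)) (l : List (Fin n)) (u g : (Fin n → ℝ) → ℝ) : Prop :=
  LocallyIntegrableOn u U ∧ LocallyIntegrableOn g U ∧
    ∀ η : (Fin n → ℝ) → ℝ, ContDiff ℝ ∞ η → HasCompactSupport η → tsupport η ⊆ U →
      ∫ z in U, u z * iterPartialD l η z = (-1) ^ l.length * ∫ z in U, g z * η z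

/-- `u ∈ W^{s,∞}(U)`: every weak derivative of order at most `s` exists and is essentially bounded
(the empty list gives `u ∈ L^∞(U)` itself). -/
def MemSobolevInfty {n : ℕ} (s : ℕ) (U : Set (Fin n → ℝ)) (u : (Fin n → ℝ) → ℝ) : Prop :=
  ∀ l : List (Fin n), l.length ≤ s →
    ∃ g : (Fin n → ℝ) → ℝ, MemLp g ⊤ (volume.restrict U) ∧ IsWeakDeriv U l u g

/-! ### Tanh networks -/

/-- Parameters `θ` of a tanh network with `n` inputs, two hidden layers of widths `N₁`, `N₂` and
one real output. -/
structure TanhNet (n N₁ N₂ : ℕ) where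
  W₁ : Matrix (Fin N₁) (Fin n) ℝ
  b₁ : Fin N₁ → ℝ
  W₂ : Matrix (Fin N₂) (Fin N₁) ℝ
  b₂ : Fin N₂ → ℝ
  W₃ : Fin N₂ → ℝ
  b₃ : ℝ

/-- The function `u_θ` computed by the network. -/
def TanhNet.eval {n N₁ N₂ : ℕ} (θ : TanhNet n N₁ N₂) (z : Fin n → ℝ) : ℝ :=
  ∑ k, θ.W₃ k * Real.tanh (∑ j, θ.W₂ k j * Real.tanh (∑ i, θ.W₁ j i * z i + θ.b₁ j) + θ.b₂ k) + θ.b₃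

/-! ### The linear PDE `∂u/∂t = L[u]` -/

/-- A linear evolution equation `∂u/∂t = L[u]` on `Ω × [0,T]`, where `Ω = ∏ (lo i, hi i)` and
`L[u] = ∑ A_{ij} ∂²u/∂x_i∂x_j + ∑ μ_i ∂u/∂x_i + υ u`, with coefficients that may depend on
`(x, t)` and are continuous on the closed cylinder. -/
structure LinearPDE (d : ℕ) where
  lo : Fin d → ℝ
  hi : Fin d → ℝ
  T : ℝ
  lo_lt_hi : ∀ i, lo i < hi i
  T_pos : 0 < T
  A : Fin d → Fin d → Spacetime d → ℝ
  μ : Fin d → Spacetime d → ℝ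
  υ : Spacetime d → ℝ
  continuousOn_A : ∀ i j, ContinuousOn (A i j)
    (Set.Icc (Fin.snoc (α := fun _ => ℝ) lo 0) (Fin.snoc (α := fun _ => ℝ) hi T))
  continuousOn_μ : ∀ i, ContinuousOn (μ i)
    (Set.Icc (Fin.snoc (α := fun _ => ℝ) lo 0) (Fin.snoc (α := fun _ => ℝ) hi T))
  continuousOn_υ : ContinuousOn υ
    (Set.Icc (Fin.snoc (α := fun _ => ℝ) lo 0) (Fin.snoc (α := fun _ => ℝ) hi T))

namespace LinearPDE

variable {d : ℕ} (P : LinearPDE d)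

/-- Lower corner `(lo, 0)` of the space-time cylinder. -/
def zlo : Spacetime d := Fin.snoc (α := fun _ => ℝ) P.lo 0

/-- Upper corner `(hi, T)` of the space-time cylinder. -/
def zhi : Spacetime d := Fin.snoc (α := fun _ => ℝ) P.hi P.T

/-- The closed cylinder `closure Ω × [0,T]`. -/
def cyl : Set (Spacetime d) := Set.Icc P.zlo P.zhi

/-- The open cylinder `Ω × (0,T)`. -/
def cylInt : Set (Spacetime d) := Set.pi Set.univ fun k => Set.Ioo (P.zlo k) (P.zhi k)

/-- The PDE residual `R_i[v] = ∂v/∂t - L[v]`. -/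
def residual (v : Spacetime d → ℝ) (z : Spacetime d) : ℝ :=
  partialD (Fin.last d) v z -
    ((∑ i : Fin d, ∑ j : Fin d, P.A i j z * partialD i.castSucc (partialD j.castSucc v) z)
      + (∑ i : Fin d, P.μ i z * partialD i.castSucc v z) + P.υ z * v z)

/-- `u` is a (strong) solution of the initial-boundary value problem `∂u/∂t = L[u]` a.e. on
`Ω × (0,T)`, in the sense of weak derivatives, `u(x,0) = φ(x)` on `Ω` and `u(y,t) = ψ(y,t)` on
`∂Ω × [0,T]`; `u` stands for the representative that is continuous on the closed cylinder. -/
def IsSolution (φ : (Fin d → ℝ) → ℝ) (ψ u : Spacetime d → ℝ) : Prop :=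
  ContinuousOn u P.cyl ∧
  (∃ (D : Fin (d + 1) → Spacetime d → ℝ) (H : Fin d → Fin d → Spacetime d → ℝ),
    (∀ k, IsWeakDeriv P.cylInt [k] u (D k)) ∧
    (∀ i j, IsWeakDeriv P.cylInt [i.castSucc, j.castSucc] u (H i j)) ∧
    ∀ᵐ z ∂(volume.restrict P.cylInt),
      D (Fin.last d) z = (∑ i : Fin d, ∑ j : Fin d, P.A i j z * H i j z)
        + (∑ i : Fin d, P.μ i z * D i.castSucc z) + P.υ z * u z) ∧
  (∀ x : Fin d → ℝ, (∀ i, x i ∈ Set.Ioo (P.lo i) (P.hi i)) →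
    u (Fin.snoc (α := fun _ => ℝ) x 0) = φ x) ∧
  (∀ z ∈ P.cyl, (∃ i : Fin d, z i.castSucc = P.lo i ∨ z i.castSucc = P.hi i) → u z = ψ z)

/-! ### Conservation laws -/

end LinearPDE

/-- A vector `(T^{x_1}, …, T^{x_d}, T^t)` of differential functions of order at most two:
`F k z r p H` is the value of the `k`-th component when `u(z) = r`, the gradient of `u` at `z` is
`p` and the Hessian is `H` (in all space-time variables; `k = Fin.last d` is `T^t`). -/
abbrev Flux (d : ℕ) :=
  Fin (d + 1) → Spacetime d → ℝ → Spacetime d → (Fin (d + 1) → Fin (d + 1) → ℝ) → ℝ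

namespace Flux

variable {d : ℕ} (F : Flux d)

/-- The `k`-th component evaluated along a function `v`. -/
def along (v : Spacetime d → ℝ) (k : Fin (d + 1)) (z : Spacetime d) : ℝ :=
  F k z (v z) (fun i => partialD i v z) (fun i j => partialD i (partialD j v) z)

/-- The Lie conservation residual `R_Lie[v] = D_t T^t(v) + ∑ D_{x_i} T^{x_i}(v)`
(total derivatives). -/
def lieResidual (v : Spacetime d → ℝ) (z : Spacetime d) : ℝ :=
  ∑ k, partialD k (F.along v k) z

/-- The components do not depend on second derivatives of `u`. -/
def IsFirstOrder : Prop := ∀ k z r p H H', F k z r p H = F k z r p H'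

/-- The components are affine in `u` and its derivatives. -/
def IsAffine : Prop := ∀ k z, ∃ (c α : ℝ) (β : Fin (d + 1) → ℝ) (Γ : Fin (d + 1) → Fin (d + 1) → ℝ),
  ∀ r p H, F k z r p H = c + α * r + ∑ i, β i * p i + ∑ i, ∑ j, Γ i j * H i j

end Flux

namespace LinearPDE

variable {d : ℕ} (P : LinearPDE d)

/-- `F` is a conserved vector of the equation: it is twice continuously differentiable in all its
arguments near the closed cylinder, and its total divergence vanishes wherever the equation
`∂v/∂t = L[v]` holds. -/
def IsConserved (F : Flux d) : Prop :=
  (∃ U : Set (Spacetime d), IsOpen U ∧ P.cyl ⊆ U ∧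
    ∀ k, ContDiffOn ℝ 2
      (fun q : Spacetime d × ℝ × Spacetime d × (Fin (d + 1) → Fin (d + 1) → ℝ) =>
        F k q.1 q.2.1 q.2.2.1 q.2.2.2) (U ×ˢ Set.univ)) ∧
  ∀ v : Spacetime d → ℝ, ContDiff ℝ ∞ v → ∀ z ∈ P.cylInt,
    P.residual v z = 0 → F.lieResidual v z = 0

/-! ### Risks -/

/-- `∫_{Ω×[0,T]} |R_i[v]|² dx dt`. -/
def pdeRisk (v : Spacetime d → ℝ) : ℝ := ∫ z in P.cyl, |P.residual v z| ^ 2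

/-- `∫_{∂Ω×[0,T]} |v - ψ|²` with respect to surface measure: the sum, over the `2d` faces
`{x_i = c}` with `c = lo i` or `c = hi i`, of the `d`-dimensional Lebesgue integral in the remaining
coordinates. -/
def bcRisk (ψ v : Spacetime d → ℝ) : ℝ :=
  ∑ i : Fin d, ∑ c ∈ ({P.lo i, P.hi i} : Finset ℝ),
    ∫ y in Set.Icc (fun j : Fin d => P.zlo (i.castSucc.succAbove j))
        (fun j : Fin d => P.zhi (i.castSucc.succAbove j)),
      |v (i.castSucc.insertNth (α := fun _ => ℝ) c y)
        - ψ (i.castSucc.insertNth (α := fun _ => ℝ) c y)| ^ 2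

/-- `∫_Ω |v(x,0) - φ(x)|² dx`. -/
def icRisk (φ : (Fin d → ℝ) → ℝ) (v : Spacetime d → ℝ) : ℝ :=
  ∫ x in Set.Icc P.lo P.hi, |v (Fin.snoc (α := fun _ => ℝ) x 0) - φ x| ^ 2

/-- The Lie symmetry risk `∫_{Ω×[0,T]} |R_Lie[v]|² dx dt`. -/
def lieRisk (F : Flux d) (v : Spacetime d → ℝ) : ℝ := ∫ z in P.cyl, |F.lieResidual v z| ^ 2

/-- The structural risk `λ₁ L_PDE + λ₂ L_BC + λ₃ L_IC + λ₄ L_Lie`. -/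
def structuralRisk (φ : (Fin d → ℝ) → ℝ) (ψ : Spacetime d → ℝ) (F : Flux d)
    (lam₁ lam₂ lam₃ lam₄ : ℝ) (v : Spacetime d → ℝ) : ℝ :=
  lam₁ * P.pdeRisk v + lam₂ * P.bcRisk ψ v + lam₃ * P.icRisk φ v + lam₄ * P.lieRisk F v

end LinearPDE

/-! ### The Black-Scholes equation and its conserved vector for `G₂ = x ∂/∂x` -/

/-- The Black-Scholes equation `u_t + ½σ²x²u_xx + r x u_x - r u = 0` on
`(xmin, xmax) × [0,T]`. -/
def blackScholes (r σ xmin xmax T : ℝ) (hx : xmin < xmax) (hT : 0 < T) : LinearPDE 1 where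
  lo := fun _ => xmin
  hi := fun _ => xmax
  T := T
  lo_lt_hi := fun _ => hx
  T_pos := hT
  A := fun _ _ z => -(1 / 2 * σ ^ 2 * z 0 ^ 2)
  μ := fun _ z => -(r * z 0)
  υ := fun _ => r
  continuousOn_A := fun _ _ => by fun_prop
  continuousOn_μ := fun _ => by fun_prop
  continuousOn_υ := by fun_prop

/-- The conserved vector
`T^x = u_t l + u l' + g - b u e^{-rt} + b (u_x + 2ru/(σ²x)) x e^{-rt}`,
`T^t = -u_x l + a/x + (2bu/(σ²x)) e^{-rt}` of the Black-Scholes equation;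
`z 0 = x`, `z 1 = t`, `p 0 = u_x`, `p 1 = u_t`. -/
def blackScholesFlux (r σ a b : ℝ) (l g : ℝ → ℝ) : Flux 1 := fun k z u p _ =>
  if k = 0 then
    p 1 * l (z 1) + u * deriv l (z 1) + g (z 1) - b * u * Real.exp (-(r * z 1))
      + b * (p 0 + 2 * r * u / (σ ^ 2 * z 0)) * z 0 * Real.exp (-(r * z 1))
  else
    -(p 0 * l (z 1)) + a / z 0 + 2 * b * u / (σ ^ 2 * z 0) * Real.exp (-(r * z 1))

end

/-! The network estimate combines three facts.

Regularisation. A function in `W^{s,∞}` of a box need not be `C²` up to the boundary. Shrinking the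
box towards its centre and mollifying gives smooth functions `g` whose derivatives up to order `s`
are bounded by one constant `C`, which converge uniformly to `u`, and whose derivatives converge
almost everywhere (`exists_smooth_approx`). By dominated convergence the PDE risk of `g` tends to
zero, at no cost in `C`. The networks may therefore approximate `g` instead of `u`.

Approximation. On a grid with `N ^ n` nodes, `n = d + 1`, local Taylor polynomials blended by tensor
products of differences of shifted tanh functions have `C²` error `O(N^{-(s-2)})`, with a constant
depending only on `C` (`exists_jetBound_sub_blended_taylor`). Each summand is a product of `q = n +
s + 1` factors that are affine in first-layer units and coordinates. Such a product is the limit of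
combinations of `2 ^ q` second-layer units: polarization isolates the term of degree `q` in the
Taylor expansion of tanh at a point where its `q`-th derivative is nonzero. Weights are
unrestricted, so this limit does not affect the width, which is `O(N ^ n)` (`exists_tanhNet_rate`).
The risk is quadratic in the errors, so `ε ≈ N^{-2(s-2)}` and the width is `O(ε^{-(d+1)/(2(s-2))})`.
This is at least as good as the claimed exponent since `d + 1 ≤ 2d` and `γ ≥ 0`.

Conservation. Put `a = R_i[v](z)` and subtract `a (t - t₀)` from `v`, where `t₀` is the time of `z`.
At `z` only the entry `u_t` of the jet changes, and the equation now holds there, so the Lie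
residual of the new function vanishes at `z`. For a first-order flux, the Lie residual is a locally
Lipschitz function of the 2-jet, hence `|R_Lie[v]| ≤ L |a|` on bounded jets. For an affine flux, the
Lie residual of `v` equals `a` times a bounded function, whatever `v` is. Thus the Lie risk is
dominated by the PDE risk (`exists_lieRisk_le`). For Black–Scholes the quotient of the two residuals
is the explicit function `2 b e^{-rt} / (σ² x)`. -/

noncomputable section

/-! ### Symmetry of iterated derivatives. -/

section Symmetry

variable {E F : Type*} [NormedAddCommGroup E] [NormedSpace ℝ E] [NormedAddCommGroup F]
  [NormedSpace ℝ F]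

theorem iteratedFDeriv_succ_eq_fderiv_apply {f : E → F} {n : ℕ} (hf : ContDiff ℝ (n + 1) f)
    (x : E) (v : Fin (n + 1) → E) :
    iteratedFDeriv ℝ (n + 1) f x v
      = fderiv ℝ (fun y => iteratedFDeriv ℝ n f y (Fin.tail v)) x (v 0) := by
  rw [iteratedFDeriv_succ_apply_left]
  have h : DifferentiableAt ℝ (iteratedFDeriv ℝ n f) x :=
    (hf.differentiable_iteratedFDeriv (by exact_mod_cast Nat.lt_succ_self n)).differentiableAt
  rw [fderiv_continuousMultilinear_apply_const_apply h]

/-- The iterated derivatives of a `C^n` function are symmetric. -/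
theorem ContDiff.iteratedFDeriv_comp_perm' {f : E → F} {n : ℕ} (hf : ContDiff ℝ n f) (x : E)
    (v : Fin n → E) (σ : Equiv.Perm (Fin n)) :
    iteratedFDeriv ℝ n f x (v ∘ σ) = iteratedFDeriv ℝ n f x v := by
  induction n generalizing x with
  | zero => congr 1; ext i; exact i.elim0
  | succ n ih =>
    -- Adjacent transpositions generate the permutations. The swap of the first two arguments is the
    -- symmetry of a second derivative with the other arguments frozen; any other adjacent swap
    -- leaves the first argument alone and follows by induction under one derivative.
    have key : ∀ (τ : Equiv.Perm (Fin (n + 1))), τ ∈ Submonoid.closure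
        (Set.range fun i : Fin n => Equiv.swap i.castSucc i.succ) → ∀ w : Fin (n + 1) → E,
        iteratedFDeriv ℝ (n + 1) f x (w ∘ τ) = iteratedFDeriv ℝ (n + 1) f x w := by
      intro τ hτ
      induction hτ using Submonoid.closure_induction with
      | one => intro w; rfl
      | mul a b _ _ ha hb =>
        intro w
        rw [Equiv.Perm.coe_mul, ← Function.comp_assoc, hb, ha]
      | mem τ hτ =>
        obtain ⟨i, rfl⟩ := hτ
        intro w
        cases n with
        | zero => exact i.elim0
        | succ n =>
          induction i using Fin.cases with
          | zero =>
            have hg : ContDiff ℝ 2 (fun y => iteratedFDeriv ℝ n f y (Fin.tail (Fin.tail w))) := by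
              have h1 : ContDiff ℝ 2 (iteratedFDeriv ℝ n f) :=
                hf.iteratedFDeriv_right (by norm_cast; omega)
              exact (ContinuousMultilinearMap.apply ℝ (fun _ : Fin n => E) F
                (Fin.tail (Fin.tail w))).contDiff.comp h1
            have e : ∀ u : Fin (n + 2) → E, Fin.tail (Fin.tail u) = Fin.tail (Fin.tail w) →
                iteratedFDeriv ℝ (n + 2) f x u = fderiv ℝ (fderiv ℝ
                  (fun y => iteratedFDeriv ℝ n f y (Fin.tail (Fin.tail w)))) x (u 0) (u 1) := by
              intro u hu
              rw [iteratedFDeriv_succ_eq_fderiv_apply (by exact_mod_cast hf)]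
              have : (fun y => iteratedFDeriv ℝ (n + 1) f y (Fin.tail u)) = fun y =>
                  fderiv ℝ (fun y => iteratedFDeriv ℝ n f y (Fin.tail (Fin.tail w))) y (u 1) := by
                funext y
                rw [iteratedFDeriv_succ_eq_fderiv_apply (hf.of_le (by norm_cast; omega)), hu]
                rfl
              rw [this, fderiv_clm_apply
                ((hg.fderiv_right (m := 1) (by norm_num)).differentiable (by norm_num) x)
                (differentiableAt_const _)]
              simp
            rw [e w rfl, e]
            · have hs := (hg.contDiffAt (x := x)).isSymmSndFDerivAt (by simp)
              have h := hs (w 1) (w 0)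
              simp only [Function.comp_apply, Fin.castSucc_zero, Fin.succ_zero_eq_one,
                Equiv.swap_apply_left, Equiv.swap_apply_right]
              exact h
            · funext j
              simp only [Fin.tail, Function.comp_apply]
              congr 1
          | succ i =>
            rw [iteratedFDeriv_succ_eq_fderiv_apply (by exact_mod_cast hf),
              iteratedFDeriv_succ_eq_fderiv_apply (by exact_mod_cast hf)]
            have e1 : Fin.tail (w ∘ ⇑(Equiv.swap i.succ.castSucc i.succ.succ))
                = Fin.tail w ∘ ⇑(Equiv.swap i.castSucc i.succ) := by
              funext j
              simp only [Fin.tail, Function.comp_apply]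
              congr 1
              rw [show i.succ.castSucc = i.castSucc.succ from rfl,
                (Fin.succ_injective _).swap_apply]
            have e2 : (w ∘ ⇑(Equiv.swap i.succ.castSucc i.succ.succ)) 0 = w 0 := by
              simp only [Function.comp_apply]
              congr 1
            rw [e1, e2]
            simp_rw [ih (hf.of_le (by norm_cast; omega)) _ (Fin.tail w)]
    refine key σ ?_ v
    rw [Equiv.Perm.mclosure_swap_castSucc_succ]
    trivial

end Symmetry

/-! ### Taylor polynomials in several variables and their remainders. -/

section Taylor

variable {E : Type*} [NormedAddCommGroup E] [NormedSpace ℝ E]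

/-- The Taylor polynomial of degree less than `s` of `f` at `z₀`. -/
def taylorPoly (f : E → ℝ) (z₀ : E) (s : ℕ) (z : E) : ℝ :=
  ∑ k ∈ Finset.range s, (k.factorial : ℝ)⁻¹ * iteratedFDeriv ℝ k f z₀ fun _ => z - z₀

/-- Viewing the Taylor polynomial as a finite power series makes its smoothness and its derivatives
instances of the general theory. -/
theorem taylorPoly_hasFiniteFPowerSeriesOnBall (f : E → ℝ) (z₀ : E) (s : ℕ) :
    HasFiniteFPowerSeriesOnBall (taylorPoly f z₀ s)
      (fun k => if k < s then (k.factorial : ℝ)⁻¹ • iteratedFDeriv ℝ k f z₀ else 0) z₀ s ⊤ := by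
  set p : FormalMultilinearSeries ℝ E ℝ :=
    fun k => if k < s then (k.factorial : ℝ)⁻¹ • iteratedFDeriv ℝ k f z₀ else 0 with hp
  have hfin : ∀ m, s ≤ m → p m = 0 := fun m hm => by simp [hp, hm]
  have h := (p.hasFiniteFPowerSeriesOnBall_of_finite hfin).comp_sub z₀
  rw [zero_add] at h
  refine h.congr fun z _ => ?_
  change p.sum (z - z₀) = _
  rw [p.sum_of_finite hfin, FormalMultilinearSeries.partialSum, taylorPoly]
  refine Finset.sum_congr rfl fun k hk => ?_
  simp [hp, Finset.mem_range.1 hk]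

theorem contDiff_taylorPoly (f : E → ℝ) (z₀ : E) (s : ℕ) {n : WithTop ℕ∞} :
    ContDiff ℝ n (taylorPoly f z₀ s) := by
  refine contDiff_iff_contDiffAt.2 fun z => ?_
  exact ((taylorPoly_hasFiniteFPowerSeriesOnBall f z₀ s).cpolynomialAt_of_mem
    (by simp)).contDiffAt

/-- The `k`-th derivative of a power series at its centre is the sum of its `k`-th coefficient over
all permutations of the arguments; symmetry turns this into `k!` equal terms, cancelling the
factorial. -/
theorem iteratedFDeriv_taylorPoly_self {f : E → ℝ} {k s : ℕ} (hf : ContDiff ℝ k f) (z₀ : E)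
    (hk : k < s) :
    iteratedFDeriv ℝ k (taylorPoly f z₀ s) z₀ = iteratedFDeriv ℝ k f z₀ := by
  ext v
  rw [(taylorPoly_hasFiniteFPowerSeriesOnBall f z₀ s).toHasFPowerSeriesOnBall
    |>.iteratedFDeriv_eq_sum_of_completeSpace]
  have : ∀ σ : Equiv.Perm (Fin k), iteratedFDeriv ℝ k f z₀ (fun i => v (σ i))
      = iteratedFDeriv ℝ k f z₀ v := fun σ => hf.iteratedFDeriv_comp_perm' z₀ v σ
  simp [hk, this, Fintype.card_perm]
  field_simp

/-- Recentring a finite power series at `z` does not raise its degree. -/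
theorem iteratedFDeriv_taylorPoly_eq_zero (f : E → ℝ) (z₀ z : E) {k s : ℕ} (hk : s ≤ k) :
    iteratedFDeriv ℝ k (taylorPoly f z₀ s) z = 0 := by
  have h := (taylorPoly_hasFiniteFPowerSeriesOnBall f z₀ s).changeOrigin (y := z - z₀)
    (by simp)
  rw [add_sub_cancel] at h
  ext v
  rw [h.toHasFPowerSeriesOnBall.iteratedFDeriv_eq_sum_of_completeSpace]
  simp [h.finite k hk]

/-- A function whose derivatives of order less than `s` vanish at `z₀` and whose `s`-th derivative
is bounded is small near `z₀`, together with its derivatives. -/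
theorem norm_iteratedFDeriv_le_of_vanishing {K : Set E} (hK : Convex ℝ K) {R : E → ℝ} {s : ℕ}
    (hR : ContDiff ℝ s R) {z₀ : E} (hz₀ : z₀ ∈ K)
    (hv : ∀ k < s, iteratedFDeriv ℝ k R z₀ = 0) {C : ℝ}
    (hC : ∀ z ∈ K, ‖iteratedFDeriv ℝ s R z‖ ≤ C) {k : ℕ} (hk : k ≤ s) {z : E} (hz : z ∈ K) :
    ‖iteratedFDeriv ℝ k R z‖ ≤ C * ‖z - z₀‖ ^ (s - k) := by
  have hC0 : 0 ≤ C := (norm_nonneg _).trans (hC z₀ hz₀)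
  obtain ⟨m, rfl⟩ := Nat.exists_eq_add_of_le hk
  rw [Nat.add_sub_cancel_left]
  -- Descending induction on the order `k`, with `m = s - k`: the mean value inequality on the
  -- segment from `z₀` gains one power of the distance because the `k`-th derivative vanishes at
  -- `z₀`.
  induction m generalizing k z with
  | zero => simpa using hC z hz
  | succ m ih =>
    have hd : ∀ y, HasFDerivAt (iteratedFDeriv ℝ k R) (fderiv ℝ (iteratedFDeriv ℝ k R) y) y :=
      fun y => ((hR.differentiable_iteratedFDeriv
        (by exact_mod_cast (by omega : k < k + (m + 1)))).differentiableAt).hasFDerivAt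
    have hb : ∀ y ∈ segment ℝ z₀ z, ‖fderiv ℝ (iteratedFDeriv ℝ k R) y‖ ≤ C * ‖z - z₀‖ ^ m := by
      intro y hy
      rw [norm_fderiv_iteratedFDeriv]
      have e : k + (m + 1) = k + 1 + m := by ring
      have h := ih (k := k + 1) (z := y) (hK.segment_subset hz₀ hz hy) (by rwa [← e])
        (fun j hj => hv j (by omega)) (by rwa [← e]) (by omega)
      refine h.trans ?_
      gcongr
      simpa using norm_sub_le_of_mem_segment hy
    have h := (convex_segment z₀ z).norm_image_sub_le_of_norm_hasFDerivWithin_le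
      (fun y _ => (hd y).hasFDerivWithinAt) hb (left_mem_segment ℝ z₀ z) (right_mem_segment ℝ z₀ z)
    rw [hv k (by omega), sub_zero] at h
    rw [pow_succ, ← mul_assoc]
    exact h

/-- Taylor's theorem for the derivatives. -/
theorem norm_iteratedFDeriv_sub_taylorPoly_le {K : Set E} (hK : Convex ℝ K) {f : E → ℝ} {s : ℕ}
    (hf : ContDiff ℝ s f) {z₀ : E} (hz₀ : z₀ ∈ K) {C : ℝ}
    (hC : ∀ z ∈ K, ‖iteratedFDeriv ℝ s f z‖ ≤ C) {k : ℕ} (hk : k ≤ s) {z : E} (hz : z ∈ K) :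
    ‖iteratedFDeriv ℝ k (fun y => f y - taylorPoly f z₀ s y) z‖ ≤ C * ‖z - z₀‖ ^ (s - k) := by
  have hsub : ∀ {k : ℕ}, k ≤ s → ∀ z, iteratedFDeriv ℝ k (fun y => f y - taylorPoly f z₀ s y) z
      = iteratedFDeriv ℝ k f z - iteratedFDeriv ℝ k (taylorPoly f z₀ s) z := by
    intro k hk z
    exact fun_iteratedFDeriv_sub_apply (hf.of_le (by exact_mod_cast hk)).contDiffAt
      (contDiff_taylorPoly f z₀ s).contDiffAt
  refine norm_iteratedFDeriv_le_of_vanishing hK (hf.sub (contDiff_taylorPoly f z₀ s)) hz₀ ?_ ?_ hk hz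
  · intro k hk
    rw [hsub hk.le, iteratedFDeriv_taylorPoly_self (hf.of_le (by exact_mod_cast hk.le)) z₀ hk,
      sub_self]
  · intro z hz
    rw [hsub le_rfl, iteratedFDeriv_taylorPoly_eq_zero f z₀ z le_rfl, sub_zero]
    exact hC z hz

end Taylor

/-! ### Calculus of bounds for derivatives of order at most two. -/

section JetBound

variable {E : Type*} [NormedAddCommGroup E] [NormedSpace ℝ E]

/-- The derivatives of `f` of order `k ≤ 2` at `z` are bounded by `c * N ^ k`. -/
def JetBound (N c : ℝ) (f : E → ℝ) (z : E) : Prop :=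
  ∀ k ≤ 2, ‖iteratedFDeriv ℝ k f z‖ ≤ c * N ^ k

namespace JetBound

variable {N c c' : ℝ} {f g : E → ℝ} {z : E}

theorem nonneg (h : JetBound N c f z) : 0 ≤ c := by
  simpa using (norm_nonneg _).trans (h 0 (by norm_num))

theorem abs_le (h : JetBound N c f z) : |f z| ≤ c := by
  simpa using h 0 (by norm_num)

theorem mono (h : JetBound N c f z) (hN : 0 ≤ N) (hc : c ≤ c') : JetBound N c' f z :=
  fun k hk => (h k hk).trans (mul_le_mul_of_nonneg_right hc (pow_nonneg hN k))

theorem add (hf : ContDiff ℝ 2 f) (hg : ContDiff ℝ 2 g) (h : JetBound N c f z)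
    (h' : JetBound N c' g z) : JetBound N (c + c') (fun y => f y + g y) z := by
  intro k hk
  have hk' : (k : WithTop ℕ∞) ≤ 2 := by exact_mod_cast hk
  rw [fun_iteratedFDeriv_add_apply (hf.of_le hk').contDiffAt (hg.of_le hk').contDiffAt, add_mul]
  exact (norm_add_le _ _).trans (add_le_add (h k hk) (h' k hk))

theorem const_mul (hf : ContDiff ℝ 2 f) (h : JetBound N c f z) (a : ℝ) :
    JetBound N (|a| * c) (fun y => a * f y) z := by
  intro k hk
  have hk' : (k : WithTop ℕ∞) ≤ 2 := by exact_mod_cast hk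
  have e : iteratedFDeriv ℝ k (fun y => a * f y) z = a • iteratedFDeriv ℝ k f z := by
    simpa only [smul_eq_mul] using
      iteratedFDeriv_const_smul_apply' (a := a) (hf.of_le hk').contDiffAt
  rw [e, norm_smul, Real.norm_eq_abs, mul_assoc]
  exact mul_le_mul_of_nonneg_left (h k hk) (abs_nonneg a)

theorem sub (hf : ContDiff ℝ 2 f) (hg : ContDiff ℝ 2 g) (h : JetBound N c f z)
    (h' : JetBound N c' g z) : JetBound N (c + c') (fun y => f y - g y) z := by
  have := h.add hf (contDiff_const.mul hg) (h'.const_mul hg (-1))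
  simpa [sub_eq_add_neg] using this

theorem const (hN : 0 ≤ N) (a : ℝ) : JetBound N |a| (fun _ : E => a) z := by
  intro k hk
  rcases Nat.eq_zero_or_pos k with rfl | hk0
  · simp
  · rw [iteratedFDeriv_const_of_ne hk0.ne']
    simpa using mul_nonneg (abs_nonneg a) (pow_nonneg hN k)

theorem sum {ι : Type*} {s : Finset ι} {f : ι → E → ℝ} {c : ι → ℝ}
    (hf : ∀ i ∈ s, ContDiff ℝ 2 (f i)) (h : ∀ i ∈ s, JetBound N (c i) (f i) z) :
    JetBound N (∑ i ∈ s, c i) (fun y => ∑ i ∈ s, f i y) z := by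
  intro k hk
  have hk' : (k : WithTop ℕ∞) ≤ 2 := by exact_mod_cast hk
  rw [iteratedFDeriv_fun_sum_apply fun i hi => ((hf i hi).of_le hk').contDiffAt, Finset.sum_mul]
  exact (norm_sum_le _ _).trans (Finset.sum_le_sum fun i hi => h i hi k hk)

/-- Bounds of the form `c * N ^ k` are stable under Leibniz's rule, since the exponents of `N` add.
The factor 4 is `2 ^ 2`, the largest sum of binomial coefficients for orders at most two. -/
theorem mul (hf : ContDiff ℝ 2 f) (hg : ContDiff ℝ 2 g) (hN : 0 ≤ N) (h : JetBound N c f z)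
    (h' : JetBound N c' g z) : JetBound N (4 * c * c') (fun y => f y * g y) z := by
  intro k hk
  have hk' : (k : WithTop ℕ∞) ≤ 2 := by exact_mod_cast hk
  refine (norm_iteratedFDeriv_mul_le hf hg z hk').trans ?_
  have h0 := h.nonneg
  have h0' := h'.nonneg
  calc ∑ i ∈ Finset.range (k + 1), (k.choose i : ℝ) * ‖iteratedFDeriv ℝ i f z‖
          * ‖iteratedFDeriv ℝ (k - i) g z‖
      ≤ ∑ i ∈ Finset.range (k + 1), (k.choose i : ℝ) * (c * c' * N ^ k) := by
        refine Finset.sum_le_sum fun i hi => ?_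
        have hi' : i ≤ k := Nat.lt_succ_iff.1 (Finset.mem_range.1 hi)
        have e : c * c' * N ^ k = (c * N ^ i) * (c' * N ^ (k - i)) := by
          rw [← pow_mul_pow_sub N hi']; ring
        rw [e, mul_assoc]
        gcongr
        · exact h i (hi'.trans hk)
        · exact h' (k - i) ((Nat.sub_le _ _).trans hk)
    _ = 2 ^ k * (c * c' * N ^ k) := by
        rw [← Finset.sum_mul]
        congr 1
        exact_mod_cast Nat.sum_range_choose k
    _ ≤ 2 ^ 2 * (c * c' * N ^ k) := by
        gcongr
        norm_num
    _ = _ := by ring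

theorem prod {ι : Type*} {s : Finset ι} {f : ι → E → ℝ} {c : ι → ℝ}
    (hf : ∀ i ∈ s, ContDiff ℝ 2 (f i)) (hN : 0 ≤ N) (h : ∀ i ∈ s, JetBound N (c i) (f i) z) :
    JetBound N (4 ^ s.card * ∏ i ∈ s, c i) (fun y => ∏ i ∈ s, f i y) z := by
  classical
  induction s using Finset.induction_on with
  | empty => simpa using const (z := z) hN 1
  | insert a s ha ih =>
    have h1 := ih (fun i hi => hf i (Finset.mem_insert_of_mem hi))
      (fun i hi => h i (Finset.mem_insert_of_mem hi))
    have h2 := (h a (Finset.mem_insert_self a s)).mul (hf a (Finset.mem_insert_self a s))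
      (contDiff_prod fun i hi => hf i (Finset.mem_insert_of_mem hi)) hN h1
    simp_rw [Finset.prod_insert ha]
    refine h2.mono hN (le_of_eq ?_)
    rw [Finset.card_insert_of_notMem ha]
    ring

theorem of_isCompact {K : Set E} (hK : IsCompact K) (hf : ContDiff ℝ 2 f) :
    ∃ B, 1 ≤ B ∧ ∀ z ∈ K, JetBound 1 B f z := by
  have h : ∀ k ≤ 2, ∃ B, ∀ z ∈ K, ‖iteratedFDeriv ℝ k f z‖ ≤ B := fun k hk =>
    hK.exists_bound_of_continuousOn
      (hf.continuous_iteratedFDeriv (by exact_mod_cast hk)).continuousOn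
  choose! B hB using h
  refine ⟨max 1 (max (B 0) (max (B 1) (B 2))), le_max_left _ _, fun z hz k hk => ?_⟩
  rw [one_pow, mul_one]
  refine (hB k hk z hz).trans ?_
  interval_cases k <;> simp

end JetBound

end JetBound

/-! ### The polarization identity. -/

section Polarization

/-- If `p` misses an index `i`, toggling `i` in `S` reverses the sign and keeps the product, so the
terms cancel in pairs. If `p` is surjective, every `S` other than the full set gives a zero factor.
-/
theorem sum_powerset_neg_one_pow_prod_ite {q m : ℕ} (y : Fin q → ℝ) (p : Fin m → Fin q) :
    ∑ S : Finset (Fin q), (-1 : ℝ) ^ (q - S.card) * ∏ j, (if p j ∈ S then y (p j) else 0)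
      = if Function.Surjective p then ∏ j, y (p j) else 0 := by
  classical
  split_ifs with hp
  · rw [Finset.sum_eq_single Finset.univ]
    · simp
    · intro S _ hS
      obtain ⟨i, hi⟩ : ∃ i, i ∉ S := by
        by_contra! h
        exact hS (Finset.eq_univ_iff_forall.2 h)
      obtain ⟨j, rfl⟩ := hp i
      rw [Finset.prod_eq_zero (Finset.mem_univ j) (by simp [hi]), mul_zero]
    · simp
  · obtain ⟨i, hi⟩ : ∃ i, ∀ j, p j ≠ i := by
      simpa [Function.Surjective] using hp
    refine Finset.sum_involution (fun S _ => symmDiff S {i}) ?_ ?_ (by simp) (by simp)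
    · intro S _
      have e : ∏ j, (if p j ∈ symmDiff S {i} then y (p j) else 0)
          = ∏ j, (if p j ∈ S then y (p j) else 0) := by
        refine Finset.prod_congr rfl fun j _ => ?_
        simp [Finset.mem_symmDiff, hi j]
      rw [e, ← add_mul]
      have hle : ∀ S : Finset (Fin q), S.card ≤ q := fun S => by
        simpa using Finset.card_le_univ S
      have hc : (-1 : ℝ) ^ (q - S.card) + (-1) ^ (q - (symmDiff S {i}).card) = 0 := by
        by_cases his : i ∈ S
        · have h1 : symmDiff S {i} = S.erase i := by
            ext x; by_cases hx : x = i <;> simp [Finset.mem_symmDiff, hx, his]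
          have h2 := Finset.card_erase_add_one his
          have h3 := hle S
          rw [h1, show q - (S.erase i).card = q - S.card + 1 by omega, pow_succ]
          ring
        · have h1 : symmDiff S {i} = insert i S := by
            ext x; by_cases hx : x = i <;> simp [Finset.mem_symmDiff, hx, his]
          have h2 := Finset.card_insert_of_notMem his
          have h3 := hle (insert i S)
          rw [h1, show q - S.card = q - (insert i S).card + 1 by omega, pow_succ]
          ring
      rw [hc, zero_mul]
    · intro S _ _ h
      have := congrArg (fun T => i ∈ T) h
      by_cases his : i ∈ S <;> simp [Finset.mem_symmDiff, his] at this

/-- The polarization identity for the product of `q` numbers. -/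
theorem sum_powerset_neg_one_pow_sum_pow {q m : ℕ} (hm : m ≤ q) (y : Fin q → ℝ) :
    ∑ S : Finset (Fin q), (-1 : ℝ) ^ (q - S.card) * (∑ i ∈ S, y i) ^ m
      = if m = q then (q.factorial : ℝ) * ∏ i, y i else 0 := by
  classical
  -- Expanding the power over maps `p : Fin m → Fin q`, only surjections survive: none for `m < q`,
  -- and the `q!` bijections for `m = q`.
  have e : ∀ S : Finset (Fin q), (∑ i ∈ S, y i) ^ m
      = ∑ p : Fin m → Fin q, ∏ j, (if p j ∈ S then y (p j) else 0) := fun S => by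
    rw [← Fintype.sum_pow (fun i => if i ∈ S then y i else 0)]
    simp
  simp_rw [e, Finset.mul_sum]
  rw [Finset.sum_comm]
  simp_rw [sum_powerset_neg_one_pow_prod_ite]
  split_ifs with hmq
  · subst hmq
    have e2 : ∀ p : Fin m → Fin m, (if Function.Surjective p then ∏ j, y (p j) else 0)
        = (if Function.Surjective p then 1 else 0) * ∏ j, y j := fun p => by
      split_ifs with hp
      · rw [one_mul]
        exact (Equiv.ofBijective p (Finite.surjective_iff_bijective.1 hp)).prod_comp y
      · simp
    simp_rw [e2]
    rw [← Finset.sum_mul, Finset.sum_boole]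
    congr 2
    have h1 : Fintype.card {p : Fin m → Fin m // Function.Injective p} = m.factorial := by
      rw [Fintype.card_congr (Equiv.subtypeInjectiveEquivEmbedding _ _),
        Fintype.card_embedding_eq]
      simp [Nat.descFactorial_self]
    rw [← h1, Fintype.card_subtype]
    congr 1
    ext p
    simp [Finite.injective_iff_surjective]
  · refine Finset.sum_eq_zero fun p _ => if_neg fun hp => hmq (le_antisymm hm ?_)
    simpa using Fintype.card_le_of_surjective p hp

end Polarization

/-! ### The activation function is not a polynomial. -/

section Activation

theorem contDiff_tanh {n : WithTop ℕ∞} : ContDiff ℝ n Real.tanh := by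
  have : Real.tanh = fun x => Real.sinh x / Real.cosh x := funext Real.tanh_eq_sinh_div_cosh
  rw [this]
  exact Real.contDiff_sinh.div Real.contDiff_cosh fun x => (Real.cosh_pos x).ne'

/-- Were the `q`-th derivative identically zero, tanh would equal its Taylor polynomial; being
bounded, that polynomial would be constant, which contradicts injectivity. -/
theorem exists_iteratedDeriv_tanh_ne_zero (q : ℕ) : ∃ b, iteratedDeriv q Real.tanh b ≠ 0 := by
  by_contra! h
  have h0 : ∀ x, Real.tanh x = taylorPoly Real.tanh 0 q x := fun x => by
    have := norm_iteratedFDeriv_sub_taylorPoly_le (K := Set.univ) (f := Real.tanh) (s := q)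
      (z₀ := 0) convex_univ contDiff_tanh trivial (C := 0)
      (fun z _ => by rw [norm_iteratedFDeriv_eq_norm_iteratedDeriv, h z, norm_zero])
      (k := 0) (Nat.zero_le q) (z := x) trivial
    simpa [sub_eq_zero] using this
  set P : Polynomial ℝ := ∑ k ∈ Finset.range q,
    Polynomial.C ((k.factorial : ℝ)⁻¹ * iteratedDeriv k Real.tanh 0) * Polynomial.X ^ k with hP
  have h1 : ∀ x, P.eval x = Real.tanh x := fun x => by
    rw [h0, taylorPoly, hP, Polynomial.eval_finsetSum]
    refine Finset.sum_congr rfl fun k _ => ?_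
    rw [iteratedFDeriv_apply_eq_iteratedDeriv_mul_prod]
    simp
    ring
  have h2 : P.degree ≤ 0 := by
    rw [← Polynomial.isBoundedUnder_abs_atTop_iff]
    exact ⟨1, Filter.eventually_map.2 (Filter.Eventually.of_forall fun x => by
      rw [h1]; exact (Real.abs_tanh_lt_one x).le)⟩
  rw [Polynomial.eq_C_of_degree_le_zero h2] at h1
  have h3 := h1 0
  have h4 := h1 1
  rw [Polynomial.eval_C] at h3 h4
  have h5 := Real.tanh_injective (h3.symm.trans h4)
  norm_num at h5

end Activation

/-! ### Products as limits of combinations of tanh units. -/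

section Products

variable {E : Type*} [NormedAddCommGroup E] [NormedSpace ℝ E]

/-- Products of `q` functions are limits, together with their derivatives of order at most two, of
combinations of `2 ^ q` units. -/
theorem exists_jetBound_prod_sub_units {K : Set E} (hK : IsCompact K) {q : ℕ} (hq : 1 ≤ q)
    {a : Fin q → E → ℝ} (ha : ∀ i, ContDiff ℝ 2 (a i)) {δ : ℝ} (hδ : 0 < δ) :
    ∃ b c h : ℝ, ∀ z ∈ K, JetBound 1 δ (fun y =>
      (∑ S : Finset (Fin q), c * (-1) ^ (q - S.card)
        * Real.tanh (∑ i, (if i ∈ S then h else 0) * a i y + b)) - ∏ i, a i y) z := by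
  classical
  obtain ⟨b, hb⟩ := exists_iteratedDeriv_tanh_ne_zero q
  set f : ℝ → ℝ := fun u => Real.tanh (u + b) with hf
  have hfs : ∀ {n : WithTop ℕ∞}, ContDiff ℝ n f := contDiff_tanh.comp (contDiff_id.add contDiff_const)
  have hfq : iteratedDeriv q f 0 ≠ 0 := by
    have : iteratedDeriv q f 0 = iteratedDeriv q Real.tanh (0 + b) := by
      rw [hf, iteratedDeriv_comp_add_const]
    rwa [this, zero_add]
  set v : Finset (Fin q) → E → ℝ := fun S y => ∑ i ∈ S, a i y with hv
  have hvs : ∀ S, ContDiff ℝ 2 (v S) := fun S => ContDiff.sum fun i _ => ha i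
  have hB : ∃ B, 1 ≤ B ∧ ∀ S, ∀ z ∈ K, JetBound 1 B (v S) z := by
    choose B hB1 hB using fun S => JetBound.of_isCompact hK (hvs S)
    refine ⟨∑ S, B S, (hB1 ∅).trans ?_, fun S z hz => (hB S z hz).mono zero_le_one ?_⟩ <;>
      exact Finset.single_le_sum (f := B) (fun S _ => zero_le_one.trans (hB1 S)) (Finset.mem_univ _)
  obtain ⟨B, hB1, hB⟩ := hB
  -- Split `f` into its part of degree at most `q` and a remainder. With arguments scaled by `h`,
  -- polarization reduces the first to `h ^ q` times the product, while the second is `O(h ^ (q +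
  -- 1))` with two derivatives, so division by `h ^ q` leaves an error `O(h)`.
  set ρ : ℝ → ℝ := fun u => f u - taylorPoly f 0 (q + 1) u with hρ
  have hρs : ContDiff ℝ 2 ρ := hfs.sub (contDiff_taylorPoly _ _ _)
  obtain ⟨C, hC⟩ := (isCompact_Icc (a := -B) (b := B)).exists_bound_of_continuousOn
    ((hfs (n := ((q + 1 : ℕ) : WithTop ℕ∞))).continuous_iteratedFDeriv le_rfl).continuousOn
  have hC0 : 0 ≤ C := (norm_nonneg _).trans (hC 0 ⟨by linarith, by linarith⟩)
  have hρb : ∀ k ≤ 2, ∀ u, |u| ≤ B → |iteratedDeriv k ρ u| ≤ C * |u| ^ (q + 1 - k) := by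
    intro k hk u hu
    have := norm_iteratedFDeriv_sub_taylorPoly_le (convex_Icc (-B) B) (f := f) (s := q + 1) hfs
      (z₀ := 0) ⟨by linarith, by linarith⟩ hC (k := k) (by omega) (z := u) (abs_le.1 hu)
    rw [norm_iteratedFDeriv_eq_norm_iteratedDeriv] at this
    simpa using this
  -- the remainder composed with the scaled functions
  have hcomp : ∀ S, ∀ h : ℝ, |h| ≤ 1 → ∀ z ∈ K,
      JetBound 1 (2 * C * B ^ (q + 3) * |h| ^ (q + 1)) (fun y => ρ (h * v S y)) z := by
    intro S h hh z hz k hk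
    have hk' : (k : WithTop ℕ∞) ≤ 2 := by exact_mod_cast hk
    have h1 : ∀ i ≤ k, ‖iteratedFDeriv ℝ i (fun u => ρ (h * u)) (v S z)‖
        ≤ C * B ^ (q + 1) * |h| ^ (q + 1) := by
      intro i hi
      have hi2 : (i : WithTop ℕ∞) ≤ 2 := by exact_mod_cast hi.trans hk
      rw [norm_iteratedFDeriv_eq_norm_iteratedDeriv,
        iteratedDeriv_comp_const_mul (hρs.of_le hi2), norm_mul, norm_pow, Real.norm_eq_abs,
        Real.norm_eq_abs]
      have hvz := (hB S z hz).abs_le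
      have h2 : |h * v S z| ≤ |h| * B := by
        rw [abs_mul]; gcongr
      calc |h| ^ i * |iteratedDeriv i ρ (h * v S z)|
          ≤ |h| ^ i * (C * |h * v S z| ^ (q + 1 - i)) := by
            gcongr
            refine hρb i (hi.trans hk) _ (h2.trans ?_)
            exact mul_le_of_le_one_left (by linarith) hh
        _ ≤ |h| ^ i * (C * (|h| * B) ^ (q + 1 - i)) := by gcongr
        _ = C * B ^ (q + 1 - i) * (|h| ^ i * |h| ^ (q + 1 - i)) := by rw [mul_pow]; ring
        _ = C * B ^ (q + 1 - i) * |h| ^ (q + 1) := by rw [pow_mul_pow_sub _ (by omega)]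
        _ ≤ C * B ^ (q + 1) * |h| ^ (q + 1) := by
            gcongr
            omega
    have h2 := norm_iteratedFDeriv_comp_le (g := fun u => ρ (h * u)) (f := v S) (n := k) (N := 2)
      (hρs.comp (contDiff_const.mul contDiff_id)) (hvs S) hk' z (D := B) h1
      (fun i hi1 hi => by
        have := hB S z hz i (hi.trans hk)
        rw [one_pow, mul_one] at this
        exact this.trans (le_self_pow₀ hB1 (by omega)))
    refine h2.trans ?_
    rw [one_pow, mul_one]
    calc (k.factorial : ℝ) * (C * B ^ (q + 1) * |h| ^ (q + 1)) * B ^ k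
        ≤ (2 : ℝ) * (C * B ^ (q + 1) * |h| ^ (q + 1)) * B ^ 2 := by
          gcongr
          have : k.factorial ≤ Nat.factorial 2 := Nat.factorial_le hk
          exact_mod_cast this
      _ = _ := by ring
  -- the polynomial part
  have hpoly : ∀ h : ℝ, ∀ y, ∑ S : Finset (Fin q), (-1 : ℝ) ^ (q - S.card)
      * taylorPoly f 0 (q + 1) (h * v S y) = h ^ q * iteratedDeriv q f 0 * ∏ i, a i y := by
    intro h y
    have e : ∀ S : Finset (Fin q), (-1 : ℝ) ^ (q - S.card) * taylorPoly f 0 (q + 1) (h * v S y)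
        = ∑ k ∈ Finset.range (q + 1), (k.factorial : ℝ)⁻¹ * iteratedDeriv k f 0 * h ^ k
            * ((-1 : ℝ) ^ (q - S.card) * (∑ i ∈ S, a i y) ^ k) := fun S => by
      rw [taylorPoly, Finset.mul_sum]
      refine Finset.sum_congr rfl fun k _ => ?_
      rw [iteratedFDeriv_apply_eq_iteratedDeriv_mul_prod]
      simp only [sub_zero, Finset.prod_const, Finset.card_univ, Fintype.card_fin, smul_eq_mul, hv]
      ring
    simp_rw [e]
    rw [Finset.sum_comm]
    simp_rw [← Finset.mul_sum]
    rw [Finset.sum_eq_single q]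
    · rw [sum_powerset_neg_one_pow_sum_pow le_rfl, if_pos rfl]
      have := Nat.factorial_ne_zero q
      field_simp
    · intro k hk hkq
      rw [sum_powerset_neg_one_pow_sum_pow (Nat.lt_succ_iff.1 (Finset.mem_range.1 hk)), if_neg hkq,
        mul_zero]
    · simp
  set D : ℝ := 2 ^ q * (2 * C * B ^ (q + 3)) / |iteratedDeriv q f 0| with hD
  have hD0 : 0 ≤ D := by positivity
  -- The total error is at most `D * h`; the minimum with 1 keeps the scaled arguments in `[-B, B]`,
  -- where the remainder is controlled.
  set h : ℝ := min 1 (δ / (D + 1)) with hh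
  have hh0 : 0 < h := lt_min one_pos (by positivity)
  have hh1 : |h| ≤ 1 := by rw [abs_of_pos hh0]; exact min_le_left _ _
  refine ⟨b, (h ^ q * iteratedDeriv q f 0)⁻¹, h, fun z hz => ?_⟩
  have hfun : (fun y => (∑ S : Finset (Fin q), (h ^ q * iteratedDeriv q f 0)⁻¹ * (-1) ^ (q - S.card)
        * Real.tanh (∑ i, (if i ∈ S then h else 0) * a i y + b)) - ∏ i, a i y)
      = fun y => ∑ S : Finset (Fin q), ((h ^ q * iteratedDeriv q f 0)⁻¹ * (-1) ^ (q - S.card))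
        * ρ (h * v S y) := by
    funext y
    have hne : h ^ q * iteratedDeriv q f 0 ≠ 0 := mul_ne_zero (pow_pos hh0 q).ne' hfq
    have e1 : ∏ i, a i y = (h ^ q * iteratedDeriv q f 0)⁻¹ * ∑ S : Finset (Fin q),
        (-1 : ℝ) ^ (q - S.card) * taylorPoly f 0 (q + 1) (h * v S y) := by
      rw [hpoly]; field_simp
    rw [e1, Finset.mul_sum, ← Finset.sum_sub_distrib]
    refine Finset.sum_congr rfl fun S _ => ?_
    have e2 : ∑ i, (if i ∈ S then h else 0) * a i y = h * v S y := by
      simp [hv, Finset.mul_sum, ite_mul]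
    rw [e2, hρ, hf]
    ring
  rw [hfun]
  have hs : ∀ S, ContDiff ℝ 2 fun y => ρ (h * v S y) := fun S =>
    hρs.comp (contDiff_const.mul (hvs S))
  refine (JetBound.sum (fun S _ => contDiff_const.mul (hs S))
    (fun S _ => (hcomp S h hh1 z hz).const_mul (hs S) _)).mono zero_le_one ?_
  have e3 : ∀ S : Finset (Fin q), |(h ^ q * iteratedDeriv q f 0)⁻¹ * (-1 : ℝ) ^ (q - S.card)|
      = (h ^ q * |iteratedDeriv q f 0|)⁻¹ := fun S => by
    rw [abs_mul, abs_pow, abs_neg, abs_one, one_pow, mul_one, abs_inv, abs_mul,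
      abs_of_pos (pow_pos hh0 q)]
  simp_rw [e3]
  rw [Finset.sum_const, Finset.card_univ, Fintype.card_finset, Fintype.card_fin, nsmul_eq_mul,
    abs_of_pos hh0]
  have hpos : 0 < |iteratedDeriv q f 0| := abs_pos.2 hfq
  have e4 : ((2 ^ q : ℕ) : ℝ) * ((h ^ q * |iteratedDeriv q f 0|)⁻¹ * (2 * C * B ^ (q + 3) * h ^ (q + 1)))
      = D * h := by
    rw [hD, pow_succ h]
    push_cast
    field_simp
  rw [e4]
  calc D * h ≤ (D + 1) * (δ / (D + 1)) := by
        gcongr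
        · linarith
        · exact min_le_right _ _
    _ = δ := by field_simp

end Products

/-! ### From sums of products to networks with two hidden layers. -/

section Networks

/-- Induction through the telescoping identity `a'P' - aP = (a' - a)P' + a(P' - P)`; the perturbed
factors have jets bounded by `B + 1` because `η ≤ 1`. -/
theorem JetBound.prod_sub_prod {E : Type*} [NormedAddCommGroup E] [NormedSpace ℝ E] {z : E}
    {ι : Type*} (s : Finset ι) {a a' : ι → E → ℝ} (ha : ∀ i, ContDiff ℝ 2 (a i))
    (ha' : ∀ i, ContDiff ℝ 2 (a' i)) {B η : ℝ} (hη : η ≤ 1)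
    (hB : ∀ i ∈ s, JetBound 1 B (a i) z)
    (h : ∀ i ∈ s, JetBound 1 η (fun y => a' i y - a i y) z) :
    JetBound 1 (s.card * (4 * (B + 1)) ^ s.card * η)
      (fun y => ∏ i ∈ s, a' i y - ∏ i ∈ s, a i y) z := by
  classical
  have hB' : ∀ i ∈ s, JetBound 1 (B + 1) (a' i) z := fun i hi => by
    have := (hB i hi).add (ha i) ((ha' i).sub (ha i)) (h i hi)
    simp only [add_sub_cancel] at this
    exact this.mono zero_le_one (by linarith)
  induction s using Finset.induction_on with
  | empty => simpa using JetBound.const (z := z) zero_le_one 0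
  | insert i s hi ih =>
    have ih := ih (fun j hj => hB j (Finset.mem_insert_of_mem hj))
      (fun j hj => h j (Finset.mem_insert_of_mem hj))
      (fun j hj => hB' j (Finset.mem_insert_of_mem hj))
    have h1 := (h i (Finset.mem_insert_self i s)).mul ((ha' i).sub (ha i))
      (contDiff_prod fun j _ => ha' j) zero_le_one
      (JetBound.prod (s := s) (fun j _ => ha' j) zero_le_one
        fun j hj => hB' j (Finset.mem_insert_of_mem hj))
    have h2 := (hB i (Finset.mem_insert_self i s)).mul (ha i)
      ((contDiff_prod fun j _ => ha' j).sub (contDiff_prod fun j _ => ha j)) zero_le_one ih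
    have hB0 := (hB i (Finset.mem_insert_self i s)).nonneg
    have hη0 := (h i (Finset.mem_insert_self i s)).nonneg
    have h3 := h1.add (((ha' i).sub (ha i)).mul (contDiff_prod fun j _ => ha' j))
      ((ha i).mul ((contDiff_prod fun j _ => ha' j).sub (contDiff_prod fun j _ => ha j))) h2
    have e : (fun y => (a' i y - a i y) * ∏ j ∈ s, a' j y
        + a i y * (∏ j ∈ s, a' j y - ∏ j ∈ s, a j y))
        = fun y => ∏ j ∈ insert i s, a' j y - ∏ j ∈ insert i s, a j y := by
      funext y
      rw [Finset.prod_insert hi, Finset.prod_insert hi]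
      ring
    rw [e] at h3
    refine h3.mono zero_le_one ?_
    rw [Finset.card_insert_of_notMem hi, Finset.prod_const, ← mul_pow, pow_succ]
    set Q := (4 * (B + 1)) ^ s.card with hQ
    have hQ0 : 0 ≤ Q := by positivity
    push_cast
    have : 0 ≤ (s.card : ℝ) * Q * η := by positivity
    have : 0 ≤ Q * η * B := by positivity
    nlinarith

/-- Allows units to be indexed by arbitrary finite types, such as grid points and subsets. -/
theorem exists_tanhNet_eval_eq {n : ℕ} {ι κ : Type*} [Fintype ι] [Fintype κ] (W₁ : ι → Fin n → ℝ)
    (b₁ : ι → ℝ) (W₂ : κ → ι → ℝ) (b₂ W₃ : κ → ℝ) (b₃ : ℝ) :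
    ∃ θ : TanhNet n (Fintype.card ι) (Fintype.card κ), ∀ z, θ.eval z
      = ∑ k, W₃ k * Real.tanh (∑ j, W₂ k j * Real.tanh (∑ i, W₁ j i * z i + b₁ j) + b₂ k) + b₃ := by
  let e := (Fintype.equivFin ι).symm
  let e' := (Fintype.equivFin κ).symm
  refine ⟨⟨fun j => W₁ (e j), fun j => b₁ (e j), fun k j => W₂ (e' k) (e j), fun k => b₂ (e' k),
    fun k => W₃ (e' k), b₃⟩, fun z => ?_⟩
  simp only [TanhNet.eval]
  rw [← e'.sum_comp]
  congr 1
  refine Finset.sum_congr rfl fun k _ => ?_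
  rw [← e.sum_comp]

theorem contDiff_tanh_affine {n : ℕ} {m : WithTop ℕ∞} (w : Fin n → ℝ) (β : ℝ) :
    ContDiff ℝ m fun z : Fin n → ℝ => Real.tanh (∑ i, w i * z i + β) :=
  contDiff_tanh.comp ((ContDiff.sum fun i _ => contDiff_const.mul (contDiff_apply ℝ ℝ i)).add
    contDiff_const)

theorem TanhNet.contDiff_eval {n N₁ N₂ : ℕ} {m : WithTop ℕ∞} (θ : TanhNet n N₁ N₂) :
    ContDiff ℝ m θ.eval :=
  (ContDiff.sum fun _ _ => contDiff_const.mul (contDiff_tanh.comp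
    ((ContDiff.sum fun _ _ => contDiff_const.mul (contDiff_tanh_affine _ _)).add
      contDiff_const))).add contDiff_const

/-- A coordinate is the limit of one unit. -/
theorem exists_jetBound_coord_sub_unit {n : ℕ} {K : Set (Fin n → ℝ)} (hK : IsCompact K) (i : Fin n)
    {δ : ℝ} (hδ : 0 < δ) :
    ∃ b c h c₀ : ℝ, ∀ z ∈ K,
      JetBound 1 δ (fun y => (c * Real.tanh (h * y i + b) + c₀) - y i) z := by
  -- A product with one factor. Of its two units, the one for the empty subset is the constant `-c *
  -- tanh b` and becomes `c₀`.
  obtain ⟨b, c, h, H⟩ := exists_jetBound_prod_sub_units hK (q := 1) le_rfl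
    (a := fun _ y => y i) (fun _ => contDiff_apply ℝ ℝ i) hδ
  refine ⟨b, c, h, -(c * Real.tanh b), fun z hz => ?_⟩
  have := H z hz
  have hu : (Finset.univ : Finset (Finset (Fin 1))) = {∅, {0}} := by decide
  simpa [hu, add_comm] using this

/-- Sums of products of functions in the span of the units of a first layer, of the coordinates and
of the constants are limits of networks with two hidden layers. -/
theorem exists_tanhNet_sub_sum_prod {n q : ℕ} (hq : 1 ≤ q) {J κ : Type*} [Fintype J] [Fintype κ]
    {K : Set (Fin n → ℝ)} (hK : IsCompact K) (w : J → Fin n → ℝ) (β : J → ℝ)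
    (c : κ → Fin q → ℝ) (A : κ → Fin q → J → ℝ) (B : κ → Fin q → Fin n → ℝ) {δ : ℝ} (hδ : 0 < δ) :
    ∃ θ : TanhNet n (Fintype.card (J ⊕ Fin n)) (Fintype.card (κ × Finset (Fin q))), ∀ z ∈ K,
      JetBound 1 δ (fun y => θ.eval y - ∑ k, ∏ m, (c k m
        + ∑ j, A k m j * Real.tanh (∑ i, w j i * y i + β j) + ∑ i, B k m i * y i)) z := by
  classical
  set a : κ → Fin q → (Fin n → ℝ) → ℝ := fun k m y => c k m
    + ∑ j, A k m j * Real.tanh (∑ i, w j i * y i + β j) + ∑ i, B k m i * y i with hadef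
  have ha : ∀ k m, ContDiff ℝ 2 (a k m) := fun k m =>
    (contDiff_const.add (ContDiff.sum fun j _ => contDiff_const.mul (contDiff_tanh_affine _ _))).add
      (ContDiff.sum fun i _ => contDiff_const.mul (contDiff_apply ℝ ℝ i))
  obtain ⟨M, hM1, hM⟩ : ∃ M, 1 ≤ M ∧ ∀ k m, ∀ z ∈ K, JetBound 1 M (a k m) z := by
    choose M hM1 hM using fun p : κ × Fin q => JetBound.of_isCompact hK (ha p.1 p.2)
    refine ⟨1 + ∑ p, M p, ?_, fun k m z hz => (hM (k, m) z hz).mono zero_le_one ?_⟩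
    · have : 0 ≤ ∑ p, M p := Finset.sum_nonneg fun p _ => zero_le_one.trans (hM1 p)
      linarith
    · have := Finset.single_le_sum (f := M) (fun p _ => zero_le_one.trans (hM1 p))
        (Finset.mem_univ (k, m))
      linarith
  -- tolerances
  set Q : ℝ := q * (4 * (M + 1)) ^ q with hQ
  have hQ0 : 0 ≤ Q := by positivity
  -- Half of `δ` pays for replacing coordinates by units inside the factors, which costs at most `Q
  -- * η` per product; the other half pays for replacing products by units.
  set η : ℝ := min 1 (δ / (2 * (Fintype.card κ * Q + 1))) with hη
  have hη0 : 0 < η := lt_min one_pos (by positivity)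
  set S : ℝ := 1 + ∑ k, ∑ m, ∑ i, |B k m i| with hS
  have hS0 : 0 < S := by positivity
  choose b' c' h' c₀ hX using fun i : Fin n =>
    exists_jetBound_coord_sub_unit hK i (div_pos hη0 hS0)
  set X : Fin n → (Fin n → ℝ) → ℝ := fun i y => c' i * Real.tanh (h' i * y i + b' i) + c₀ i with hXdef
  have hXs : ∀ i, ContDiff ℝ 2 (X i) := fun i =>
    (contDiff_const.mul (contDiff_tanh.comp ((contDiff_const.mul (contDiff_apply ℝ ℝ i)).add
      contDiff_const))).add contDiff_const
  set a' : κ → Fin q → (Fin n → ℝ) → ℝ := fun k m y => c k m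
    + ∑ j, A k m j * Real.tanh (∑ i, w j i * y i + β j) + ∑ i, B k m i * X i y with ha'def
  have ha' : ∀ k m, ContDiff ℝ 2 (a' k m) := fun k m =>
    (contDiff_const.add (ContDiff.sum fun j _ => contDiff_const.mul (contDiff_tanh_affine _ _))).add
      (ContDiff.sum fun i _ => contDiff_const.mul (hXs i))
  have haa : ∀ k m, ∀ z ∈ K, JetBound 1 η (fun y => a' k m y - a k m y) z := by
    intro k m z hz
    have e : (fun y => a' k m y - a k m y) = fun y => ∑ i, B k m i * (X i y - y i) := by
      funext y
      simp only [ha'def, hadef, mul_sub, Finset.sum_sub_distrib]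
      ring
    rw [e]
    have hs : ∀ i, ContDiff ℝ 2 fun y : Fin n → ℝ => X i y - y i := fun i =>
      (hXs i).sub (contDiff_apply ℝ ℝ i)
    refine (JetBound.sum (fun i _ => contDiff_const.mul (hs i))
      (fun i _ => (hX i z hz).const_mul (hs i) (B k m i))).mono zero_le_one ?_
    rw [← Finset.sum_mul, mul_div_assoc', div_le_iff₀ hS0, mul_comm]
    refine mul_le_mul_of_nonneg_left ?_ hη0.le
    have h1 := Finset.single_le_sum (f := fun k => ∑ m, ∑ i, |B k m i|)
      (fun k _ => by positivity) (Finset.mem_univ k)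
    have h2 := Finset.single_le_sum (f := fun m => ∑ i, |B k m i|)
      (fun k _ => by positivity) (Finset.mem_univ m)
    linarith
  -- the second layer
  choose b s h hU using fun k : κ => exists_jetBound_prod_sub_units hK hq (ha' k)
    (show 0 < δ / (2 * (Fintype.card κ + 1)) by positivity)
  -- The first layer consists of the given units and one unit per coordinate. The second has a unit
  -- for each product `k` and subset of its factors; since the factors are affine in the first
  -- layer, they are absorbed into weights and biases.
  obtain ⟨θ, hθ⟩ := exists_tanhNet_eval_eq (n := n) (ι := J ⊕ Fin n) (κ := κ × Finset (Fin q))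
    (Sum.elim w fun i => Pi.single i (h' i)) (Sum.elim β b')
    (fun p => Sum.elim (fun j => ∑ m, (if m ∈ p.2 then h p.1 else 0) * A p.1 m j)
      (fun i => ∑ m, (if m ∈ p.2 then h p.1 else 0) * (B p.1 m i * c' i)))
    (fun p => ∑ m, (if m ∈ p.2 then h p.1 else 0) * (c p.1 m + ∑ i, B p.1 m i * c₀ i) + b p.1)
    (fun p => s p.1 * (-1) ^ (q - p.2.card)) 0
  refine ⟨θ, fun z hz => ?_⟩
  have e : ∀ y, θ.eval y = ∑ k, ∑ T : Finset (Fin q), s k * (-1) ^ (q - T.card)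
      * Real.tanh (∑ m, (if m ∈ T then h k else 0) * a' k m y + b k) := by
    intro y
    rw [hθ, add_zero, Fintype.sum_prod_type]
    refine Finset.sum_congr rfl fun k _ => Finset.sum_congr rfl fun T _ => ?_
    congr 2
    rw [← add_assoc]
    congr 1
    simp only [Fintype.sum_sum_type, Sum.elim_inl, Sum.elim_inr, ha'def, hXdef, Finset.sum_mul]
    rw [Finset.sum_comm, Finset.sum_comm (s := (Finset.univ : Finset (Fin n))),
      ← Finset.sum_add_distrib, ← Finset.sum_add_distrib]
    refine Finset.sum_congr rfl fun m _ => ?_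
    have e1 : ∀ i : Fin n, ∑ x, (Pi.single i (h' i) : Fin n → ℝ) x * y x = h' i * y i := fun i => by
      rw [Finset.sum_eq_single i] <;> simp +contextual
    simp only [e1, mul_add, Finset.mul_sum, Finset.sum_add_distrib]
    have : ∀ u v w x : ℝ, u + v + (w + x) = w + u + (v + x) := fun u v w x => by ring
    rw [this]
    congr 1
    · congr 1
      exact Finset.sum_congr rfl fun j _ => by ring
    · congr 1
      exact Finset.sum_congr rfl fun j _ => by ring
  have hs1 : ∀ k, ContDiff ℝ 2 fun y => ∑ T : Finset (Fin q), s k * (-1) ^ (q - T.card)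
      * Real.tanh (∑ m, (if m ∈ T then h k else 0) * a' k m y + b k) := fun k =>
    ContDiff.sum fun T _ => contDiff_const.mul (contDiff_tanh.comp
      ((ContDiff.sum fun m _ => contDiff_const.mul (ha' k m)).add contDiff_const))
  have hs2 : ∀ k, ContDiff ℝ 2 fun y => ∏ m, a' k m y := fun k => contDiff_prod fun m _ => ha' k m
  have hs3 : ∀ k, ContDiff ℝ 2 fun y => ∏ m, a k m y := fun k => contDiff_prod fun m _ => ha k m
  have h1 := JetBound.sum (s := Finset.univ) (fun k _ => (hs1 k).sub (hs2 k))
    (fun k _ => hU k z hz)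
  have h2 := JetBound.sum (s := Finset.univ) (fun k _ => (hs2 k).sub (hs3 k)) (fun k _ =>
    JetBound.prod_sub_prod Finset.univ (ha k) (ha' k) (min_le_left _ _) (fun m _ => hM k m z hz)
      (fun m _ => haa k m z hz))
  have h3 := h1.add (ContDiff.sum fun k _ => (hs1 k).sub (hs2 k))
    (ContDiff.sum fun k _ => (hs2 k).sub (hs3 k)) h2
  have e2 : (fun y => θ.eval y - ∑ k, ∏ m, a k m y) = fun y =>
      ∑ k, (∑ T : Finset (Fin q), s k * (-1) ^ (q - T.card)
        * Real.tanh (∑ m, (if m ∈ T then h k else 0) * a' k m y + b k) - ∏ m, a' k m y)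
      + ∑ k, (∏ m, a' k m y - ∏ m, a k m y) := by
    funext y
    rw [e y, ← Finset.sum_add_distrib, ← Finset.sum_sub_distrib]
    exact Finset.sum_congr rfl fun k _ => by ring
  rw [e2]
  refine h3.mono zero_le_one ?_
  simp only [Finset.sum_const, Finset.card_univ, Fintype.card_fin, nsmul_eq_mul]
  have g1 : (Fintype.card κ : ℝ) * (δ / (2 * (Fintype.card κ + 1))) ≤ δ / 2 := by
    rw [mul_div_assoc', div_le_div_iff₀ (by positivity) (by positivity)]
    nlinarith
  have g2 : (Fintype.card κ : ℝ) * (Q * η) ≤ δ / 2 := by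
    calc (Fintype.card κ : ℝ) * (Q * η)
        ≤ (Fintype.card κ : ℝ) * (Q * (δ / (2 * (Fintype.card κ * Q + 1)))) := by
          gcongr; exact min_le_right _ _
      _ = (Fintype.card κ * Q) * δ / (2 * (Fintype.card κ * Q + 1)) := by ring
      _ ≤ δ / 2 := by
          rw [div_le_div_iff₀ (by positivity) (by positivity)]
          nlinarith
  linarith

end Networks

/-! ### Exponential decay of tanh towards its limits. -/

section TanhDecay

theorem one_sub_tanh_le (x : ℝ) : 1 - Real.tanh x ≤ 2 * Real.exp (-(2 * x)) := by
  rw [Real.tanh_eq, one_sub_div (by positivity), div_le_iff₀ (by positivity)]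
  have : Real.exp (-(2 * x)) * Real.exp x = Real.exp (-x) := by
    rw [← Real.exp_add]; ring_nf
  have : 0 < Real.exp (-(2 * x)) * Real.exp (-x) := by positivity
  nlinarith

theorem one_add_tanh_le (x : ℝ) : 1 + Real.tanh x ≤ 2 * Real.exp (2 * x) := by
  have := one_sub_tanh_le (-x)
  rw [Real.tanh_neg] at this
  simpa using this

theorem one_sub_tanh_sq_le (x : ℝ) : 1 - Real.tanh x ^ 2 ≤ 4 * Real.exp (-(2 * |x|)) := by
  have h1 := Real.tanh_lt_one x
  have h2 := Real.neg_one_lt_tanh x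
  rcases abs_cases x with ⟨h, _⟩ | ⟨h, _⟩ <;> rw [h]
  · have := one_sub_tanh_le x
    nlinarith
  · have := one_add_tanh_le x
    rw [show -(2 * -x) = 2 * x by ring]
    nlinarith

theorem hasDerivAt_tanh (x : ℝ) : HasDerivAt Real.tanh (1 - Real.tanh x ^ 2) x := by
  have e : Real.tanh = fun x => Real.sinh x / Real.cosh x := funext Real.tanh_eq_sinh_div_cosh
  have h := (Real.hasDerivAt_sinh x).div (Real.hasDerivAt_cosh x) (Real.cosh_pos x).ne'
  rw [e]
  convert! h using 1
  have := (Real.cosh_pos x).ne'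
  field_simp

theorem abs_iteratedDeriv_tanh_le {k : ℕ} (hk : 1 ≤ k) (hk2 : k ≤ 2) (x : ℝ) :
    |iteratedDeriv k Real.tanh x| ≤ 8 * Real.exp (-(2 * |x|)) := by
  have hd : deriv Real.tanh = fun x => 1 - Real.tanh x ^ 2 := funext fun x => (hasDerivAt_tanh x).deriv
  have h0 := one_sub_tanh_sq_le x
  have h1 := (Real.tanh_sq_lt_one x).le
  have he := Real.exp_pos (-(2 * |x|))
  interval_cases k
  · rw [iteratedDeriv_one, hd, abs_of_nonneg (by linarith)]
    linarith
  · have h2 : HasDerivAt (fun x => 1 - Real.tanh x ^ 2)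
        (-(2 * Real.tanh x * (1 - Real.tanh x ^ 2))) x := by
      convert! ((hasDerivAt_tanh x).pow 2).const_sub 1 using 1
      ring
    rw [iteratedDeriv_succ, iteratedDeriv_one, hd, h2.deriv, abs_neg, abs_mul, abs_mul,
      abs_of_nonneg (show (0 : ℝ) ≤ 1 - Real.tanh x ^ 2 by linarith), abs_two]
    have := (Real.abs_tanh_lt_one x).le
    nlinarith [abs_nonneg (Real.tanh x)]

end TanhDecay

/-! ### A one-dimensional partition of unity made of tanh steps. -/

section Partition

/-- The step functions `tanh (t - j)`, replaced by constants at both ends. -/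
def tanhStep (N j : ℕ) (t : ℝ) : ℝ :=
  if j = 0 then 1 else if j = N then -1 else Real.tanh (t - j)

/-- A partition of unity on `[0, N]` subordinate, up to exponential tails, to the unit intervals. -/
def tanhBump (N j : ℕ) (t : ℝ) : ℝ := (tanhStep N j t - tanhStep N (j + 1) t) / 2

theorem contDiff_tanhStep (N j : ℕ) {m : WithTop ℕ∞} : ContDiff ℝ m (tanhStep N j) := by
  unfold tanhStep
  split_ifs
  · exact contDiff_const
  · exact contDiff_const
  · exact contDiff_tanh.comp (contDiff_id.sub contDiff_const)

theorem contDiff_tanhBump (N j : ℕ) {m : WithTop ℕ∞} : ContDiff ℝ m (tanhBump N j) :=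
  ((contDiff_tanhStep N j).sub (contDiff_tanhStep N (j + 1))).div_const 2

/-- The sum telescopes to half the difference of the end steps; this is why they are frozen to the
constants 1 and -1. -/
theorem sum_tanhBump {N : ℕ} (hN : 1 ≤ N) (t : ℝ) : ∑ j ∈ Finset.range N, tanhBump N j t = 1 := by
  simp only [tanhBump]
  rw [← Finset.sum_div, Finset.sum_range_sub']
  have : N ≠ 0 := by omega
  simp [tanhStep, this]

theorem abs_tanhStep_le (N j : ℕ) (t : ℝ) : |tanhStep N j t| ≤ 1 := by
  unfold tanhStep
  split_ifs
  · simp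
  · simp
  · exact (Real.abs_tanh_lt_one _).le

theorem abs_iteratedDeriv_tanhStep_le (N j : ℕ) {k : ℕ} (hk : 1 ≤ k) (hk2 : k ≤ 2) (t : ℝ) :
    |iteratedDeriv k (tanhStep N j) t| ≤ 8 * Real.exp (-(2 * |t - j|)) := by
  have hz : ∀ c : ℝ, |iteratedDeriv k (fun _ : ℝ => c) t| ≤ 8 * Real.exp (-(2 * |t - j|)) := by
    intro c
    rw [iteratedDeriv_const, if_neg (by omega), abs_zero]
    positivity
  by_cases h0 : j = 0
  · have : tanhStep N j = fun _ => 1 := by funext t; simp [tanhStep, h0]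
    rw [this]; exact hz 1
  by_cases hN : j = N
  · have : tanhStep N j = fun _ => -1 := by funext t; simp [tanhStep, h0, ← hN]
    rw [this]; exact hz (-1)
  have : tanhStep N j = fun t => Real.tanh (t - j) := by funext t; simp [tanhStep, h0, hN]
  rw [this, iteratedDeriv_comp_sub_const]
  exact abs_iteratedDeriv_tanh_le hk hk2 _

/-- Far from `j` both steps are exponentially close to the same value 1 or -1, so their difference
decays; their derivatives decay separately. The factor `exp 2` pays for moving the centre from `j +
1` to `j`. The restriction to `[0, N]` matters because the first and last bumps do not decay outside
it. -/
theorem abs_iteratedDeriv_tanhBump_le {N j : ℕ} {k : ℕ} (hk2 : k ≤ 2) {t : ℝ}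
    (ht : 0 ≤ t) (htN : t ≤ N) :
    |iteratedDeriv k (tanhBump N j) t| ≤ 8 * Real.exp 2 * Real.exp (-(2 * |t - j|)) := by
  have hshift : Real.exp (-(2 * |t - (j + 1 : ℕ)|)) ≤ Real.exp 2 * Real.exp (-(2 * |t - j|)) := by
    rw [← Real.exp_add]
    apply Real.exp_le_exp.2
    have : |t - j| ≤ |t - (j + 1 : ℕ)| + 1 := by
      have := abs_add_le (t - (j + 1 : ℕ)) 1
      rw [abs_one] at this
      refine le_trans (le_of_eq ?_) this
      congr 1; push_cast; ring
    linarith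
  have he1 : 1 ≤ Real.exp 2 := Real.one_le_exp (by norm_num)
  have he := Real.exp_pos (-(2 * |t - j|))
  rcases Nat.eq_zero_or_pos k with rfl | hk
  · rw [iteratedDeriv_zero]
    by_cases h1 : |t - j| ≤ 1
    · have : 1 ≤ Real.exp 2 * Real.exp (-(2 * |t - j|)) := by
        rw [← Real.exp_add]
        exact Real.one_le_exp (by linarith)
      have h2 := abs_le.1 (abs_tanhStep_le N j t)
      have h3 := abs_le.1 (abs_tanhStep_le N (j + 1) t)
      have : |tanhBump N j t| ≤ 1 := by
        rw [tanhBump, abs_le]; constructor <;> linarith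
      nlinarith
    · rw [not_le, lt_abs] at h1
      rcases h1 with h1 | h1
      · have hjN : j + 1 < N := by
          have : ((j + 1 : ℕ) : ℝ) < N := by push_cast; linarith
          exact_mod_cast this
        have h2 : 0 ≤ 1 - tanhStep N j t ∧ 1 - tanhStep N j t ≤ 2 * Real.exp (-(2 * |t - j|)) := by
          unfold tanhStep
          rw [if_neg (show j ≠ N by omega), abs_of_pos (by linarith : (0 : ℝ) < t - j)]
          split_ifs
          · simp; positivity
          · exact ⟨by linarith [Real.tanh_lt_one (t - j)], one_sub_tanh_le _⟩
        have h3 : 0 ≤ 1 - tanhStep N (j + 1) t ∧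
            1 - tanhStep N (j + 1) t ≤ 2 * Real.exp (-(2 * |t - (j + 1 : ℕ)|)) := by
          unfold tanhStep
          rw [if_neg (by omega), if_neg (by omega),
            abs_of_pos (by push_cast; linarith : (0 : ℝ) < t - (j + 1 : ℕ))]
          exact ⟨by linarith [Real.tanh_lt_one (t - (j + 1 : ℕ))], one_sub_tanh_le _⟩
        have e : tanhBump N j t = ((1 - tanhStep N (j + 1) t) - (1 - tanhStep N j t)) / 2 := by
          rw [tanhBump]; ring
        rw [e, abs_le]
        constructor <;> nlinarith
      · have hj0 : j ≠ 0 := by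
          rintro rfl
          simp at h1; linarith
        have hN : j ≠ 0 := hj0
        by_cases hjN : j = N
        · subst hjN
          have e : |t - j| = j - t := by rw [abs_of_neg (by linarith)]; ring
          have h2 : tanhBump j j t = (tanhStep j j t - tanhStep j (j + 1) t) / 2 := rfl
          have h3 : 1 + tanhStep j (j + 1) t ≤ 2 * Real.exp (-(2 * |t - (j + 1 : ℕ)|)) := by
            unfold tanhStep
            rw [if_neg (by omega), if_neg (by omega),
              abs_of_neg (by push_cast; linarith : t - (j + 1 : ℕ) < 0)]
            have := one_add_tanh_le (t - (j + 1 : ℕ))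
            rwa [show -(2 * -(t - ((j + 1 : ℕ) : ℝ))) = 2 * (t - (j + 1 : ℕ)) by ring]
          have h4 := abs_le.1 (abs_tanhStep_le j (j + 1) t)
          have h5 : tanhStep j j t = -1 := by simp [tanhStep, hj0]
          rw [h2, h5, abs_le]
          constructor <;> nlinarith
        have h2 : 0 ≤ 1 + tanhStep N j t ∧ 1 + tanhStep N j t ≤ 2 * Real.exp (-(2 * |t - j|)) := by
          unfold tanhStep
          rw [if_neg hj0, if_neg hjN, abs_of_neg (by linarith : t - j < 0),
            show -(2 * -(t - (j : ℝ))) = 2 * (t - j) by ring]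
          exact ⟨by linarith [Real.neg_one_lt_tanh (t - j)], one_add_tanh_le _⟩
        have h3 : 0 ≤ 1 + tanhStep N (j + 1) t ∧
            1 + tanhStep N (j + 1) t ≤ 2 * Real.exp (-(2 * |t - (j + 1 : ℕ)|)) := by
          unfold tanhStep
          rw [if_neg (by omega), abs_of_neg (by push_cast; linarith : t - (j + 1 : ℕ) < 0),
            show -(2 * -(t - ((j + 1 : ℕ) : ℝ))) = 2 * (t - (j + 1 : ℕ)) by ring]
          split_ifs
          · simp; positivity
          · exact ⟨by linarith [Real.neg_one_lt_tanh (t - (j + 1 : ℕ))], one_add_tanh_le _⟩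
        have e : tanhBump N j t = ((1 + tanhStep N j t) - (1 + tanhStep N (j + 1) t)) / 2 := by
          rw [tanhBump]; ring
        rw [e, abs_le]
        constructor <;> nlinarith
  · have e : iteratedDeriv k (tanhBump N j) t
        = (iteratedDeriv k (tanhStep N j) t - iteratedDeriv k (tanhStep N (j + 1)) t) / 2 := by
      unfold tanhBump
      rw [iteratedDeriv_div_const, iteratedDeriv_fun_sub (contDiff_tanhStep N j).contDiffAt
        (contDiff_tanhStep N (j + 1)).contDiffAt]
    have h2 := abs_le.1 (abs_iteratedDeriv_tanhStep_le N j hk hk2 t)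
    have h3 := abs_le.1 (abs_iteratedDeriv_tanhStep_le N (j + 1) hk hk2 t)
    rw [e, abs_le]
    constructor <;> nlinarith

/-- Rounding `t` down to an integer costs a factor `e`, after which the sum is part of the
convergent series of `exp (-|m|)` over the integers. -/
theorem exists_sum_exp_neg_abs_le : ∃ C : ℝ, 0 ≤ C ∧ ∀ (N : ℕ) (t : ℝ),
    ∑ j ∈ Finset.range N, Real.exp (-|t - j|) ≤ C := by
  have hs : Summable fun m : ℤ => Real.exp (-|(m : ℝ)|) := by
    refine Summable.of_nat_of_neg ?_ ?_ <;> simpa using Real.summable_exp_neg_nat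
  refine ⟨Real.exp 1 * ∑' m : ℤ, Real.exp (-|(m : ℝ)|), by positivity, fun N t => ?_⟩
  have h1 : ∀ j ∈ Finset.range N, Real.exp (-|t - j|)
      ≤ Real.exp 1 * Real.exp (-|(((j : ℤ) - ⌊t⌋ : ℤ) : ℝ)|) := by
    intro j _
    rw [← Real.exp_add]
    apply Real.exp_le_exp.2
    have h2 : |(((j : ℤ) - ⌊t⌋ : ℤ) : ℝ)| = |(t - j) - (t - ⌊t⌋)| := by
      rw [← abs_neg]; congr 1; push_cast; ring
    have h3 : |(t - j) - (t - ⌊t⌋)| ≤ |t - j| + |t - ⌊t⌋| := by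
      simpa only [Real.norm_eq_abs] using norm_sub_le (t - (j : ℝ)) (t - (⌊t⌋ : ℝ))
    have h4 : |t - ⌊t⌋| ≤ 1 := by
      rw [abs_of_nonneg (by linarith [Int.floor_le t])]
      linarith [Int.lt_floor_add_one t]
    rw [h2]; linarith
  refine (Finset.sum_le_sum h1).trans ?_
  rw [← Finset.mul_sum]
  refine mul_le_mul_of_nonneg_left ?_ (Real.exp_pos 1).le
  have hinj : Function.Injective fun j : ℕ => (j : ℤ) - ⌊t⌋ := fun a b h => by simpa using h
  calc ∑ j ∈ Finset.range N, Real.exp (-|(((j : ℤ) - ⌊t⌋ : ℤ) : ℝ)|)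
      ≤ ∑' j : ℕ, Real.exp (-|(((j : ℤ) - ⌊t⌋ : ℤ) : ℝ)|) :=
        (hs.comp_injective hinj).sum_le_tsum _ fun _ _ => (Real.exp_pos _).le
    _ ≤ _ := (hs.comp_injective hinj).tsum_le_tsum_of_inj _ hinj (fun _ _ => (Real.exp_pos _).le)
        (fun _ => le_rfl) hs

/-- Half of the exponential decay absorbs the polynomial weight through `x ^ s ≤ s! * exp x`,
applied at `x = 1 + |t - j|`. -/
theorem exists_sum_pow_mul_exp_le (s : ℕ) : ∃ C : ℝ, 0 ≤ C ∧ ∀ (N : ℕ) (t : ℝ),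
    ∑ j ∈ Finset.range N, Real.exp (-(2 * |t - j|)) * (1 + |t - j|) ^ s ≤ C := by
  obtain ⟨C, hC0, hC⟩ := exists_sum_exp_neg_abs_le
  refine ⟨s.factorial * Real.exp 1 * C, by positivity, fun N t => ?_⟩
  refine (Finset.sum_le_sum fun j _ => ?_).trans
    ((Finset.mul_sum _ _ _).symm.le.trans (mul_le_mul_of_nonneg_left (hC N t) (by positivity)))
  have h1 := Real.pow_div_factorial_le_exp (1 + |t - j|) (by positivity) s
  rw [div_le_iff₀ (by positivity)] at h1
  calc Real.exp (-(2 * |t - j|)) * (1 + |t - j|) ^ s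
      ≤ Real.exp (-(2 * |t - j|)) * (Real.exp (1 + |t - j|) * s.factorial) := by gcongr
    _ = s.factorial * (Real.exp (-(2 * |t - j|)) * Real.exp (1 + |t - j|)) := by ring
    _ = s.factorial * (Real.exp 1 * Real.exp (-|t - j|)) := by
        rw [← Real.exp_add, ← Real.exp_add]; ring_nf
    _ = _ := by ring

end Partition

/-! ### Blending local Taylor polynomials on a grid in the box. -/

section LocalTaylor

variable {n : ℕ}

/-- One factor of the tensor product partition of unity on the box. -/
def coordBump (lo hi : Fin n → ℝ) (N j : ℕ) (i : Fin n) (z : Fin n → ℝ) : ℝ :=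
  tanhBump N j (N / (hi i - lo i) * z i - N / (hi i - lo i) * lo i)

/-- The nodes of the uniform grid of mesh `1 / N` in the box. -/
def boxNode (lo hi : Fin n → ℝ) (N : ℕ) (j : Fin n → Fin N) (i : Fin n) : ℝ :=
  lo i + (j i : ℝ) / N * (hi i - lo i)

theorem contDiff_coordBump (lo hi : Fin n → ℝ) (N j : ℕ) (i : Fin n) {m : WithTop ℕ∞} :
    ContDiff ℝ m (coordBump lo hi N j i) :=
  (contDiff_tanhBump N j).comp ((contDiff_const.mul (contDiff_apply ℝ ℝ i)).sub contDiff_const)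

theorem boxNode_mem {lo hi : Fin n → ℝ} (h : ∀ i, lo i < hi i) {N : ℕ} (j : Fin n → Fin N) :
    boxNode lo hi N j ∈ Set.Icc lo hi := by
  refine ⟨fun i => ?_, fun i => ?_⟩ <;> have h1 := h i <;> have h2 := (j i).2 <;>
    have hN : (0 : ℝ) < N := by exact_mod_cast (Nat.zero_le _).trans_lt h2
  · have : 0 ≤ ((j i : ℕ) : ℝ) / N * (hi i - lo i) :=
      mul_nonneg (by positivity) (by linarith)
    simp only [boxNode]; linarith
  · have h3 : ((j i : ℕ) : ℝ) / N ≤ 1 := by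
      rw [div_le_one hN]; exact_mod_cast h2.le
    have : ((j i : ℕ) : ℝ) / N * (hi i - lo i) ≤ 1 * (hi i - lo i) :=
      mul_le_mul_of_nonneg_right h3 (by linarith)
    simp only [boxNode]; linarith

theorem sum_prod_coordBump (lo hi : Fin n → ℝ) {N : ℕ} (hN : 1 ≤ N) (z : Fin n → ℝ) :
    ∑ j : Fin n → Fin N, ∏ i, coordBump lo hi N (j i) i z = 1 := by
  have h := Finset.prod_univ_sum (fun _ : Fin n => (Finset.univ : Finset (Fin N)))
    (fun i j => coordBump lo hi N j i z)
  rw [Fintype.piFinset_univ] at h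
  rw [← h]
  refine Finset.prod_eq_one fun i _ => ?_
  rw [← Finset.sum_range (fun j => coordBump lo hi N j i z)]
  exact sum_tanhBump hN _

theorem scaled_mem {lo hi : Fin n → ℝ} (h : ∀ i, lo i < hi i) (N : ℕ) {z : Fin n → ℝ}
    (hz : z ∈ Set.Icc lo hi) (i : Fin n) :
    0 ≤ N / (hi i - lo i) * z i - N / (hi i - lo i) * lo i ∧
      N / (hi i - lo i) * z i - N / (hi i - lo i) * lo i ≤ N := by
  have h1 : 0 < hi i - lo i := sub_pos.2 (h i)
  have h2 := hz.1 i
  have h3 := hz.2 i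
  rw [← mul_sub]
  constructor
  · exact mul_nonneg (by positivity) (by linarith)
  · calc N / (hi i - lo i) * (z i - lo i) ≤ N / (hi i - lo i) * (hi i - lo i) := by
          gcongr
      _ = N := by field_simp

/-- Chain rule for an affine map of slope `N / (hi i - lo i)`: each derivative costs a factor `N *
Λ`. -/
theorem jetBound_coordBump {lo hi : Fin n → ℝ} (h : ∀ i, lo i < hi i) {Λ : ℝ} (hΛ1 : 1 ≤ Λ)
    (hΛ : ∀ i, (hi i - lo i)⁻¹ ≤ Λ) (N j : ℕ) (i : Fin n) {z : Fin n → ℝ}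
    (hz : z ∈ Set.Icc lo hi) :
    JetBound N (8 * Real.exp 2 * Λ ^ 2
      * Real.exp (-(2 * |N / (hi i - lo i) * z i - N / (hi i - lo i) * lo i - j|)))
      (coordBump lo hi N j i) z := by
  intro k hk
  set ℓ : ℝ := N / (hi i - lo i) with hℓ
  have hlen : 0 < hi i - lo i := sub_pos.2 (h i)
  have hℓ0 : 0 ≤ ℓ := by positivity
  set L : (Fin n → ℝ) →L[ℝ] ℝ := ℓ • ContinuousLinearMap.proj i with hL
  have hLn : ‖L‖ ≤ ℓ := by
    refine ContinuousLinearMap.opNorm_le_bound _ hℓ0 fun x => ?_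
    rw [hL]
    simp only [smul_apply, ContinuousLinearMap.proj_apply, norm_smul]
    rw [Real.norm_of_nonneg hℓ0]
    gcongr
    exact norm_le_pi_norm x i
  have e : coordBump lo hi N j i = (fun u => tanhBump N j (u - ℓ * lo i)) ∘ L := by
    funext z; simp [coordBump, hL, hℓ]
  have hs : ContDiff ℝ 2 fun u => tanhBump N j (u - ℓ * lo i) :=
    (contDiff_tanhBump N j).comp (contDiff_id.sub contDiff_const)
  rw [e, L.iteratedFDeriv_comp_right hs z (by exact_mod_cast hk)]
  refine (ContinuousMultilinearMap.norm_compContinuousLinearMap_le _ _).trans ?_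
  rw [norm_iteratedFDeriv_eq_norm_iteratedDeriv, iteratedDeriv_comp_sub_const, Real.norm_eq_abs,
    Finset.prod_const, Finset.card_univ, Fintype.card_fin]
  have hLz : L z = ℓ * z i := by simp [hL]
  have hm := scaled_mem h N hz i
  rw [hLz]
  have h1 := abs_iteratedDeriv_tanhBump_le (N := N) (j := j) hk hm.1 hm.2
  calc |iteratedDeriv k (tanhBump N j) (ℓ * z i - ℓ * lo i)| * ‖L‖ ^ k
      ≤ (8 * Real.exp 2 * Real.exp (-(2 * |ℓ * z i - ℓ * lo i - j|))) * (Λ ^ k * N ^ k) := by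
        rw [← mul_pow]
        gcongr
        refine hLn.trans ?_
        rw [hℓ, div_eq_mul_inv, mul_comm]
        exact mul_le_mul_of_nonneg_right (hΛ i) (by positivity)
    _ ≤ (8 * Real.exp 2 * Real.exp (-(2 * |ℓ * z i - ℓ * lo i - j|))) * (Λ ^ 2 * N ^ k) := by
        gcongr
    _ = _ := by ring

/-- The maximum over coordinates is bounded by a product of the numbers `1 + |·|`, so that powers of
the distance can be summed against tensor-product bumps one coordinate at a time. -/
theorem norm_sub_boxNode_le {lo hi : Fin n → ℝ} (h : ∀ i, lo i < hi i) {Λ : ℝ} (hΛ0 : 0 ≤ Λ)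
    (hΛ : ∀ i, hi i - lo i ≤ Λ) {N : ℕ} (hN : 1 ≤ N) (j : Fin n → Fin N) (z : Fin n → ℝ) :
    ‖z - boxNode lo hi N j‖ ≤ Λ / N
      * ∏ i, (1 + |N / (hi i - lo i) * z i - N / (hi i - lo i) * lo i - (j i : ℕ)|) := by
  have hN0 : (0 : ℝ) < N := by exact_mod_cast hN
  refine (pi_norm_le_iff_of_nonneg (by positivity)).2 fun i => ?_
  have hlen : 0 < hi i - lo i := sub_pos.2 (h i)
  have e : z i - boxNode lo hi N j i
      = (hi i - lo i) / N * (N / (hi i - lo i) * z i - N / (hi i - lo i) * lo i - (j i : ℕ)) := by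
    simp only [boxNode]; field_simp; ring
  rw [Pi.sub_apply, Real.norm_eq_abs, e, abs_mul, abs_of_pos (by positivity)]
  have h1 : |N / (hi i - lo i) * z i - N / (hi i - lo i) * lo i - (j i : ℕ)|
      ≤ ∏ i, (1 + |N / (hi i - lo i) * z i - N / (hi i - lo i) * lo i - (j i : ℕ)|) := by
    rw [← Finset.mul_prod_erase _ _ (Finset.mem_univ i)]
    have h2 : 1 ≤ ∏ k ∈ Finset.univ.erase i,
        (1 + |N / (hi k - lo k) * z k - N / (hi k - lo k) * lo k - (j k : ℕ)|) :=
      Finset.one_le_prod fun k _ => by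
        linarith [abs_nonneg (N / (hi k - lo k) * z k - N / (hi k - lo k) * lo k - (j k : ℕ))]
    have h3 := abs_nonneg (N / (hi i - lo i) * z i - N / (hi i - lo i) * lo i - (j i : ℕ))
    nlinarith
  gcongr
  exact hΛ i

/-- The blended local Taylor polynomials approximate to optimal order. -/
theorem exists_jetBound_sub_blended_taylor {lo hi : Fin n → ℝ} (h : ∀ i, lo i < hi i) {s : ℕ}
    (hs : 2 ≤ s) : ∃ C₁ : ℝ, 0 ≤ C₁ ∧ ∀ f : (Fin n → ℝ) → ℝ, ContDiff ℝ s f → ∀ C : ℝ,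
      (∀ z ∈ Set.Icc lo hi, ‖iteratedFDeriv ℝ s f z‖ ≤ C) → ∀ N : ℕ, 1 ≤ N →
      ∀ z ∈ Set.Icc lo hi, JetBound N (C * C₁ / N ^ s) (fun y => f y
        - ∑ j : Fin n → Fin N, (∏ i, coordBump lo hi N (j i) i y)
          * taylorPoly f (boxNode lo hi N j) s y) z := by
  obtain ⟨Λ, hΛ1, hΛ, hΛ'⟩ : ∃ Λ : ℝ, 1 ≤ Λ ∧ (∀ i, (hi i - lo i)⁻¹ ≤ Λ) ∧ ∀ i, hi i - lo i ≤ Λ := by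
    have hp : ∀ i, 0 < hi i - lo i := fun i => sub_pos.2 (h i)
    have h1 : ∀ i, 0 ≤ (hi i - lo i)⁻¹ + (hi i - lo i) := fun i => by
      have := hp i; positivity
    refine ⟨1 + ∑ i, ((hi i - lo i)⁻¹ + (hi i - lo i)), ?_, fun i => ?_, fun i => ?_⟩
    · linarith [Finset.sum_nonneg fun i (_ : i ∈ Finset.univ) => h1 i]
    · have := Finset.single_le_sum (f := fun i => (hi i - lo i)⁻¹ + (hi i - lo i))
        (fun i _ => h1 i) (Finset.mem_univ i)
      have := hp i
      linarith
    · have := Finset.single_le_sum (f := fun i => (hi i - lo i)⁻¹ + (hi i - lo i))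
        (fun i _ => h1 i) (Finset.mem_univ i)
      have := inv_nonneg.2 (hp i).le
      linarith
  obtain ⟨Cs, hCs0, hCs⟩ := exists_sum_pow_mul_exp_le s
  set c : ℝ := 8 * Real.exp 2 * Λ ^ 2 with hc
  have hc0 : 0 ≤ c := by positivity
  refine ⟨4 * 4 ^ n * Λ ^ s * (c * Cs) ^ n, by positivity, fun f hf C hC N hN z hz => ?_⟩
  have hN0 : (0 : ℝ) < N := by exact_mod_cast hN
  have hN1 : (1 : ℝ) ≤ N := by exact_mod_cast hN
  have hC0 : 0 ≤ C := (norm_nonneg _).trans (hC z hz)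
  set t : Fin n → ℝ := fun i => N / (hi i - lo i) * z i - N / (hi i - lo i) * lo i with ht
  have hf2 : ContDiff ℝ 2 f := hf.of_le (by exact_mod_cast hs)
  have hφs : ∀ j : Fin n → Fin N, ContDiff ℝ 2 fun y => ∏ i, coordBump lo hi N (j i) i y :=
    fun j => contDiff_prod fun i _ => contDiff_coordBump _ _ _ _ i
  have hTs : ∀ j : Fin n → Fin N, ContDiff ℝ 2 fun y => f y - taylorPoly f (boxNode lo hi N j) s y :=
    fun j => hf2.sub (contDiff_taylorPoly _ _ _)
  -- Since the bumps sum to one, the error is the blend of the local Taylor remainders.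
  have e : (fun y => f y - ∑ j : Fin n → Fin N, (∏ i, coordBump lo hi N (j i) i y)
      * taylorPoly f (boxNode lo hi N j) s y) = fun y => ∑ j : Fin n → Fin N,
        (∏ i, coordBump lo hi N (j i) i y) * (f y - taylorPoly f (boxNode lo hi N j) s y) := by
    funext y
    simp only [mul_sub, Finset.sum_sub_distrib]
    rw [← Finset.sum_mul, sum_prod_coordBump lo hi hN, one_mul]
  rw [e]
  have h1 : ∀ j : Fin n → Fin N, JetBound N (4 ^ n * ∏ i, (c * Real.exp (-(2 * |t i - (j i : ℕ)|))))
      (fun y => ∏ i, coordBump lo hi N (j i) i y) z := fun j => by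
    have := JetBound.prod (s := Finset.univ) (N := N) (z := z)
      (fun i _ => contDiff_coordBump lo hi N (j i) i) hN0.le
      (fun i _ => jetBound_coordBump h hΛ1 hΛ N (j i) i hz)
    rwa [Finset.card_univ, Fintype.card_fin] at this
  -- A remainder of order `s - k` in the distance loses `N ^ k`, the same scale as the derivatives
  -- of the bumps, so both fit one `JetBound N`.
  have h2 : ∀ j : Fin n → Fin N, JetBound N (C * Λ ^ s / N ^ s * ∏ i, (1 + |t i - (j i : ℕ)|) ^ s)
      (fun y => f y - taylorPoly f (boxNode lo hi N j) s y) z := by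
    intro j k hk
    refine (norm_iteratedFDeriv_sub_taylorPoly_le (convex_Icc lo hi) hf (boxNode_mem h j) hC
      (hk.trans hs) hz).trans ?_
    have h3 := norm_sub_boxNode_le h (by linarith) hΛ' hN j z
    set P := ∏ i, (1 + |t i - (j i : ℕ)|) with hP
    have hP1 : 1 ≤ P := Finset.one_le_prod fun i _ => by
      linarith [abs_nonneg (t i - (j i : ℕ))]
    rw [Finset.prod_pow]
    calc C * ‖z - boxNode lo hi N j‖ ^ (s - k) ≤ C * (Λ / N * P) ^ (s - k) := by gcongr
      _ = C * (Λ ^ (s - k) * P ^ (s - k)) / N ^ (s - k) := by rw [mul_pow, div_pow]; ring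
      _ ≤ C * (Λ ^ s * P ^ s) / N ^ (s - k) := by
          gcongr <;> omega
      _ = C * Λ ^ s / N ^ s * P ^ s * N ^ k := by
          rw [← pow_sub_mul_pow (N : ℝ) (hk.trans hs)]
          field_simp
  refine (JetBound.sum (fun j _ => (hφs j).mul (hTs j))
    (fun j _ => (h1 j).mul (hφs j) (hTs j) hN0.le (h2 j))).mono hN0.le ?_
  have h4 : ∀ j : Fin n → Fin N, 4 * (4 ^ n * ∏ i, (c * Real.exp (-(2 * |t i - (j i : ℕ)|))))
      * (C * Λ ^ s / N ^ s * ∏ i, (1 + |t i - (j i : ℕ)|) ^ s)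
      = 4 * 4 ^ n * C * Λ ^ s / N ^ s
        * ∏ i, (c * (Real.exp (-(2 * |t i - (j i : ℕ)|)) * (1 + |t i - (j i : ℕ)|) ^ s)) := by
    intro j
    simp only [Finset.prod_mul_distrib]
    ring
  simp_rw [h4]
  rw [← Finset.mul_sum]
  -- The sum over the grid factors into one-dimensional sums, each bounded independently of `N` and
  -- `z`.
  have h5 := Finset.prod_univ_sum (fun _ : Fin n => (Finset.univ : Finset (Fin N)))
    (fun i j => c * (Real.exp (-(2 * |t i - (j : ℕ)|)) * (1 + |t i - (j : ℕ)|) ^ s))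
  rw [Fintype.piFinset_univ] at h5
  rw [← h5]
  have h6 : ∏ i : Fin n, ∑ j : Fin N,
      (c * (Real.exp (-(2 * |t i - (j : ℕ)|)) * (1 + |t i - (j : ℕ)|) ^ s)) ≤ (c * Cs) ^ n := by
    refine (Finset.prod_le_prod (fun i _ => by positivity) fun i _ =>
      (?_ : _ ≤ c * Cs)).trans_eq (by simp)
    rw [← Finset.mul_sum]
    refine mul_le_mul_of_nonneg_left ?_ hc0
    have := hCs N (t i)
    rwa [Finset.sum_range] at this
  calc _ ≤ 4 * 4 ^ n * C * Λ ^ s / N ^ s * (c * Cs) ^ n :=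
        mul_le_mul_of_nonneg_left h6 (by positivity)
    _ = _ := by ring

end LocalTaylor

/-! ### Networks realising the blended Taylor polynomials. -/

section Rate

variable {n : ℕ}

/-- Splits each homogeneous Taylor term into products of coordinate differences, the form a network
can reproduce. -/
theorem iteratedFDeriv_diag_eq_sum (f : (Fin n → ℝ) → ℝ) (z₀ v : Fin n → ℝ) (k : ℕ) :
    iteratedFDeriv ℝ k f z₀ (fun _ => v) = ∑ p : Fin k → Fin n,
      iteratedFDeriv ℝ k f z₀ (fun l => Pi.single (p l) 1) * ∏ l, v (p l) := by
  conv_lhs => rw [pi_eq_sum_univ' v]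
  rw [ContinuousMultilinearMap.map_sum]
  refine Finset.sum_congr rfl fun p _ => ?_
  rw [ContinuousMultilinearMap.map_smul_univ, smul_eq_mul, mul_comm]

/-- Padding by ones gives all monomials of degree below `s` the same number of factors. -/
theorem prod_dite_lt_eq {k s : ℕ} (hk : k ≤ s) (g : Fin k → ℝ) :
    ∏ l : Fin s, (if h : (l : ℕ) < k then g ⟨l, h⟩ else 1) = ∏ l, g l := by
  obtain ⟨r, rfl⟩ := Nat.exists_eq_add_of_le hk
  rw [Fin.prod_univ_add]
  simp

/-- All steps, including the frozen ones, become affine combinations of the same `N` units of the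
first layer. -/
theorem tanhStep_eq_sum {N : ℕ} (j : ℕ) (hj : j ≤ N) (t : ℝ) :
    tanhStep N j t = (if j = 0 then 1 else if j = N then -1 else 0)
      + ∑ l : Fin N, (if (l : ℕ) = j ∧ j ≠ 0 then 1 else 0) * Real.tanh (t - (l : ℕ)) := by
  unfold tanhStep
  by_cases h0 : j = 0
  · simp [h0]
  by_cases hN : j = N
  · have : ∀ l : Fin N, (l : ℕ) ≠ N := fun l => l.2.ne
    simp [hN, this]
  have hlt : j < N := lt_of_le_of_ne hj hN
  rw [if_neg h0, if_neg hN, if_neg h0, if_neg hN, Finset.sum_eq_single ⟨j, hlt⟩]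
  · simp [h0]
  · intro l _ hl
    rw [if_neg, zero_mul]
    rintro ⟨rfl, _⟩
    exact hl rfl
  · simp

/-- Smooth functions are approximated in `C²` on a box by tanh networks with two hidden layers,
with the rate given by the number of degrees of freedom. -/
theorem exists_tanhNet_rate {lo hi : Fin n → ℝ} (h : ∀ i, lo i < hi i) (hn : 1 ≤ n) {s : ℕ}
    (hs : 2 ≤ s) : ∃ (W : ℕ) (C₁ : ℝ), 0 ≤ C₁ ∧ ∀ f : (Fin n → ℝ) → ℝ, ContDiff ℝ s f → ∀ C : ℝ,
      (∀ z ∈ Set.Icc lo hi, ‖iteratedFDeriv ℝ s f z‖ ≤ C) → ∀ N : ℕ, 1 ≤ N →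
      ∃ N₁ N₂ : ℕ, 0 < N₁ ∧ N₁ ≤ W * N ^ n ∧ 0 < N₂ ∧ N₂ ≤ W * N ^ n ∧ ∃ θ : TanhNet n N₁ N₂,
        ∀ z ∈ Set.Icc lo hi,
          JetBound 1 ((C * C₁ + 1) / N ^ (s - 2)) (fun y => θ.eval y - f y) z := by
  obtain ⟨C₁, hC₁, H⟩ := exists_jetBound_sub_blended_taylor h hs
  set m : ℕ := Fintype.card (Σ k : Fin s, Fin k → Fin n) with hm
  have hm0 : 0 < m := by
    have : Nonempty (Σ k : Fin s, Fin k → Fin n) := ⟨⟨⟨0, by omega⟩, fun l => l.elim0⟩⟩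
    exact Fintype.card_pos
  refine ⟨2 * n + m * 2 ^ (n + (s + 1)), C₁, hC₁, fun f hf C hC N hN => ?_⟩
  have hN0 : (0 : ℝ) < N := by exact_mod_cast hN
  have hN1 : (1 : ℝ) ≤ N := by exact_mod_cast hN
  -- the coefficients of the factors
  let κ := (Fin n → Fin N) × (Σ k : Fin s, Fin k → Fin n)
  let coef : κ → ℝ := fun p => ((p.2.1 : ℕ).factorial : ℝ)⁻¹
    * iteratedFDeriv ℝ p.2.1 f (boxNode lo hi N p.1) (fun l => Pi.single (p.2.2 l) 1)
  let sg : ℕ → ℝ := fun j => if j = 0 then 1 else if j = N then -1 else 0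
  let sl : ℕ → Fin N → ℝ := fun j l => if (l : ℕ) = j ∧ j ≠ 0 then 1 else 0
  -- Layout of the factors of one summand: `n` bumps, then the Taylor coefficient, then `s` linear
  -- factors padded by ones.
  let c : κ → Fin (n + (s + 1)) → ℝ := fun p => Fin.addCases (fun i => (sg (p.1 i) - sg (p.1 i + 1)) / 2)
    (Fin.cons (coef p) fun l => if h : (l : ℕ) < p.2.1 then
      -boxNode lo hi N p.1 (p.2.2 ⟨l, h⟩) else 1)
  let A : κ → Fin (n + (s + 1)) → Fin n × Fin N → ℝ := fun p => Fin.addCases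
    (fun i jl => if jl.1 = i then (sl (p.1 i) jl.2 - sl (p.1 i + 1) jl.2) / 2 else 0) (fun _ _ => 0)
  let B : κ → Fin (n + (s + 1)) → Fin n → ℝ := fun p => Fin.addCases (fun _ _ => 0)
    (Fin.cons (fun _ => 0) fun l i => if h : (l : ℕ) < p.2.1 then
      (if p.2.2 ⟨l, h⟩ = i then 1 else 0) else 0)
  let w : Fin n × Fin N → Fin n → ℝ := fun jl => Pi.single jl.1 (N / (hi jl.1 - lo jl.1))
  let β : Fin n × Fin N → ℝ := fun jl => -(N / (hi jl.1 - lo jl.1) * lo jl.1) - (jl.2 : ℕ)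
  -- The error of realising the products is set to `1 / N ^ (s - 2)`, the size of the Taylor error;
  -- it is the summand 1 in `C * C₁ + 1`.
  obtain ⟨θ, hθ⟩ := exists_tanhNet_sub_sum_prod (n := n) (q := n + (s + 1)) (by omega) (J := Fin n × Fin N)
    (κ := κ) (isCompact_Icc (a := lo) (b := hi)) w β c A B (δ := 1 / N ^ (s - 2)) (by positivity)
  have hw : ∀ (jl : Fin n × Fin N) (y : Fin n → ℝ), ∑ i, w jl i * y i + β jl
      = N / (hi jl.1 - lo jl.1) * y jl.1 - N / (hi jl.1 - lo jl.1) * lo jl.1 - (jl.2 : ℕ) := by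
    intro jl y
    have : ∑ i, w jl i * y i = N / (hi jl.1 - lo jl.1) * y jl.1 := by
      rw [Finset.sum_eq_single jl.1] <;> simp +contextual [w]
    rw [this]
    simp only [β]
    ring
  have hprod : ∀ (p : κ) (y : Fin n → ℝ), ∏ m, (c p m
      + ∑ j, A p m j * Real.tanh (∑ i, w j i * y i + β j) + ∑ i, B p m i * y i)
      = (∏ i, coordBump lo hi N (p.1 i) i y)
        * (coef p * ∏ l, (y (p.2.2 l) - boxNode lo hi N p.1 (p.2.2 l))) := by
    intro p y
    rw [Fin.prod_univ_add, Fin.prod_univ_succ]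
    congr 1
    · refine Finset.prod_congr rfl fun i _ => ?_
      simp only [c, A, B, Fin.addCases_left, hw]
      rw [Fintype.sum_prod_type]
      rw [Finset.sum_eq_single i (fun i' _ hi' => by simp [hi']) (by simp)]
      simp only [if_true, zero_mul, Finset.sum_const_zero, add_zero, coordBump, tanhBump]
      rw [tanhStep_eq_sum _ (p.1 i).2.le, tanhStep_eq_sum _ (p.1 i).2]
      simp only [sg, sl, div_mul_eq_mul_div, sub_mul, ← Finset.sum_div, Finset.sum_sub_distrib]
      ring
    · congr 1
      · simp [c, A, B]
      · rw [← prod_dite_lt_eq p.2.1.2.le]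
        refine Finset.prod_congr rfl fun l _ => ?_
        simp only [c, A, B, Fin.addCases_right, Fin.cons_succ]
        split_ifs with hl
        · simp; ring
        · simp
  have hsum : ∀ y, ∑ p : κ, ∏ m, (c p m
      + ∑ j, A p m j * Real.tanh (∑ i, w j i * y i + β j) + ∑ i, B p m i * y i)
      = ∑ j : Fin n → Fin N, (∏ i, coordBump lo hi N (j i) i y)
        * taylorPoly f (boxNode lo hi N j) s y := by
    intro y
    simp_rw [hprod]
    rw [Fintype.sum_prod_type]
    refine Finset.sum_congr rfl fun j _ => ?_
    dsimp only
    rw [← Finset.mul_sum, Fintype.sum_sigma, taylorPoly, Finset.sum_range]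
    congr 1
    refine Finset.sum_congr rfl fun k _ => ?_
    rw [iteratedFDeriv_diag_eq_sum, Finset.mul_sum]
    refine Finset.sum_congr rfl fun p _ => ?_
    simp only [coef, Pi.sub_apply]
    ring
  have hcard1 : Fintype.card ((Fin n × Fin N) ⊕ Fin n) = n * N + n := by simp
  have hcard2 : Fintype.card (κ × Finset (Fin (n + (s + 1)))) = N ^ n * m * 2 ^ (n + (s + 1)) := by
    simp only [κ, Fintype.card_prod, Fintype.card_finset, Fintype.card_fin, Fintype.card_fun, hm]
  refine ⟨_, _, ?_, ?_, ?_, ?_, θ, fun z hz => ?_⟩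
  · rw [hcard1]; omega
  · rw [hcard1]
    have h1 : N ≤ N ^ n := Nat.le_self_pow (by omega) N
    have h2 : 1 ≤ N ^ n := hN.trans h1
    have h3 := Nat.mul_le_mul_left n h1
    have h4 := Nat.mul_le_mul_left n h2
    have h5 : 0 ≤ m * 2 ^ (n + (s + 1)) * N ^ n := Nat.zero_le _
    calc n * N + n ≤ n * N ^ n + n * N ^ n := by omega
      _ ≤ (2 * n + m * 2 ^ (n + (s + 1))) * N ^ n := by
        rw [add_mul, mul_assoc 2, two_mul]; omega
  · rw [hcard2]; positivity
  · rw [hcard2]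
    calc N ^ n * m * 2 ^ (n + (s + 1)) = m * 2 ^ (n + (s + 1)) * N ^ n := by ring
      _ ≤ _ := Nat.mul_le_mul_right _ (by omega)
  · have h1 := hθ z hz
    simp_rw [hsum] at h1
    have h2 : JetBound 1 (C * C₁ / N ^ (s - 2)) (fun y => f y
        - ∑ j : Fin n → Fin N, (∏ i, coordBump lo hi N (j i) i y)
          * taylorPoly f (boxNode lo hi N j) s y) z := by
      intro k hk
      refine (H f hf C hC N hN z hz k hk).trans ?_
      have hC0 : 0 ≤ C := (norm_nonneg _).trans (hC z hz)
      rw [one_pow, mul_one]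
      calc C * C₁ / N ^ s * N ^ k ≤ C * C₁ / N ^ s * N ^ 2 := by
            gcongr
        _ = _ := by
            rw [← pow_sub_mul_pow (N : ℝ) hs]
            field_simp
    have hf2 : ContDiff ℝ 2 f := hf.of_le (by exact_mod_cast hs)
    have hb : ContDiff ℝ 2 fun y => ∑ j : Fin n → Fin N, (∏ i, coordBump lo hi N (j i) i y)
          * taylorPoly f (boxNode lo hi N j) s y :=
      ContDiff.sum fun j _ => (contDiff_prod fun i _ => contDiff_coordBump _ _ _ _ i).mul
        (contDiff_taylorPoly _ _ _)
    have h3 := h1.sub (θ.contDiff_eval.sub hb) (hf2.sub hb) h2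
    simp only [sub_sub_sub_cancel_right] at h3
    refine h3.mono zero_le_one (le_of_eq ?_)
    ring

end Rate

/-! ### Iterated partial derivatives and mollification of weak derivatives. -/

section PartialDerivatives

variable {n : ℕ}

theorem contDiff_partialD {f : (Fin n → ℝ) → ℝ} {m k : WithTop ℕ∞} (hf : ContDiff ℝ k f)
    (h : m + 1 ≤ k) (i : Fin n) : ContDiff ℝ m (partialD i f) :=
  (hf.fderiv_right h).clm_apply contDiff_const

theorem contDiff_iterPartialD {f : (Fin n → ℝ) → ℝ} (hf : ContDiff ℝ ∞ f) (l : List (Fin n)) :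
    ContDiff ℝ ∞ (iterPartialD l f) := by
  induction l with
  | nil => exact hf
  | cons i l ih => exact contDiff_partialD ih (by simp) i

theorem hasCompactSupport_iterPartialD {f : (Fin n → ℝ) → ℝ} (hf : HasCompactSupport f)
    (l : List (Fin n)) : HasCompactSupport (iterPartialD l f) := by
  induction l with
  | nil => exact hf
  | cons i l ih => exact ih.fderiv_apply ℝ _

theorem partialD_const_mul {f : (Fin n → ℝ) → ℝ} (hf : Differentiable ℝ f) (a : ℝ) (i : Fin n) :
    partialD i (fun z => a * f z) = fun z => a * partialD i f z := by
  funext z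
  simp [partialD, fderiv_const_mul (hf z)]

theorem partialD_comp_affine {F : (Fin n → ℝ) → ℝ} (hF : Differentiable ℝ F) (a : ℝ)
    (b : Fin n → ℝ) (i : Fin n) :
    partialD i (fun y => F (a • y + b)) = fun y => a * partialD i F (a • y + b) := by
  funext y
  have h1 : HasFDerivAt (fun y : Fin n → ℝ => a • y + b)
      (a • ContinuousLinearMap.id ℝ (Fin n → ℝ)) y :=
    ((hasFDerivAt_id y).const_smul a).add_const b
  have h2 := (hF (a • y + b)).hasFDerivAt.comp y h1
  have h3 : fderiv ℝ (fun y => F (a • y + b)) y = _ := h2.fderiv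
  simp [partialD, h3]

/-- Serves both the reflection `y ↦ w - y` in convolutions and the contraction of the box. -/
theorem iterPartialD_comp_affine {F : (Fin n → ℝ) → ℝ} (hF : ContDiff ℝ ∞ F) (a : ℝ)
    (b : Fin n → ℝ) (l : List (Fin n)) :
    iterPartialD l (fun y => F (a • y + b))
      = fun y => a ^ l.length * iterPartialD l F (a • y + b) := by
  induction l with
  | nil => simp [iterPartialD]
  | cons i l ih =>
    have hd := (contDiff_iterPartialD hF l).differentiable (by simp)
    have hd' : Differentiable ℝ fun y => iterPartialD l F (a • y + b) :=
      hd.comp ((differentiable_id.const_smul a).add_const b)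
    rw [iterPartialD, ih, partialD_const_mul hd', partialD_comp_affine hd]
    funext y
    simp only [iterPartialD, List.length_cons, pow_succ]
    ring

theorem iteratedFDeriv_single_eq_iterPartialD {f : (Fin n → ℝ) → ℝ} {k : ℕ} (hf : ContDiff ℝ k f)
    (p : Fin k → Fin n) (z : Fin n → ℝ) :
    iteratedFDeriv ℝ k f z (fun l => Pi.single (p l) 1) = iterPartialD (List.ofFn p) f z := by
  induction k generalizing z with
  | zero => simp [iterPartialD]
  | succ k ih =>
    rw [iteratedFDeriv_succ_eq_fderiv_apply (by exact_mod_cast hf), List.ofFn_succ,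
      iterPartialD, partialD]
    congr 2
    funext y
    exact ih (hf.of_le (by exact_mod_cast k.le_succ)) (fun l => p l.succ) y

theorem norm_iteratedFDeriv_le_sum (f : (Fin n → ℝ) → ℝ) (k : ℕ) (z : Fin n → ℝ) :
    ‖iteratedFDeriv ℝ k f z‖ ≤ ∑ p : Fin k → Fin n,
      |iteratedFDeriv ℝ k f z (fun l => Pi.single (p l) 1)| := by
  refine ContinuousMultilinearMap.opNorm_le_bound (Finset.sum_nonneg fun _ _ => abs_nonneg _)
    fun v => ?_
  have e : iteratedFDeriv ℝ k f z v = ∑ p : Fin k → Fin n,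
      (∏ l, v l (p l)) * iteratedFDeriv ℝ k f z (fun l => Pi.single (p l) 1) := by
    conv_lhs => rw [show v = fun l => ∑ i, v l i • (Pi.single i 1 : Fin n → ℝ) from
      funext fun l => pi_eq_sum_univ' (v l)]
    rw [ContinuousMultilinearMap.map_sum]
    refine Finset.sum_congr rfl fun p _ => ?_
    rw [ContinuousMultilinearMap.map_smul_univ, smul_eq_mul]
  rw [e, Finset.sum_mul]
  refine (norm_sum_le _ _).trans (Finset.sum_le_sum fun p _ => ?_)
  rw [norm_mul, mul_comm, Real.norm_eq_abs, norm_prod]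
  gcongr with l
  exact norm_le_pi_norm (v l) (p l)

theorem partialD_convolution {f g : (Fin n → ℝ) → ℝ} (hf : LocallyIntegrable f volume)
    (hg : ContDiff ℝ ∞ g) (hc : HasCompactSupport g) (i : Fin n) :
    partialD i (MeasureTheory.convolution f g (ContinuousLinearMap.mul ℝ ℝ) volume)
      = MeasureTheory.convolution f (partialD i g) (ContinuousLinearMap.mul ℝ ℝ) volume := by
  funext z
  have hg1 : ContDiff ℝ 1 g := hg.of_le (by exact_mod_cast le_top)
  rw [partialD, (hc.hasFDerivAt_convolution_right (ContinuousLinearMap.mul ℝ ℝ) hf hg1 z).fderiv,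
    convolution_precompR_apply _ hf (hc.fderiv ℝ) (hg1.continuous_fderiv one_ne_zero)]
  rfl

theorem iterPartialD_convolution {f g : (Fin n → ℝ) → ℝ} (hf : LocallyIntegrable f volume)
    (hg : ContDiff ℝ ∞ g) (hc : HasCompactSupport g) (l : List (Fin n)) :
    iterPartialD l (MeasureTheory.convolution f g (ContinuousLinearMap.mul ℝ ℝ) volume)
      = MeasureTheory.convolution f (iterPartialD l g) (ContinuousLinearMap.mul ℝ ℝ) volume := by
  induction l with
  | nil => rfl
  | cons i l ih =>
    rw [iterPartialD, ih, partialD_convolution hf (contDiff_iterPartialD hg l)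
      (hasCompactSupport_iterPartialD hc l)]
    rfl

/-- The mollification of the restriction of `u` to `U`. -/
def mollify (U : Set (Fin n → ℝ)) (ρ u : (Fin n → ℝ) → ℝ) (w : Fin n → ℝ) : ℝ :=
  ∫ y in U, u y * ρ (w - y)

theorem mollify_eq_convolution {U : Set (Fin n → ℝ)} (hU : MeasurableSet U)
    (ρ u : (Fin n → ℝ) → ℝ) : mollify U ρ u
      = MeasureTheory.convolution (U.indicator u) ρ (ContinuousLinearMap.mul ℝ ℝ) volume := by
  funext w
  rw [mollify, convolution_def, ← integral_indicator hU]
  congr 1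
  funext y
  by_cases hy : y ∈ U <;> simp [hy]

theorem contDiff_mollify {U : Set (Fin n → ℝ)} (hU : MeasurableSet U) {ρ u : (Fin n → ℝ) → ℝ}
    (hu : IntegrableOn u U) (hρ : ContDiff ℝ ∞ ρ) (hc : HasCompactSupport ρ) :
    ContDiff ℝ ∞ (mollify U ρ u) := by
  rw [mollify_eq_convolution hU]
  exact hc.contDiff_convolution_right _ ((integrable_indicator_iff hU).2 hu).locallyIntegrable hρ

/-- Derivatives of a mollification are mollifications of weak derivatives. -/
theorem iterPartialD_mollify {U : Set (Fin n → ℝ)} (hU : MeasurableSet U)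
    {ρ u g : (Fin n → ℝ) → ℝ} (hu : IntegrableOn u U) (hρ : ContDiff ℝ ∞ ρ)
    (hc : HasCompactSupport ρ) {l : List (Fin n)} (hg : IsWeakDeriv U l u g) {w : Fin n → ℝ}
    (hw : ∀ y, w - y ∈ tsupport ρ → y ∈ U) :
    iterPartialD l (mollify U ρ u) w = mollify U ρ g w := by
  have e : ∀ y, w - y = (-1 : ℝ) • y + w := fun y => by rw [neg_one_smul]; abel
  have hts : tsupport (fun y => ρ (w - y)) = (Homeomorph.subLeft w) ⁻¹' tsupport ρ :=
    tsupport_comp_eq_preimage ρ (Homeomorph.subLeft w)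
  -- The reflected kernel is an admissible test function because its support lies in `U`. The sign
  -- from the reflection cancels the one in the definition of the weak derivative.
  have h := hg.2.2 (fun y => ρ (w - y)) (hρ.comp (contDiff_const.sub contDiff_id))
    (hc.comp_homeomorph (Homeomorph.subLeft w)) (by rw [hts]; exact hw)
  rw [mollify_eq_convolution hU, iterPartialD_convolution
    ((integrable_indicator_iff hU).2 hu).locallyIntegrable hρ hc, ← mollify_eq_convolution hU]
  simp_rw [e] at h
  rw [iterPartialD_comp_affine hρ] at h
  simp_rw [← mul_assoc, mul_comm (u _), mul_assoc, integral_const_mul] at h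
  have h1 : ((-1 : ℝ) ^ l.length) ≠ 0 := by positivity
  have h2 := mul_left_cancel₀ h1 h
  simp only [mollify, e]
  exact h2

end PartialDerivatives

/-! ### Mollification as averaging. -/

section Mollification

variable {n : ℕ}

theorem integrable_mul_normed {U : Set (Fin n → ℝ)} (φ : ContDiffBump (0 : Fin n → ℝ))
    {g : (Fin n → ℝ) → ℝ} (hg : IntegrableOn g U) (w : Fin n → ℝ) :
    IntegrableOn (fun y => g y * φ.normed volume (w - y)) U := by
  have hc : Continuous fun y => φ.normed volume (w - y) :=
    φ.continuous_normed.comp (continuous_const.sub continuous_id)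
  obtain ⟨C, hC⟩ := φ.hasCompactSupport_normed (μ := volume).exists_bound_of_continuous
    φ.continuous_normed
  exact Integrable.mul_bdd (c := C) hg hc.aestronglyMeasurable
    (Eventually.of_forall fun y => hC (w - y))

theorem setIntegral_normed_eq_one {U : Set (Fin n → ℝ)} (φ : ContDiffBump (0 : Fin n → ℝ))
    {w : Fin n → ℝ} (hw : Metric.closedBall w φ.rOut ⊆ U) :
    ∫ y in U, φ.normed volume (w - y) = 1 := by
  rw [setIntegral_eq_integral_of_forall_compl_eq_zero,
    integral_sub_left_eq_self (φ.normed volume) volume w, φ.integral_normed]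
  intro y hy
  by_contra h
  have h1 : w - y ∈ Function.support (φ.normed volume) := h
  rw [φ.support_normed_eq, mem_ball_zero_iff, norm_sub_rev, ← dist_eq_norm] at h1
  exact hy (hw (Metric.mem_closedBall.2 h1.le))

theorem mollify_sub_const {U : Set (Fin n → ℝ)} (φ : ContDiffBump (0 : Fin n → ℝ))
    [IsFiniteMeasure (volume.restrict U)] {g : (Fin n → ℝ) → ℝ} (hg : IntegrableOn g U)
    {w : Fin n → ℝ}
    (hw : Metric.closedBall w φ.rOut ⊆ U) (b : ℝ) :
    mollify U (φ.normed volume) g w - b = ∫ y in U, (g y - b) * φ.normed volume (w - y) := by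
  have h1 : IntegrableOn (fun _ : Fin n → ℝ => b) U := integrable_const b
  simp_rw [sub_mul]
  rw [integral_sub (integrable_mul_normed φ hg w) (integrable_mul_normed φ h1 w),
    integral_const_mul, setIntegral_normed_eq_one φ hw, mul_one, mollify]

/-- The mollified value is an average over the ball. With `b = 0` this bounds derivatives; with `b =
u z` it gives uniform convergence. -/
theorem abs_mollify_sub_const_le {U : Set (Fin n → ℝ)} (φ : ContDiffBump (0 : Fin n → ℝ))
    [IsFiniteMeasure (volume.restrict U)] {g : (Fin n → ℝ) → ℝ} (hg : IntegrableOn g U)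
    {w : Fin n → ℝ}
    (hw : Metric.closedBall w φ.rOut ⊆ U) {b ε : ℝ}
    (hε : ∀ᵐ y ∂volume.restrict U, y ∈ Metric.closedBall w φ.rOut → |g y - b| ≤ ε) :
    |mollify U (φ.normed volume) g w - b| ≤ ε := by
  have h1 : IntegrableOn (fun _ : Fin n → ℝ => (1 : ℝ)) U := integrable_const 1
  have h2 := integrable_mul_normed φ h1 w
  simp only [one_mul] at h2
  rw [mollify_sub_const φ hg hw, ← Real.norm_eq_abs]
  calc ‖∫ y in U, (g y - b) * φ.normed volume (w - y)‖
      ≤ ∫ y in U, ε * φ.normed volume (w - y) := by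
        refine norm_integral_le_of_norm_le (h2.const_mul ε) ?_
        filter_upwards [hε] with y hy
        have h0 := φ.nonneg_normed (μ := volume) (w - y)
        rw [norm_mul, Real.norm_of_nonneg h0, Real.norm_eq_abs]
        by_cases h : y ∈ Metric.closedBall w φ.rOut
        · exact mul_le_mul_of_nonneg_right (hy h) h0
        · have h3 : φ.normed volume (w - y) = 0 := by
            by_contra h4
            have h5 : w - y ∈ Function.support (φ.normed volume) := h4
            rw [φ.support_normed_eq, mem_ball_zero_iff, norm_sub_rev, ← dist_eq_norm] at h5
            exact h (Metric.mem_closedBall.2 h5.le)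
          simp [h3]
    _ = ε := by rw [integral_const_mul, setIntegral_normed_eq_one φ hw, mul_one]

/-- When the outer radius is at most twice the inner one, the normalised kernel is at most `2 ^ n`
divided by the volume of the ball. Mollification is then dominated by plain averages, to which
Lebesgue differentiation applies. -/
theorem abs_mollify_sub_const_le_average {U : Set (Fin n → ℝ)} (φ : ContDiffBump (0 : Fin n → ℝ))
    (hφ : φ.rOut ≤ 2 * φ.rIn) (hUm : MeasurableSet U)
    [IsFiniteMeasure (volume.restrict U)] {g : (Fin n → ℝ) → ℝ} (hg : IntegrableOn g U)
    {w : Fin n → ℝ}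
    (hw : Metric.closedBall w φ.rOut ⊆ U) (b : ℝ) :
    |mollify U (φ.normed volume) g w - b|
      ≤ 2 ^ n * ⨍ y in Metric.closedBall w φ.rOut, ‖U.indicator g y - b‖ := by
  rw [mollify_sub_const φ hg hw, setAverage_eq]
  set V := volume.real (Metric.closedBall w φ.rOut) with hV
  have hV' : volume.real (Metric.closedBall (0 : Fin n → ℝ) φ.rOut) = V := by
    simp only [hV, Measure.real, Measure.addHaar_closedBall_center volume w]
  have hb : ∀ y, φ.normed volume (w - y) ≤ 2 ^ n / V := fun y => by
    have := φ.normed_le_div_measure_closedBall_rOut volume 2 hφ (w - y)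
    rwa [hV', Module.finrank_fin_fun] at this
  have hgi : IntegrableOn (fun y => U.indicator g y - b) (Metric.closedBall w φ.rOut) := by
    refine Integrable.sub (((integrable_indicator_iff hUm).2 hg).integrableOn) ?_
    exact integrableOn_const Metric.isBounded_closedBall.measure_lt_top.ne
  have e : ∫ y in U, (g y - b) * φ.normed volume (w - y)
      = ∫ y in Metric.closedBall w φ.rOut, (U.indicator g y - b) * φ.normed volume (w - y) := by
    rw [← integral_indicator hUm, ← integral_indicator Metric.isClosed_closedBall.measurableSet]
    congr 1
    funext y
    by_cases hy : y ∈ Metric.closedBall w φ.rOut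
    · simp [hy, hw hy]
    · have h3 : φ.normed volume (w - y) = 0 := by
        by_contra h4
        have h5 : w - y ∈ Function.support (φ.normed volume) := h4
        rw [φ.support_normed_eq, mem_ball_zero_iff, norm_sub_rev, ← dist_eq_norm] at h5
        exact hy (Metric.mem_closedBall.2 h5.le)
      simp [hy, h3]
  rw [e, ← Real.norm_eq_abs, smul_eq_mul, ← mul_assoc, ← div_eq_mul_inv, ← integral_const_mul]
  refine norm_integral_le_of_norm_le (hgi.norm.const_mul _) (Eventually.of_forall fun y => ?_)
  rw [norm_mul, mul_comm, Real.norm_of_nonneg (φ.nonneg_normed _)]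
  exact mul_le_mul_of_nonneg_right (hb y) (norm_nonneg _)

/-- The fundamental lemma of the calculus of variations. It identifies the weak derivatives in the
equation with the bounded ones supplied by the Sobolev hypothesis. -/
theorem IsWeakDeriv.ae_eq {U : Set (Fin n → ℝ)} (hU : IsOpen U) {l : List (Fin n)}
    {u g g' : (Fin n → ℝ) → ℝ} (h : IsWeakDeriv U l u g) (h' : IsWeakDeriv U l u g') :
    ∀ᵐ z ∂volume.restrict U, g z = g' z := by
  rw [ae_restrict_iff' hU.measurableSet]
  have hl := h.2.1.sub h'.2.1
  have key := hU.ae_eq_zero_of_integral_contDiff_smul_eq_zero (μ := volume) hl ?_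
  · filter_upwards [key] with z hz hzU
    exact sub_eq_zero.1 (hz hzU)
  · intro η hη hc hs
    have h1 := (h.2.2 η hη hc hs).symm.trans (h'.2.2 η hη hc hs)
    have h2 := mul_left_cancel₀ (pow_ne_zero _ (by norm_num)) h1
    have hi : ∀ {f : (Fin n → ℝ) → ℝ}, LocallyIntegrableOn f U volume →
        IntegrableOn (fun y => f y * η y) U := by
      intro f hf
      have h3 : IntegrableOn (fun y => f y * η y) (tsupport η) :=
        (hf.integrableOn_compact_subset hs hc).mul_continuousOn hη.continuous.continuousOn hc
      have h4 : IntegrableOn (fun y => f y * η y) Set.univ :=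
        (integrableOn_iff_integrable_of_support_subset fun y hy => by
          by_contra hy'
          exact hy (by simp [image_eq_zero_of_notMem_tsupport hy'])).1 h3 |>.integrableOn
      exact h4.mono_set (Set.subset_univ U)
    rw [← setIntegral_eq_integral_of_forall_compl_eq_zero (s := U) (fun y hy => by
      rw [image_eq_zero_of_notMem_tsupport fun hy' => hy (hs hy'), zero_smul])]
    simp only [smul_eq_mul, Pi.sub_apply, mul_comm (η _)]
    simp only [sub_mul]
    rw [integral_sub (hi h.2.1) (hi h'.2.1), h2, sub_self]

end Mollification

/-! ### Smooth approximation up to the boundary of the box. -/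

section SmoothApproximation

variable {n : ℕ}

theorem exists_bound_of_memLp_top {α : Type*} [MeasurableSpace α] {μ : Measure α} {g : α → ℝ}
    (hg : MemLp g ⊤ μ) : ∃ M : ℝ, 0 ≤ M ∧ ∀ᵐ y ∂μ, |g y| ≤ M := by
  refine ⟨(eLpNormEssSup g μ).toReal, ENNReal.toReal_nonneg, ?_⟩
  have hfin : eLpNormEssSup g μ ≠ ⊤ := by
    have := hg.2.ne
    rwa [eLpNorm_exponent_top] at this
  filter_upwards [ae_le_eLpNormEssSup (f := g) (μ := μ)] with y hy
  have := ENNReal.toReal_mono hfin hy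
  simpa using this

/-- Functions in `W^{s,∞}` of a box which are continuous up to the boundary are limits of smooth
functions, whose derivatives of order at most `s` are uniformly bounded on the closed box and
converge almost everywhere. -/
theorem exists_smooth_approx {lo hi : Fin n → ℝ} (h : ∀ i, lo i < hi i) {s : ℕ}
    {u : (Fin n → ℝ) → ℝ}
    (hu : MemSobolevInfty s (Set.pi Set.univ fun k => Set.Ioo (lo k) (hi k)) u)
    (huc : ContinuousOn u (Set.Icc lo hi)) :
    ∃ (C : ℝ) (G : ℕ → (Fin n → ℝ) → ℝ), (∀ m, ContDiff ℝ ∞ (G m)) ∧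
      (∀ m, ∀ z ∈ Set.Icc lo hi, ∀ k ≤ s, ‖iteratedFDeriv ℝ k (G m) z‖ ≤ C) ∧
      TendstoUniformlyOn G u atTop (Set.Icc lo hi) ∧
      ∀ l : List (Fin n), l.length ≤ s → ∀ g,
        IsWeakDeriv (Set.pi Set.univ fun k => Set.Ioo (lo k) (hi k)) l u g →
        ∀ᵐ z ∂volume.restrict (Set.pi Set.univ fun k => Set.Ioo (lo k) (hi k)),
          Tendsto (fun m => iterPartialD l (G m) z) atTop (𝓝 (g z)) := by
  set U : Set (Fin n → ℝ) := Set.pi Set.univ fun k => Set.Ioo (lo k) (hi k) with hUdef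
  have hUo : IsOpen U := isOpen_set_pi Set.finite_univ fun _ _ => isOpen_Ioo
  have hUK : U ⊆ Set.Icc lo hi := fun z hz =>
    ⟨fun i => (hz i trivial).1.le, fun i => (hz i trivial).2.le⟩
  have hUfin : volume U ≠ ⊤ := ((measure_mono hUK).trans_lt isCompact_Icc.measure_lt_top).ne
  have : IsFiniteMeasure (volume.restrict U) := isFiniteMeasure_restrict.2 hUfin
  -- the parameters
  obtain ⟨r, hr0, hr⟩ : ∃ r : ℝ, 0 < r ∧ ∀ i, r < (hi i - lo i) / 2 := by
    have hp : ∀ i, 0 < (hi i - lo i) / 2 := fun i => by linarith [h i]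
    rcases isEmpty_or_nonempty (Fin n) with he | he
    · exact ⟨1, one_pos, fun i => he.elim i⟩
    · obtain ⟨i₀, hi₀⟩ := Finite.exists_min fun i => (hi i - lo i) / 2
      exact ⟨(hi i₀ - lo i₀) / 2 / 2, by linarith [hp i₀], fun i => by
        linarith [hi₀ i, hp i₀]⟩
  set c : Fin n → ℝ := fun i => (lo i + hi i) / 2 with hc
  obtain ⟨R, hR0, hR⟩ : ∃ R : ℝ, 0 ≤ R ∧ ∀ z ∈ Set.Icc lo hi, ‖z - c‖ ≤ R := by
    obtain ⟨R, hR⟩ := (isCompact_Icc (a := lo) (b := hi)).exists_bound_of_continuousOn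
      (f := fun z => z - c) (by fun_prop)
    exact ⟨max R 0, le_max_right _ _, fun z hz => (hR z hz).trans (le_max_left _ _)⟩
  set δ : ℕ → ℝ := fun m => 1 / ((m : ℝ) + 1) with hδ
  have hδ0 : ∀ m, 0 < δ m := fun m => by positivity
  have hδ1 : ∀ m, δ m ≤ 1 := fun m => by
    rw [hδ, div_le_one (by positivity)]; linarith [(Nat.cast_nonneg m : (0 : ℝ) ≤ m)]
  have hδlim : Tendsto δ atTop (𝓝 0) := tendsto_one_div_add_atTop_nhds_zero_nat
  let φ : ℕ → ContDiffBump (0 : Fin n → ℝ) := fun m =>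
    ⟨δ m * r / 2, δ m * r, by have := hδ0 m; positivity, by
      have := mul_pos (hδ0 m) hr0; linarith⟩
  have hφout : ∀ m, (φ m).rOut = δ m * r := fun m => rfl
  have hφin : ∀ m, (φ m).rOut ≤ 2 * (φ m).rIn := fun m => by
    change δ m * r ≤ 2 * (δ m * r / 2); linarith
  -- The contraction by `1 - δ m` towards the centre leaves a margin larger than the mollification
  -- radius `δ m * r`, since `r` is below half of every side. Thus `u` need not be extended across
  -- the boundary.
  let S : ℕ → (Fin n → ℝ) → Fin n → ℝ := fun m z => (1 - δ m) • z + δ m • c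
  have hS : ∀ m z, z - S m z = δ m • (z - c) := fun m z => by
    simp only [S, smul_sub, sub_smul, one_smul]; abel
  have hSball : ∀ m, ∀ z ∈ Set.Icc lo hi, Metric.closedBall (S m z) (φ m).rOut ⊆ U := by
    intro m z hz y hy i _
    have h1 : |y i - S m z i| ≤ δ m * r := by
      have := (norm_le_pi_norm (y - S m z) i).trans (mem_closedBall_iff_norm.1 hy)
      simpa using this
    have h2 : S m z i = (1 - δ m) * z i + δ m * ((lo i + hi i) / 2) := by simp [S, hc]
    have h3 := abs_le.1 h1
    have h4 : δ m * r < δ m * ((hi i - lo i) / 2) := mul_lt_mul_of_pos_left (hr i) (hδ0 m)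
    have h5 : 0 ≤ (1 - δ m) * (z i - lo i) :=
      mul_nonneg (by linarith [hδ1 m]) (sub_nonneg.2 (hz.1 i))
    have h6 : 0 ≤ (1 - δ m) * (hi i - z i) :=
      mul_nonneg (by linarith [hδ1 m]) (sub_nonneg.2 (hz.2 i))
    rw [h2] at h3
    constructor <;> nlinarith
  have huint : IntegrableOn u U := (huc.integrableOn_Icc).mono_set hUK
  have hmol : ∀ m, ContDiff ℝ ∞ (mollify U ((φ m).normed volume) u) := fun m =>
    contDiff_mollify hUo.measurableSet huint (φ m).contDiff_normed (φ m).hasCompactSupport_normed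
  set G : ℕ → (Fin n → ℝ) → ℝ := fun m z => mollify U ((φ m).normed volume) u (S m z) with hG
  have hGs : ∀ m, ContDiff ℝ ∞ (G m) := fun m =>
    (hmol m).comp (show ContDiff ℝ ∞ fun z => (1 - δ m) • z + δ m • c by fun_prop)
  -- the derivatives
  have hGd : ∀ m, ∀ z ∈ Set.Icc lo hi, ∀ l g, IsWeakDeriv U l u g → iterPartialD l (G m) z
      = (1 - δ m) ^ l.length * mollify U ((φ m).normed volume) g (S m z) := by
    intro m z hz l g hg
    rw [hG]
    simp only [S]
    rw [iterPartialD_comp_affine (hmol m)]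
    simp only
    rw [iterPartialD_mollify hUo.measurableSet huint (φ m).contDiff_normed
      (φ m).hasCompactSupport_normed hg]
    intro y hy
    rw [(φ m).tsupport_normed_eq, mem_closedBall_zero_iff, norm_sub_rev] at hy
    exact hSball m z hz (mem_closedBall_iff_norm.2 hy)
  have hloc : ∀ l : List (Fin n), l.length ≤ s → ∃ (M : ℝ) (g : (Fin n → ℝ) → ℝ), 0 ≤ M ∧
      IsWeakDeriv U l u g ∧ IntegrableOn g U ∧ ∀ᵐ y ∂volume.restrict U, |g y| ≤ M := by
    intro l hl
    obtain ⟨g, hg, hw⟩ := hu l hl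
    obtain ⟨M, hM0, hM⟩ := exists_bound_of_memLp_top hg
    exact ⟨M, g, hM0, hw, hg.integrable le_top, hM⟩
  choose! M D hM0 hD hDi hDM using hloc
  have hpow : ∀ m k, |(1 - δ m) ^ k| ≤ 1 := fun m k => by
    rw [abs_pow]
    refine pow_le_one₀ (abs_nonneg _) ?_
    rw [abs_le]; constructor <;> linarith [hδ0 m, hδ1 m]
  have hbound : ∀ m, ∀ z ∈ Set.Icc lo hi, ∀ l : List (Fin n), l.length ≤ s →
      |iterPartialD l (G m) z| ≤ M l := by
    intro m z hz l hl
    rw [hGd m z hz l _ (hD l hl), abs_mul]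
    have h1 := abs_mollify_sub_const_le (φ m) (hDi l hl) (hSball m z hz) (b := 0) (ε := M l) (by
      filter_upwards [hDM l hl] with y hy _
      simpa using hy)
    rw [sub_zero] at h1
    calc _ ≤ 1 * M l := mul_le_mul (hpow m _) h1 (abs_nonneg _) zero_le_one
      _ = M l := one_mul _
  refine ⟨∑ k ∈ Finset.range (s + 1), ∑ p : Fin k → Fin n, M (List.ofFn p), G, hGs, ?_, ?_, ?_⟩
  · intro m z hz k hk
    have hn : ∀ k ∈ Finset.range (s + 1), 0 ≤ ∑ p : Fin k → Fin n, M (List.ofFn p) :=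
      fun k hk => Finset.sum_nonneg fun p _ =>
        hM0 _ (by simpa using Nat.lt_succ_iff.1 (Finset.mem_range.1 hk))
    refine (norm_iteratedFDeriv_le_sum (G m) k z).trans (le_trans ?_
      (Finset.single_le_sum hn (Finset.mem_range.2 (Nat.lt_succ_of_le hk))))
    refine Finset.sum_le_sum fun p _ => ?_
    rw [iteratedFDeriv_single_eq_iterPartialD ((hGs m).of_le (by exact_mod_cast le_top))]
    exact hbound m z hz _ (by simpa using hk)
  · rw [Metric.tendstoUniformlyOn_iff]
    intro ε hε
    have huu := isCompact_Icc.uniformContinuousOn_of_continuous huc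
    rw [Metric.uniformContinuousOn_iff] at huu
    obtain ⟨τ, hτ0, hτ⟩ := huu (ε / 2) (by positivity)
    have hlim : Tendsto (fun m => δ m * (r + R)) atTop (𝓝 0) := by
      simpa using hδlim.mul_const (r + R)
    filter_upwards [hlim.eventually (gt_mem_nhds hτ0)] with m hm z hz
    have h1 := abs_mollify_sub_const_le (φ m) huint (hSball m z hz) (b := u z) (ε := ε / 2) (by
      filter_upwards [ae_restrict_mem hUo.measurableSet] with y hyU hy
      have h2 : dist y z < τ := by
        calc dist y z ≤ dist y (S m z) + dist (S m z) z := dist_triangle _ _ _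
          _ ≤ δ m * r + δ m * R := by
              refine add_le_add hy ?_
              rw [dist_comm, dist_eq_norm, hS, norm_smul, Real.norm_of_nonneg (hδ0 m).le]
              exact mul_le_mul_of_nonneg_left (hR z hz) (hδ0 m).le
          _ < τ := by rw [← mul_add]; exact hm
      exact (hτ y (hUK hyU) z hz h2).le)
    rw [dist_comm, Real.dist_eq]
    exact h1.trans_lt (by linarith)
  · intro l hl g hg
    have hge := hg.ae_eq hUo (hD l hl)
    have hli : LocallyIntegrable (U.indicator (D l)) volume :=
      ((integrable_indicator_iff hUo.measurableSet).2 (hDi l hl)).locallyIntegrable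
    -- The balls are centred at `S m z` rather than at `z`. The offset is at most `R / r` times the
    -- radius, so Lebesgue differentiation with eccentric balls applies.
    have hleb := ae_restrict_of_ae (s := U)
      (IsUnifLocDoublingMeasure.ae_tendsto_average_norm_sub volume hli (R / r))
    filter_upwards [hge, hleb, ae_restrict_mem hUo.measurableSet] with z hz1 hz2 hzU
    have hzK := hUK hzU
    have hκ : Tendsto (fun m => δ m * r) atTop (𝓝[>] 0) := by
      refine tendsto_nhdsWithin_iff.2 ⟨by simpa using hδlim.mul_const r, ?_⟩
      exact Eventually.of_forall fun m => mul_pos (hδ0 m) hr0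
    have hav := hz2 (fun m => S m z) (fun m => δ m * r) hκ (Eventually.of_forall fun m => by
      rw [mem_closedBall_iff_norm, hS, norm_smul, Real.norm_of_nonneg (hδ0 m).le]
      calc δ m * ‖z - c‖ ≤ δ m * R := mul_le_mul_of_nonneg_left (hR z hzK) (hδ0 m).le
        _ = R / r * (δ m * r) := by field_simp)
    have hmo : Tendsto (fun m => mollify U ((φ m).normed volume) (D l) (S m z)) atTop
        (𝓝 (D l z)) := by
      rw [tendsto_iff_norm_sub_tendsto_zero]
      refine squeeze_zero (fun _ => norm_nonneg _) (fun m => ?_)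
        (by simpa using hav.const_mul ((2 : ℝ) ^ n))
      have h3 := abs_mollify_sub_const_le_average (φ m) (hφin m) hUo.measurableSet (hDi l hl)
        (hSball m z hzK) (D l z)
      rw [Set.indicator_of_mem hzU]
      exact h3
    have hp : Tendsto (fun m => (1 - δ m) ^ l.length) atTop (𝓝 1) := by
      simpa using ((tendsto_const_nhds (x := (1 : ℝ))).sub hδlim).pow l.length
    have hfin := hp.mul hmo
    rw [one_mul, ← hz1] at hfin
    exact hfin.congr fun m => (hGd m z hzK l _ (hD l hl)).symm

end SmoothApproximation

/-! ### Fluxes as functions on the space of jets. -/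

section Jets

variable {n : ℕ} {v : (Fin n → ℝ) → ℝ}

/-- The second-order jet of `v` at `z`. -/
def jet (v : (Fin n → ℝ) → ℝ) (z : Fin n → ℝ) :
    (Fin n → ℝ) × ℝ × (Fin n → ℝ) × (Fin n → Fin n → ℝ) :=
  (z, v z, fun i => partialD i v z, fun i j => partialD i (partialD j v) z)

theorem contDiff_jet (hv : ContDiff ℝ 3 v) : ContDiff ℝ 1 (jet v) := by
  refine contDiff_id.prodMk ((hv.of_le (by norm_num)).prodMk ((contDiff_pi.2 fun i => ?_).prodMk
    (contDiff_pi.2 fun i => contDiff_pi.2 fun j => ?_)))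
  · exact contDiff_partialD hv (by norm_num) i
  · exact contDiff_partialD (contDiff_partialD (m := 2) hv (by norm_num) j) (by norm_num) i

theorem fderiv_jet_single (hv : ContDiff ℝ 3 v) (z : Fin n → ℝ) (k : Fin n) :
    fderiv ℝ (jet v) z (Pi.single k 1) = (Pi.single k 1, partialD k v z,
      fun i => partialD k (partialD i v) z, fun i j => partialD k (partialD i (partialD j v)) z) := by
  have h0 : DifferentiableAt ℝ v z := hv.differentiable (by norm_num) z
  have h1 : ∀ i, DifferentiableAt ℝ (partialD i v) z := fun i =>
    (contDiff_partialD (m := 1) hv (by norm_num) i).differentiable (by norm_num) z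
  have h2 : ∀ i j, DifferentiableAt ℝ (partialD i (partialD j v)) z := fun i j =>
    (contDiff_partialD (m := 1) (contDiff_partialD (m := 2) hv (by norm_num) j)
      (by norm_num) i).differentiable (by norm_num) z
  have h : HasFDerivAt (jet v) _ z := (hasFDerivAt_id z).prodMk (h0.hasFDerivAt.prodMk
    ((hasFDerivAt_pi.2 fun i => (h1 i).hasFDerivAt).prodMk
      (hasFDerivAt_pi.2 fun i => hasFDerivAt_pi.2 fun j => (h2 i j).hasFDerivAt)))
  rw [h.fderiv]
  rfl

end Jets

namespace Flux

variable {d : ℕ} (F : Flux d)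

/-- The `k`-th component as a function on the space of jets. -/
def onJet (k : Fin (d + 1))
    (q : Spacetime d × ℝ × Spacetime d × (Fin (d + 1) → Fin (d + 1) → ℝ)) : ℝ :=
  F k q.1 q.2.1 q.2.2.1 q.2.2.2

variable {F} {v : Spacetime d → ℝ} {z : Spacetime d}

theorem differentiableAt_along {k : Fin (d + 1)} (hv : ContDiff ℝ 3 v)
    (hF : DifferentiableAt ℝ (F.onJet k) (jet v z)) : DifferentiableAt ℝ (F.along v k) z :=
  hF.comp z ((contDiff_jet hv).differentiable (by norm_num) z)

/-- The chain rule shows that the Lie residual at `z` depends on `v` only through its 3-jet at `z`.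
-/
theorem lieResidual_eq (hv : ContDiff ℝ 3 v)
    (hF : ∀ k, DifferentiableAt ℝ (F.onJet k) (jet v z)) :
    F.lieResidual v z = ∑ k, fderiv ℝ (F.onJet k) (jet v z) (Pi.single k 1, partialD k v z,
      fun i => partialD k (partialD i v) z,
      fun i j => partialD k (partialD i (partialD j v)) z) := by
  refine Finset.sum_congr rfl fun k _ => ?_
  rw [← fderiv_jet_single hv]
  have h := (hF k).hasFDerivAt.comp z ((contDiff_jet hv).differentiable (by norm_num) z).hasFDerivAt
  exact congrArg (fun L => L (Pi.single k 1)) h.fderiv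

end Flux

/-! ### Correcting the PDE residual by a multiple of `t - t₀`. -/

section TimeShift

variable {d : ℕ}

/-- The function `t - t₀`, where `t₀` is the time of `z`. -/
def timeShift (z y : Spacetime d) : ℝ := y (Fin.last d) - z (Fin.last d)

theorem contDiff_timeShift (z : Spacetime d) {k : WithTop ℕ∞} : ContDiff ℝ k (timeShift z) :=
  (contDiff_apply ℝ ℝ (Fin.last d)).sub contDiff_const

theorem partialD_const {n : ℕ} (a : ℝ) (i : Fin n) : partialD i (fun _ => a) = fun _ => 0 := by
  funext z
  simp [partialD]

theorem partialD_timeShift (z : Spacetime d) (i : Fin (d + 1)) :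
    partialD i (timeShift z) = fun _ => (Pi.single (Fin.last d) 1 : Spacetime d) i := by
  funext y
  have h : HasFDerivAt (timeShift z)
      (ContinuousLinearMap.proj (R := ℝ) (φ := fun _ : Fin (d + 1) => ℝ) (Fin.last d)) y :=
    (ContinuousLinearMap.proj (R := ℝ) (φ := fun _ : Fin (d + 1) => ℝ)
      (Fin.last d)).hasFDerivAt.sub_const _
  rw [partialD, h.fderiv]
  simp [Pi.single_apply, eq_comm]

theorem partialD_sub_const_mul {n : ℕ} {v w : (Fin n → ℝ) → ℝ} (hv : Differentiable ℝ v)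
    (hw : Differentiable ℝ w) (a : ℝ) (i : Fin n) :
    partialD i (fun y => v y - a * w y) = fun y => partialD i v y - a * partialD i w y := by
  funext y
  have h := (hv y).hasFDerivAt.fun_sub ((hw y).hasFDerivAt.const_mul a)
  rw [partialD, h.fderiv]
  simp [partialD]

theorem partialD_sub_timeShift {v : Spacetime d → ℝ} (hv : Differentiable ℝ v) (a : ℝ)
    (z : Spacetime d) (i : Fin (d + 1)) :
    partialD i (fun y => v y - a * timeShift z y)
      = fun y => partialD i v y - a * (Pi.single (Fin.last d) 1 : Spacetime d) i := by
  rw [partialD_sub_const_mul hv ((contDiff_timeShift z (k := 1)).differentiable (by norm_num)),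
    partialD_timeShift]

theorem partialD_partialD_sub_timeShift {v : Spacetime d → ℝ} (hv : ContDiff ℝ 2 v) (a : ℝ)
    (z : Spacetime d) (i j : Fin (d + 1)) :
    partialD i (partialD j (fun y => v y - a * timeShift z y)) = partialD i (partialD j v) := by
  rw [partialD_sub_timeShift (hv.differentiable (by norm_num))]
  funext y
  rw [partialD, fderiv_sub_const, ← partialD]

/-- At `z` the shift vanishes and its only nonzero derivative is the one in time. -/
theorem jet_sub_timeShift {v : Spacetime d → ℝ} (hv : ContDiff ℝ 2 v) (a : ℝ) (z : Spacetime d) :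
    jet (fun y => v y - a * timeShift z y) z
      = jet v z - a • (0, 0, (Pi.single (Fin.last d) 1 : Spacetime d), 0) := by
  simp only [jet, partialD_partialD_sub_timeShift hv]
  simp only [partialD_sub_timeShift (hv.differentiable (by norm_num))]
  ext <;> simp [timeShift]

/-- The equation contains `∂_t` with coefficient one, so `a` equal to the residual makes the
equation hold at `z`. -/
theorem LinearPDE.residual_sub_timeShift (P : LinearPDE d) {v : Spacetime d → ℝ}
    (hv : ContDiff ℝ 2 v) (a : ℝ) (z : Spacetime d) :
    P.residual (fun y => v y - a * timeShift z y) z = P.residual v z - a := by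
  simp only [residual, partialD_partialD_sub_timeShift hv]
  simp only [partialD_sub_timeShift (hv.differentiable (by norm_num))]
  simp [timeShift]
  ring

end TimeShift

/-! ### The cylinder and elementary bounds for the PDE residual. -/

namespace LinearPDE

variable {d : ℕ} (P : LinearPDE d)

theorem zlo_lt_zhi (k : Fin (d + 1)) : P.zlo k < P.zhi k := by
  refine Fin.lastCases ?_ (fun i => ?_) k
  · simpa [zlo, zhi] using P.T_pos
  · simpa [zlo, zhi] using P.lo_lt_hi i

theorem isCompact_cyl : IsCompact P.cyl := isCompact_Icc

theorem cylInt_subset_cyl : P.cylInt ⊆ P.cyl := fun _ hz =>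
  ⟨fun i => (hz i trivial).1.le, fun i => (hz i trivial).2.le⟩

theorem closure_cylInt : closure P.cylInt = P.cyl := by
  rw [cylInt, closure_pi_set, cyl, ← Set.pi_univ_Icc]
  congr 1
  funext k
  exact closure_Ioo (P.zlo_lt_zhi k).ne

theorem restrict_cylInt : volume.restrict P.cylInt = volume.restrict P.cyl :=
  Measure.restrict_congr_set Measure.univ_pi_Ioo_ae_eq_Icc

theorem ae_cyl_of_cylInt {p : Spacetime d → Prop} (h : ∀ z ∈ P.cylInt, p z) :
    ∀ᵐ z ∂volume.restrict P.cyl, p z := by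
  rw [← P.restrict_cylInt]
  refine (ae_restrict_iff' ?_).2 (Eventually.of_forall h)
  exact (isOpen_set_pi Set.finite_univ fun _ _ => isOpen_Ioo).measurableSet

theorem exists_abs_residual_le : ∃ C, 0 ≤ C ∧ ∀ v : Spacetime d → ℝ, ∀ z ∈ P.cyl, ∀ B,
    |v z| ≤ B → (∀ k, |partialD k v z| ≤ B) → (∀ i j, |partialD i (partialD j v) z| ≤ B) →
      |P.residual v z| ≤ C * B := by
  have hb : ∀ f : Spacetime d → ℝ, ContinuousOn f P.cyl → ∃ C, ∀ z ∈ P.cyl, |f z| ≤ C :=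
    fun f hf => P.isCompact_cyl.exists_bound_of_continuousOn hf
  choose a ha using fun i j => hb _ (P.continuousOn_A i j)
  choose m hm using fun i => hb _ (P.continuousOn_μ i)
  obtain ⟨c, hc⟩ := hb _ P.continuousOn_υ
  have h0 : P.zlo ∈ P.cyl := ⟨le_rfl, fun i => (P.zlo_lt_zhi i).le⟩
  have ha0 := fun i j => (abs_nonneg _).trans (ha i j _ h0)
  have hm0 := fun i => (abs_nonneg _).trans (hm i _ h0)
  have hc0 := (abs_nonneg _).trans (hc _ h0)
  refine ⟨1 + ((∑ i, ∑ j, a i j) + (∑ i, m i) + c), ?_, fun v z hz B h1 h2 h3 => ?_⟩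
  · have := Finset.sum_nonneg fun i (_ : i ∈ Finset.univ) =>
      Finset.sum_nonneg fun j (_ : j ∈ Finset.univ) => ha0 i j
    have := Finset.sum_nonneg fun i (_ : i ∈ Finset.univ) => hm0 i
    linarith
  · have e1 : |∑ i, ∑ j, P.A i j z * partialD i.castSucc (partialD j.castSucc v) z|
        ≤ (∑ i, ∑ j, a i j) * B := by
      simp only [Finset.sum_mul]
      refine (Finset.abs_sum_le_sum_abs _ _).trans (Finset.sum_le_sum fun i _ =>
        (Finset.abs_sum_le_sum_abs _ _).trans (Finset.sum_le_sum fun j _ => ?_))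
      rw [abs_mul]
      exact mul_le_mul (ha i j z hz) (h3 _ _) (abs_nonneg _) (ha0 i j)
    have e2 : |∑ i, P.μ i z * partialD i.castSucc v z| ≤ (∑ i, m i) * B := by
      simp only [Finset.sum_mul]
      refine (Finset.abs_sum_le_sum_abs _ _).trans (Finset.sum_le_sum fun i _ => ?_)
      rw [abs_mul]
      exact mul_le_mul (hm i z hz) (h2 _) (abs_nonneg _) (hm0 i)
    have e3 : |P.υ z * v z| ≤ c * B := by
      rw [abs_mul]
      exact mul_le_mul (hc z hz) h1 (abs_nonneg _) hc0
    have e4 := h2 (Fin.last d)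
    rw [residual]
    refine (abs_sub _ _).trans ?_
    have := abs_add_le ((∑ i, ∑ j, P.A i j z * partialD i.castSucc (partialD j.castSucc v) z)
      + ∑ i, P.μ i z * partialD i.castSucc v z) (P.υ z * v z)
    have := abs_add_le (∑ i, ∑ j, P.A i j z * partialD i.castSucc (partialD j.castSucc v) z)
      (∑ i, P.μ i z * partialD i.castSucc v z)
    linarith

theorem continuousOn_residual {v : Spacetime d → ℝ} (hv : ContDiff ℝ 2 v) :
    ContinuousOn (P.residual v) P.cyl := by
  have h1 : ∀ k, Continuous (partialD k v) := fun k =>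
    (contDiff_partialD (m := 1) hv (by norm_num) k).continuous
  have h2 : ∀ i j, Continuous (partialD i (partialD j v)) := fun i j =>
    (contDiff_partialD (m := 0) (contDiff_partialD (m := 1) hv (by norm_num) j)
      (by norm_num) i).continuous
  refine (h1 _).continuousOn.sub (((continuousOn_finsetSum _ fun i _ =>
    continuousOn_finsetSum _ fun j _ => (P.continuousOn_A i j).mul (h2 _ _).continuousOn).add
    (continuousOn_finsetSum _ fun i _ => (P.continuousOn_μ i).mul (h1 _).continuousOn)).add
    (P.continuousOn_υ.mul hv.continuous.continuousOn))

theorem integrableOn_residual_sq {v : Spacetime d → ℝ} (hv : ContDiff ℝ 2 v) :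
    IntegrableOn (fun z => |P.residual v z| ^ 2) P.cyl :=
  ((P.continuousOn_residual hv).abs.pow 2).integrableOn_compact P.isCompact_cyl

/-- The lateral and temporal boundary is a null set, and only the dominating integrand has to be
integrable. -/
theorem lieRisk_le {F : Flux d} {v : Spacetime d → ℝ} {M : ℝ} (hv : ContDiff ℝ 2 v)
    (h : ∀ z ∈ P.cylInt, |F.lieResidual v z| ^ 2 ≤ M * |P.residual v z| ^ 2) :
    P.lieRisk F v ≤ M * P.pdeRisk v := by
  rw [lieRisk, pdeRisk, ← integral_const_mul]
  exact integral_mono_of_nonneg (Eventually.of_forall fun z => by positivity)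
    ((P.integrableOn_residual_sq hv).const_mul M) (P.ae_cyl_of_cylInt h)

end LinearPDE

/-! ### Control of the Lie residual by the PDE residual. -/

namespace LinearPDE

variable {d : ℕ} (P : LinearPDE d) {F : Flux d}

theorem IsConserved.exists_contDiffOn {P : LinearPDE d} (hF : P.IsConserved F) : ∃ U : Set (Spacetime d),
    IsOpen U ∧ P.cyl ⊆ U ∧ ∀ k, ContDiffOn ℝ 2 (F.onJet k) (U ×ˢ Set.univ) :=
  hF.1

/-- The Lie residual of a first-order conserved vector is bounded by the PDE residual, on functions
with bounded jets. -/
theorem exists_abs_lieResidual_le_of_isFirstOrder (hF : P.IsConserved F) (h1 : F.IsFirstOrder)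
    (B : ℝ) : ∃ L : ℝ, 0 ≤ L ∧ ∀ v : Spacetime d → ℝ, ContDiff ℝ ∞ v → ∀ z ∈ P.cylInt,
      |v z| ≤ B → (∀ k, |partialD k v z| ≤ B) → (∀ i j, |partialD i (partialD j v) z| ≤ B) →
      |F.lieResidual v z| ≤ L * |P.residual v z| := by
  obtain ⟨U, hUo, hU, hFU⟩ := hF.exists_contDiffOn
  obtain ⟨C, hC0, hC⟩ := P.exists_abs_residual_le
  have hWo : IsOpen (U ×ˢ (Set.univ : Set (ℝ × Spacetime d × (Fin (d + 1) → Fin (d + 1) → ℝ)))) :=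
    hUo.prod isOpen_univ
  have hdiff : ∀ k q, q.1 ∈ U → DifferentiableAt ℝ (F.onJet k) q := fun k q hq =>
    ((hFU k).differentiableOn (by norm_num)).differentiableAt (hWo.mem_nhds ⟨hq, trivial⟩)
  let π : (Spacetime d × ℝ × Spacetime d × (Fin (d + 1) → Fin (d + 1) → ℝ)) →L[ℝ]
      (Spacetime d × ℝ × Spacetime d × (Fin (d + 1) → Fin (d + 1) → ℝ)) :=
    (ContinuousLinearMap.fst ℝ _ _).prod (((ContinuousLinearMap.fst ℝ _ _).comp
      (ContinuousLinearMap.snd ℝ _ _)).prod (((ContinuousLinearMap.fst ℝ _ _).comp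
      ((ContinuousLinearMap.snd ℝ _ _).comp (ContinuousLinearMap.snd ℝ _ _))).prod 0))
  have hπ : ∀ q, π q = (q.1, q.2.1, q.2.2.1, 0) := fun q => rfl
  -- A first-order flux factors through the projection forgetting the Hessian. Third derivatives of
  -- `v` therefore drop out, and the Lie residual is the function `G` of the 2-jet.
  have hproj : ∀ k q, q.1 ∈ U → ∀ ξ,
      fderiv ℝ (F.onJet k) q ξ = fderiv ℝ (F.onJet k) q (ξ.1, ξ.2.1, ξ.2.2.1, 0) := by
    intro k q hq ξ
    have e : F.onJet k = F.onJet k ∘ π := by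
      funext q
      exact h1 k _ _ _ _ _
    have h := (hdiff k (π q) hq).hasFDerivAt.comp q π.hasFDerivAt
    rw [← e] at h
    rw [h.fderiv]
    rfl
  let G : (Spacetime d × ℝ × Spacetime d × (Fin (d + 1) → Fin (d + 1) → ℝ)) → ℝ := fun q =>
    ∑ k, fderiv ℝ (F.onJet k) q (Pi.single k 1, q.2.2.1 k, fun i => q.2.2.2 k i, 0)
  have hLie : ∀ v : Spacetime d → ℝ, ContDiff ℝ ∞ v → ∀ z ∈ U,
      F.lieResidual v z = G (jet v z) := by
    intro v hv z hz
    rw [Flux.lieResidual_eq (hv.of_le (WithTop.coe_le_coe.2 le_top)) fun k => hdiff k _ hz]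
    refine Finset.sum_congr rfl fun k _ => ?_
    rw [hproj k _ hz]
    rfl
  have hG : ContDiffOn ℝ 1 G (U ×ˢ Set.univ) := by
    refine ContDiffOn.sum fun k _ => ContDiffOn.clm_apply
      ((hFU k).fderiv_of_isOpen hWo (by norm_num)) (ContDiff.contDiffOn ?_)
    have a1 : ContDiff ℝ 1 fun q : Spacetime d × ℝ × Spacetime d ×
        (Fin (d + 1) → Fin (d + 1) → ℝ) => q.2.2.1 k :=
      (contDiff_apply ℝ ℝ k).comp contDiff_snd.snd.fst
    have a2 : ContDiff ℝ 1 fun q : Spacetime d × ℝ × Spacetime d ×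
        (Fin (d + 1) → Fin (d + 1) → ℝ) => q.2.2.2 k :=
      (contDiff_apply ℝ (Fin (d + 1) → ℝ) k).comp contDiff_snd.snd.snd
    exact contDiff_const.prodMk (a1.prodMk (a2.prodMk contDiff_const))
  -- The residual is at most `C * B`, so this radius accommodates the jets of both `v` and the
  -- corrected function.
  set R : ℝ := |B| + C * |B| with hR
  let K : Set (Spacetime d × ℝ × Spacetime d × (Fin (d + 1) → Fin (d + 1) → ℝ)) :=
    P.cyl ×ˢ Metric.closedBall 0 R
  have hK : IsCompact K := P.isCompact_cyl.prod (isCompact_closedBall 0 R)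
  have hlip : LocallyLipschitzOn K G := by
    intro q hq
    obtain ⟨L, t, ht, h⟩ := ((hG.contDiffAt
      (hWo.mem_nhds ⟨hU hq.1, trivial⟩))).exists_lipschitzOnWith
    exact ⟨L, t, mem_nhdsWithin_of_mem_nhds ht, h⟩
  obtain ⟨L, hL⟩ := hlip.exists_lipschitzOnWith_of_compact hK
  refine ⟨L, L.2, fun v hv z hz b0 b1 b2 => ?_⟩
  have hzc := P.cylInt_subset_cyl hz
  have hB : 0 ≤ B := (abs_nonneg _).trans b0
  rw [abs_of_nonneg hB] at hR
  set a := P.residual v z with ha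
  have hab : |a| ≤ C * B := hC v z hzc B b0 b1 b2
  have hv2 : ContDiff ℝ 2 v := hv.of_le (WithTop.coe_le_coe.2 le_top)
  have hv' : ContDiff ℝ ∞ fun y => v y - a * timeShift z y :=
    hv.sub (contDiff_const.mul (contDiff_timeShift z))
  have h0 : G (jet (fun y => v y - a * timeShift z y) z) = 0 := by
    rw [← hLie _ hv' z (hU hzc)]
    refine hF.2 _ hv' z hz ?_
    rw [P.residual_sub_timeShift hv2, sub_self]
  have hR0 : 0 ≤ R := by rw [hR]; positivity
  have hBR : B ≤ R := by rw [hR]; nlinarith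
  have hjet : jet v z ∈ K := by
    refine ⟨hzc, ?_⟩
    rw [mem_closedBall_zero_iff]
    refine max_le (b0.trans hBR) (max_le ?_ ?_)
    · exact (pi_norm_le_iff_of_nonneg hR0).2 fun k => (b1 k).trans hBR
    · exact (pi_norm_le_iff_of_nonneg hR0).2 fun i =>
        (pi_norm_le_iff_of_nonneg hR0).2 fun j => (b2 i j).trans hBR
  have hjet' : jet (fun y => v y - a * timeShift z y) z ∈ K := by
    rw [jet_sub_timeShift hv2]
    refine ⟨by simpa [jet] using hzc, ?_⟩
    rw [mem_closedBall_zero_iff]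
    refine max_le ?_ (max_le ?_ ?_)
    · simpa [jet] using b0.trans hBR
    · refine (pi_norm_le_iff_of_nonneg hR0).2 fun k => ?_
      have : |(Pi.single (Fin.last d) (1 : ℝ) : Spacetime d) k| ≤ 1 := by
        rw [Pi.single_apply]; split_ifs <;> simp
      have e : |partialD k v z - a * (Pi.single (Fin.last d) (1 : ℝ) : Spacetime d) k| ≤ R := by
        refine (abs_sub _ _).trans ?_
        rw [abs_mul, hR]
        exact add_le_add (b1 k) ((mul_le_of_le_one_right (abs_nonneg _) this).trans hab)
      simpa [jet] using e
    · simpa [jet] using (pi_norm_le_iff_of_nonneg hR0).2 fun i =>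
        (pi_norm_le_iff_of_nonneg hR0).2 fun j => (b2 i j).trans hBR
  -- `G` vanishes at the corrected jet, which lies at distance at most `|a|` from that of `v`.
  have h := hL.dist_le_mul _ hjet _ hjet'
  rw [h0, Real.dist_eq, sub_zero, ← hLie v hv z (hU hzc), jet_sub_timeShift hv2, dist_eq_norm,
    sub_sub_cancel, norm_smul] at h
  refine h.trans (mul_le_mul_of_nonneg_left ?_ L.2)
  refine mul_le_of_le_one_right (abs_nonneg _) ?_
  simp [Prod.norm_def, Pi.norm_single]

/-- The value along the zero function is subtracted to remove the inhomogeneous part of the flux. -/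
theorem _root_.Flux.IsAffine.along_sub (hA : F.IsAffine) {v w : Spacetime d → ℝ}
    (hv : ContDiff ℝ 2 v) (hw : ContDiff ℝ 2 w) (a : ℝ) (k : Fin (d + 1)) (y : Spacetime d) :
    F.along (fun y => v y - a * w y) k y
      = F.along v k y - a * (F.along w k y - F.along (fun _ => 0) k y) := by
  obtain ⟨c, α, β, Γ, h⟩ := hA k y
  have e1 : ∀ i, partialD i (fun y => v y - a * w y)
      = fun y => partialD i v y - a * partialD i w y :=
    partialD_sub_const_mul (hv.differentiable (by norm_num)) (hw.differentiable (by norm_num)) a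
  have e2 : ∀ i j, partialD i (partialD j (fun y => v y - a * w y))
      = fun y => partialD i (partialD j v) y - a * partialD i (partialD j w) y := fun i j => by
    rw [e1]
    exact partialD_sub_const_mul
      ((contDiff_partialD (m := 1) hv (by norm_num) j).differentiable (by norm_num))
      ((contDiff_partialD (m := 1) hw (by norm_num) j).differentiable (by norm_num)) a i
  simp only [Flux.along, e2]
  simp only [e1, h, partialD_const, mul_sub, Finset.sum_sub_distrib, mul_left_comm _ a,
    ← Finset.mul_sum]
  simp
  ring

/-- For an affine flux, the correction by `a (t - t₀)` changes the Lie residual by exactly `a` times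
a function independent of `v`, so no bound on the jets is needed. -/
theorem exists_abs_lieResidual_le_of_isAffine (hF : P.IsConserved F) (hA : F.IsAffine) :
    ∃ L : ℝ, 0 ≤ L ∧ ∀ v : Spacetime d → ℝ, ContDiff ℝ 3 v → ∀ z ∈ P.cyl,
      |F.lieResidual v z| ≤ L * |P.residual v z| := by
  obtain ⟨U, hUo, hU, hFU⟩ := hF.exists_contDiffOn
  have hWo : IsOpen (U ×ˢ (Set.univ : Set (ℝ × Spacetime d × (Fin (d + 1) → Fin (d + 1) → ℝ)))) :=
    hUo.prod isOpen_univ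
  have hdiff : ∀ k q, q.1 ∈ U → DifferentiableAt ℝ (F.onJet k) q := fun k q hq =>
    ((hFU k).differentiableOn (by norm_num)).differentiableAt (hWo.mem_nhds ⟨hq, trivial⟩)
  have hcd : ∀ k, ContinuousOn (fderiv ℝ (F.onJet k)) (U ×ˢ Set.univ) := fun k =>
    (hFU k).continuousOn_fderiv_of_isOpen hWo (by norm_num)
  have hlc : ∀ v : Spacetime d → ℝ, ContDiff ℝ 3 v → ContinuousOn (F.lieResidual v) U := by
    intro v hv
    have hj := (contDiff_jet hv)
    have : ContinuousOn (fun z => ∑ k, fderiv ℝ (F.onJet k) (jet v z)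
        (fderiv ℝ (jet v) z (Pi.single k 1))) U := by
      refine continuousOn_finsetSum _ fun k _ => ContinuousOn.clm_apply
        ((hcd k).comp hj.continuous.continuousOn fun z hz => ⟨hz, trivial⟩)
        ((hj.continuous_fderiv (by norm_num)).clm_apply continuous_const).continuousOn
    refine this.congr fun z hz => ?_
    rw [Flux.lieResidual_eq hv fun k => hdiff k _ hz]
    simp only [fderiv_jet_single hv]
  have hlie : ∀ v : Spacetime d → ℝ, ContDiff ℝ ∞ v → ∀ z ∈ P.cylInt, F.lieResidual v z
      = P.residual v z * (F.lieResidual (timeShift z) z - F.lieResidual (fun _ => 0) z) := by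
    intro v hv z hz
    set a := P.residual v z with ha
    have hzU := hU (P.cylInt_subset_cyl hz)
    have hv3 : ContDiff ℝ 3 v := hv.of_le (WithTop.coe_le_coe.2 le_top)
    have hv2 : ContDiff ℝ 2 v := hv.of_le (WithTop.coe_le_coe.2 le_top)
    have hv' : ContDiff ℝ ∞ fun y => v y - a * timeShift z y :=
      hv.sub (contDiff_const.mul (contDiff_timeShift z))
    have h0 : F.lieResidual (fun y => v y - a * timeShift z y) z = 0 := by
      refine hF.2 _ hv' z hz ?_
      rw [P.residual_sub_timeShift hv2, sub_self]
    have hd : ∀ w : Spacetime d → ℝ, ContDiff ℝ 3 w → ∀ k, DifferentiableAt ℝ (F.along w k) z :=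
      fun w hw k => Flux.differentiableAt_along hw (hdiff k _ hzU)
    have e : F.lieResidual (fun y => v y - a * timeShift z y) z = F.lieResidual v z
        - a * (F.lieResidual (timeShift z) z - F.lieResidual (fun _ => 0) z) := by
      simp only [Flux.lieResidual, ← Finset.sum_sub_distrib, Finset.mul_sum]
      refine Finset.sum_congr rfl fun k _ => ?_
      have e1 : F.along (fun y => v y - a * timeShift z y) k = fun y => F.along v k y
          - a * (F.along (timeShift z) k y - F.along (fun _ => 0) k y) :=
        funext fun y => hA.along_sub hv2 (contDiff_timeShift z) a k y
      have h := (hd v hv3 k).hasFDerivAt.fun_sub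
        (((hd _ (contDiff_timeShift z) k).hasFDerivAt.fun_sub
          (hd (fun _ => 0) contDiff_const k).hasFDerivAt).const_mul a)
      rw [e1, partialD, h.fderiv]
      simp [partialD]
    linarith
  obtain ⟨L, hL⟩ : ∃ L, ∀ z ∈ P.cyl,
      |F.lieResidual (timeShift z) z - F.lieResidual (fun _ => 0) z| ≤ L := by
    -- The shift itself varies with `z`, so continuity is read off from the explicit jet of the
    -- shift at its base point.
    have hc : ContinuousOn (fun z => (∑ k, fderiv ℝ (F.onJet k)
        (z, 0, (Pi.single (Fin.last d) 1 : Spacetime d), 0)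
        (Pi.single k 1, (Pi.single (Fin.last d) 1 : Spacetime d) k, 0, 0))
        - F.lieResidual (fun _ => 0) z) P.cyl := by
      refine (continuousOn_finsetSum _ fun k _ => ContinuousOn.clm_apply
        ((hcd k).comp (t := U ×ˢ Set.univ) (by fun_prop) fun z hz => ⟨hU hz, trivial⟩)
        continuousOn_const).sub ((hlc _ contDiff_const).mono hU)
    obtain ⟨L, hL⟩ := P.isCompact_cyl.exists_bound_of_continuousOn hc
    refine ⟨L, fun z hz => ?_⟩
    have h := hL z hz
    rw [Real.norm_eq_abs] at h
    convert h using 3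
    rw [Flux.lieResidual_eq (contDiff_timeShift z) fun k => hdiff k _ (hU hz)]
    refine Finset.sum_congr rfl fun k _ => ?_
    simp only [jet, partialD_timeShift, partialD_const]
    simp [timeShift]
    rfl
  have h0 : P.zlo ∈ P.cyl := ⟨le_rfl, fun i => (P.zlo_lt_zhi i).le⟩
  have hL0 : 0 ≤ L := (abs_nonneg _).trans (hL _ h0)
  refine ⟨L, hL0, fun v hv => ?_⟩
  have hint : ∀ z ∈ P.cylInt, |F.lieResidual v z| ≤ L * |P.residual v z| := by
    intro z hz
    have hzc := P.cylInt_subset_cyl hz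
    -- Conservation is assumed for smooth functions only. The cubic Taylor polynomial of `v` at `z`
    -- is smooth and has the same 3-jet, hence the same two residuals at `z`.
    have hp : ContDiff ℝ ∞ (taylorPoly v z 4) := contDiff_taylorPoly v z 4
    have hk : ∀ (k : ℕ) (hk : k < 4) (p : Fin k → Fin (d + 1)),
        iterPartialD (List.ofFn p) (taylorPoly v z 4) z = iterPartialD (List.ofFn p) v z := by
      intro k hk p
      have hvk : ContDiff ℝ k v := hv.of_le (by exact_mod_cast Nat.lt_succ_iff.1 hk)
      rw [← iteratedFDeriv_single_eq_iterPartialD (hp.of_le (WithTop.coe_le_coe.2 le_top)),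
        ← iteratedFDeriv_single_eq_iterPartialD hvk, iteratedFDeriv_taylorPoly_self hvk z hk]
    have k0 : taylorPoly v z 4 z = v z := by
      simpa [iterPartialD] using hk 0 (by norm_num) (fun i => i.elim0)
    have k1 : ∀ i, partialD i (taylorPoly v z 4) z = partialD i v z := fun i => by
      simpa [iterPartialD] using hk 1 (by norm_num) ![i]
    have k2 : ∀ i j, partialD i (partialD j (taylorPoly v z 4)) z = partialD i (partialD j v) z :=
      fun i j => by simpa [iterPartialD] using hk 2 (by norm_num) ![i, j]
    have k3 : ∀ i j l, partialD i (partialD j (partialD l (taylorPoly v z 4))) z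
        = partialD i (partialD j (partialD l v)) z :=
      fun i j l => by simpa [iterPartialD] using hk 3 (by norm_num) ![i, j, l]
    have r : P.residual (taylorPoly v z 4) z = P.residual v z := by
      simp only [residual, k0, k1, k2]
    have l : F.lieResidual (taylorPoly v z 4) z = F.lieResidual v z := by
      rw [Flux.lieResidual_eq hv fun k => hdiff k _ (hU hzc),
        Flux.lieResidual_eq (hp.of_le (WithTop.coe_le_coe.2 le_top)) fun k => hdiff k _ (hU hzc)]
      simp only [jet, k0, k1, k2, k3]
    rw [← l, ← r, hlie _ hp z hz, abs_mul, mul_comm]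
    exact mul_le_mul_of_nonneg_right (hL z hzc) (abs_nonneg _)
  intro z hz
  have hzcl : z ∈ closure P.cylInt := by rwa [P.closure_cylInt]
  -- Both residuals are continuous on the closed cylinder, the closure of the open one.
  exact ContinuousWithinAt.closure_le hzcl
    (((hlc v hv).mono hU z hz).abs.mono P.cylInt_subset_cyl)
    ((continuousWithinAt_const.mul
      ((P.continuousOn_residual (hv.of_le (by norm_num))) z hz).abs).mono P.cylInt_subset_cyl)
    hint

/-- On smooth functions with bounded jets the Lie risk is bounded by the PDE risk. -/
theorem exists_lieRisk_le (hF : P.IsConserved F) (hF' : F.IsFirstOrder ∨ F.IsAffine) (B : ℝ) :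
    ∃ M : ℝ, 0 ≤ M ∧ ∀ v : Spacetime d → ℝ, ContDiff ℝ ∞ v → (∀ z ∈ P.cyl, |v z| ≤ B ∧
      (∀ k, |partialD k v z| ≤ B) ∧ (∀ i j, |partialD i (partialD j v) z| ≤ B)) →
      P.lieRisk F v ≤ M * P.pdeRisk v := by
  obtain ⟨L, hL0, hL⟩ : ∃ L : ℝ, 0 ≤ L ∧ ∀ v : Spacetime d → ℝ, ContDiff ℝ ∞ v →
      (∀ z ∈ P.cyl, |v z| ≤ B ∧ (∀ k, |partialD k v z| ≤ B) ∧
        (∀ i j, |partialD i (partialD j v) z| ≤ B)) → ∀ z ∈ P.cylInt,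
      |F.lieResidual v z| ≤ L * |P.residual v z| := by
    rcases hF' with h | h
    · obtain ⟨L, hL0, hL⟩ := P.exists_abs_lieResidual_le_of_isFirstOrder hF h B
      refine ⟨L, hL0, fun v hv hb z hz => ?_⟩
      obtain ⟨b0, b1, b2⟩ := hb z (P.cylInt_subset_cyl hz)
      exact hL v hv z hz b0 b1 b2
    · obtain ⟨L, hL0, hL⟩ := P.exists_abs_lieResidual_le_of_isAffine hF h
      exact ⟨L, hL0, fun v hv _ z hz =>
        hL v (hv.of_le (WithTop.coe_le_coe.2 le_top)) z (P.cylInt_subset_cyl hz)⟩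
  refine ⟨L ^ 2, by positivity, fun v hv hb => P.lieRisk_le (hv.of_le (WithTop.coe_le_coe.2 le_top))
    fun z hz => ?_⟩
  rw [← mul_pow]
  exact pow_le_pow_left₀ (abs_nonneg _) (hL v hv hb z hz) 2

end LinearPDE

/-! ### The Black–Scholes conserved vector. -/

section BlackScholes

theorem partialD_comm {n : ℕ} {v : (Fin n → ℝ) → ℝ} (hv : ContDiff ℝ 2 v) (i j : Fin n) :
    partialD i (partialD j v) = partialD j (partialD i v) := by
  funext z
  have h : ∀ k, HasFDerivAt (partialD k v) ((ContinuousLinearMap.apply ℝ ℝ (Pi.single k 1)).comp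
      (fderiv ℝ (fderiv ℝ v) z)) z := fun k =>
    (ContinuousLinearMap.apply ℝ ℝ (Pi.single k 1 : Fin n → ℝ)).hasFDerivAt.comp z
      ((hv.fderiv_right (m := 1) (by norm_num)).differentiable (by norm_num) z).hasFDerivAt
  rw [partialD, partialD, (h j).fderiv, (h i).fderiv]
  exact (hv.contDiffAt.isSymmSndFDerivAt (by simp)) _ _

variable {r σ xmin xmax T : ℝ} {hx : xmin < xmax} {hT : 0 < T}

theorem blackScholes_residual (v : Spacetime 1 → ℝ) (z : Spacetime 1) :
    (blackScholes r σ xmin xmax T hx hT).residual v z = partialD 1 v z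
      + 1 / 2 * σ ^ 2 * z 0 ^ 2 * partialD 0 (partialD 0 v) z + r * z 0 * partialD 0 v z
      - r * v z := by
  simp [LinearPDE.residual, blackScholes]
  ring

/-- The Lie residual of the Black-Scholes flux is a multiple of the Black-Scholes residual. -/
theorem blackScholesFlux_lieResidual (hσ : σ ≠ 0) (a b : ℝ) {l g : ℝ → ℝ} (hl : ContDiff ℝ 3 l)
    (hg : ContDiff ℝ 2 g) {v : Spacetime 1 → ℝ} (hv : ContDiff ℝ 2 v) {z : Spacetime 1}
    (hz : z 0 ≠ 0) :
    (blackScholesFlux r σ a b l g).lieResidual v z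
      = 2 * b * Real.exp (-(r * z 1)) / (σ ^ 2 * z 0)
        * (blackScholes r σ xmin xmax T hx hT).residual v z := by
  have h0 := (hv.differentiable (by norm_num) z).hasFDerivAt
  have hk := fun k : Fin 2 => ((contDiff_partialD (m := 1) hv (by norm_num) k).differentiable
    (by norm_num) z).hasFDerivAt
  have hX : HasFDerivAt (fun y : Spacetime 1 => y 0)
      (ContinuousLinearMap.proj (R := ℝ) (φ := fun _ : Fin 2 => ℝ) 0) z := hasFDerivAt_apply 0 z
  have hTm : HasFDerivAt (fun y : Spacetime 1 => y 1)
      (ContinuousLinearMap.proj (R := ℝ) (φ := fun _ : Fin 2 => ℝ) 1) z := hasFDerivAt_apply 1 z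
  have hI := (hasDerivAt_inv hz).comp_hasFDerivAt z hX
  have hL := (hl.differentiable (by norm_num) (z 1)).hasDerivAt.comp_hasFDerivAt z hTm
  have hL' := ((hl.iterate_deriv' 2 1).differentiable (by norm_num) (z 1)).hasDerivAt.comp_hasFDerivAt
    z hTm
  have hG := (hg.differentiable (by norm_num) (z 1)).hasDerivAt.comp_hasFDerivAt z hTm
  have hE := (hTm.const_mul r).fun_neg.exp
  have e0 : (blackScholesFlux r σ a b l g).along v 0 = fun y => partialD 1 v y * l (y 1)
      + v y * deriv l (y 1) + g (y 1) - b * v y * Real.exp (-(r * y 1))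
      + b * (partialD 0 v y + 2 * r / σ ^ 2 * (v y * (y 0)⁻¹)) * y 0 * Real.exp (-(r * y 1)) := by
    funext y
    simp only [Flux.along, blackScholesFlux, if_true]
    ring
  have e1 : (blackScholesFlux r σ a b l g).along v 1 = fun y => -(partialD 0 v y * l (y 1))
      + a * (y 0)⁻¹ + 2 * b / σ ^ 2 * (v y * (y 0)⁻¹) * Real.exp (-(r * y 1)) := by
    funext y
    simp only [Flux.along, blackScholesFlux, one_ne_zero, if_false]
    ring
  have d0 := ((((hk 1).fun_mul hL).fun_add (h0.fun_mul hL')).fun_add hG).fun_sub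
    ((h0.const_mul b).fun_mul hE)
  have d0' := d0.fun_add (((((hk 0).fun_add ((h0.fun_mul hI).const_mul (2 * r / σ ^ 2))).const_mul
    b).fun_mul hX).fun_mul hE)
  have d1 := ((((hk 0).fun_mul hL).fun_neg).fun_add (hI.const_mul a)).fun_add
    (((h0.fun_mul hI).const_mul (2 * b / σ ^ 2)).fun_mul hE)
  rw [Flux.lieResidual, Fin.sum_univ_two, e0, e1, partialD, partialD]
  have f0 := d0'.fderiv
  have f1 := d1.fderiv
  simp only [Function.comp_def, Function.iterate_one] at f0 f1
  rw [f0, f1, blackScholes_residual]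
  -- The mixed derivatives multiplied by `l` cancel between the two components by symmetry.
  have hc := congrFun (partialD_comm hv 0 1) z
  simp only [partialD] at hc
  simp [partialD, hc]
  field_simp
  ring

theorem blackScholes_isConserved (hσ : σ ≠ 0) (hxmin : 0 < xmin) (a b : ℝ) {l g : ℝ → ℝ}
    (hl : ContDiff ℝ 3 l) (hg : ContDiff ℝ 2 g) :
    (blackScholes r σ xmin xmax T hx hT).IsConserved (blackScholesFlux r σ a b l g) := by
  have hpos : ∀ z ∈ (blackScholes r σ xmin xmax T hx hT).cyl, 0 < z 0 := fun z hz =>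
    hxmin.trans_le (by simpa [LinearPDE.zlo, blackScholes, Fin.snoc] using hz.1 0)
  refine ⟨⟨{z | 0 < z 0}, isOpen_lt continuous_const (continuous_apply 0), hpos, fun k => ?_⟩,
    fun v hv z hz h => ?_⟩
  · have hX : ContDiff ℝ 2 fun q : Spacetime 1 × ℝ × Spacetime 1 × (Fin 2 → Fin 2 → ℝ) => q.1 0 :=
      (contDiff_apply ℝ ℝ 0).comp contDiff_fst
    have hTm : ContDiff ℝ 2 fun q : Spacetime 1 × ℝ × Spacetime 1 × (Fin 2 → Fin 2 → ℝ) => q.1 1 :=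
      (contDiff_apply ℝ ℝ 1).comp contDiff_fst
    have hu : ContDiff ℝ 2 fun q : Spacetime 1 × ℝ × Spacetime 1 × (Fin 2 → Fin 2 → ℝ) => q.2.1 :=
      contDiff_snd.fst
    have hp : ∀ i, ContDiff ℝ 2
        fun q : Spacetime 1 × ℝ × Spacetime 1 × (Fin 2 → Fin 2 → ℝ) => q.2.2.1 i := fun i =>
      (contDiff_apply ℝ ℝ i).comp contDiff_snd.snd.fst
    have hL := (hl.of_le (m := 2) (by norm_num)).comp hTm
    have hL' := (hl.iterate_deriv' 2 1).comp hTm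
    have hG := hg.comp hTm
    have hE := ((contDiff_const (c := r)).mul hTm).neg.exp
    have hS : ContDiff ℝ 2 fun q : Spacetime 1 × ℝ × Spacetime 1 × (Fin 2 → Fin 2 → ℝ) =>
      σ ^ 2 * q.1 0 := contDiff_const.mul hX
    have hne : ∀ q ∈ {z : Spacetime 1 | 0 < z 0} ×ˢ
        (Set.univ : Set (ℝ × Spacetime 1 × (Fin 2 → Fin 2 → ℝ))), q.1 0 ≠ 0 :=
      fun q hq => (show 0 < q.1 0 from hq.1).ne'
    by_cases hk : k = 0
    · subst hk
      simp only [blackScholesFlux, if_true]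
      exact ((((((hp 1).mul hL).add (hu.mul hL')).add hG).sub
        ((contDiff_const.mul hu).mul hE)).contDiffOn).add
        ((((contDiffOn_const.mul ((hp 0).contDiffOn.add (((contDiff_const.mul hu).contDiffOn).div
          hS.contDiffOn fun q hq => mul_ne_zero (pow_ne_zero 2 hσ) (hne q hq)))).mul
          hX.contDiffOn).mul hE.contDiffOn))
    · simp only [blackScholesFlux, if_neg hk]
      exact ((((hp 0).mul hL).neg.contDiffOn).add (contDiffOn_const.div hX.contDiffOn hne)).add
        (((contDiff_const.mul hu).contDiffOn.div hS.contDiffOn fun q hq =>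
          mul_ne_zero (pow_ne_zero 2 hσ) (hne q hq)).mul hE.contDiffOn)
  · rw [blackScholesFlux_lieResidual (hx := hx) (hT := hT) hσ a b hl hg
      (hv.of_le (WithTop.coe_le_coe.2 le_top)) (hpos z (LinearPDE.cylInt_subset_cyl _ hz)).ne', h,
      mul_zero]

/-- With `b = xmin` the factor is `2 (xmin / x) e^{-rt} / σ²`, where `xmin / x ≤ 1` and the
exponential is largest at `t = 0` or `t = T` according to the sign of `r`. -/
theorem blackScholes_sq_lieResidual_le (hσ : 0 < σ) (hxmin : 0 < xmin) (a : ℝ) {l g : ℝ → ℝ}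
    (hl : ContDiff ℝ 3 l) (hg : ContDiff ℝ 2 g) {v : Spacetime 1 → ℝ} (hv : ContDiff ℝ 2 v)
    {z : Spacetime 1} (hz : z ∈ (blackScholes r σ xmin xmax T hx hT).cyl) :
    |(blackScholesFlux r σ a xmin l g).lieResidual v z| ^ 2
      ≤ (2 * max 1 (Real.exp (-(r * T))) / σ ^ 2) ^ 2
        * |(blackScholes r σ xmin xmax T hx hT).residual v z| ^ 2 := by
  have hz0 : xmin ≤ z 0 := by simpa [LinearPDE.zlo, blackScholes, Fin.snoc] using hz.1 0
  have ht0 : 0 ≤ z 1 := by simpa [LinearPDE.zlo, blackScholes, Fin.snoc] using hz.1 1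
  have htT : z 1 ≤ T := by simpa [LinearPDE.zhi, blackScholes, Fin.snoc] using hz.2 1
  have hpos : 0 < z 0 := hxmin.trans_le hz0
  have hexp : Real.exp (-(r * z 1)) ≤ max 1 (Real.exp (-(r * T))) := by
    rcases le_total 0 r with h | h
    · exact (Real.exp_le_one_iff.2 (by nlinarith)).trans (le_max_left _ _)
    · exact (Real.exp_le_exp.2 (by nlinarith)).trans (le_max_right _ _)
  rw [blackScholesFlux_lieResidual (hx := hx) (hT := hT) hσ.ne' a xmin hl hg hv hpos.ne', abs_mul,
    mul_pow]
  refine mul_le_mul_of_nonneg_right (pow_le_pow_left₀ (abs_nonneg _) ?_ 2) (by positivity)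
  rw [abs_of_nonneg (by positivity), div_le_div_iff₀ (by positivity) (by positivity)]
  have h1 : xmin * Real.exp (-(r * z 1)) ≤ z 0 * max 1 (Real.exp (-(r * T))) :=
    mul_le_mul hz0 hexp (Real.exp_pos _).le hpos.le
  nlinarith [mul_le_mul_of_nonneg_left h1 (by positivity : 0 ≤ 2 * σ ^ 2)]

end BlackScholes

/-! ### Stability of the structural risk. -/

section JetBoundPartial

variable {n : ℕ} {f : (Fin n → ℝ) → ℝ} {z : Fin n → ℝ} {c : ℝ}

theorem JetBound.abs_iterPartialD_le (hf : ContDiff ℝ 2 f) (h : JetBound 1 c f z) {k : ℕ}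
    (hk : k ≤ 2) (p : Fin k → Fin n) : |iterPartialD (List.ofFn p) f z| ≤ c := by
  rw [← iteratedFDeriv_single_eq_iterPartialD (hf.of_le (by exact_mod_cast hk))]
  refine ((iteratedFDeriv ℝ k f z).le_opNorm _).trans ?_
  have := h k hk
  simpa [Pi.norm_single] using this

theorem JetBound.abs_partialD_le (hf : ContDiff ℝ 2 f) (h : JetBound 1 c f z) (i : Fin n) :
    |partialD i f z| ≤ c := by
  simpa [iterPartialD] using h.abs_iterPartialD_le hf (k := 1) (by norm_num) ![i]

theorem JetBound.abs_partialD_partialD_le (hf : ContDiff ℝ 2 f) (h : JetBound 1 c f z)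
    (i j : Fin n) : |partialD i (partialD j f) z| ≤ c := by
  simpa [iterPartialD] using h.abs_iterPartialD_le hf (k := 2) le_rfl ![i, j]

end JetBoundPartial

namespace LinearPDE

variable {d : ℕ} (P : LinearPDE d) {F : Flux d} {φ : (Fin d → ℝ) → ℝ} {ψ u : Spacetime d → ℝ}

theorem residual_sub {v g : Spacetime d → ℝ} (hv : ContDiff ℝ 2 v) (hg : ContDiff ℝ 2 g)
    (z : Spacetime d) :
    P.residual (fun y => v y - g y) z = P.residual v z - P.residual g z := by
  have e : ∀ {f h : Spacetime d → ℝ}, Differentiable ℝ f → Differentiable ℝ h → ∀ i,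
      partialD i (fun y => f y - h y) = fun y => partialD i f y - partialD i h y :=
    fun hf hh i => by simpa using partialD_sub_const_mul hf hh 1 i
  have e2 : ∀ i j, partialD i (fun y => partialD j v y - partialD j g y)
      = fun y => partialD i (partialD j v) y - partialD i (partialD j g) y := fun i j =>
    e ((contDiff_partialD (m := 1) hv (by norm_num) j).differentiable (by norm_num))
      ((contDiff_partialD (m := 1) hg (by norm_num) j).differentiable (by norm_num)) i
  simp only [residual, e (hv.differentiable (by norm_num)) (hg.differentiable (by norm_num)), e2,
    mul_sub, Finset.sum_sub_distrib]
  ring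

theorem pdeRisk_nonneg (v : Spacetime d → ℝ) : 0 ≤ P.pdeRisk v :=
  integral_nonneg fun _ => by positivity

/-- The residual is linear in the function, and `(x + y)² ≤ 2x² + 2y²`. -/
theorem exists_pdeRisk_le : ∃ K, 0 ≤ K ∧ ∀ v g : Spacetime d → ℝ, ContDiff ℝ 2 v → ContDiff ℝ 2 g →
    ∀ δ, (∀ z ∈ P.cyl, JetBound 1 δ (fun y => v y - g y) z) →
      P.pdeRisk v ≤ 2 * P.pdeRisk g + K * δ ^ 2 := by
  obtain ⟨C, hC0, hC⟩ := P.exists_abs_residual_le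
  refine ⟨2 * C ^ 2 * volume.real P.cyl, by positivity, fun v g hv hg δ hδ => ?_⟩
  have hvg := hv.sub hg
  have hcst : IntegrableOn (fun _ : Spacetime d => 2 * (C * δ) ^ 2) P.cyl :=
    integrableOn_const P.isCompact_cyl.measure_ne_top
  have hg2 := (P.integrableOn_residual_sq hg).const_mul 2
  have h : P.pdeRisk v ≤ ∫ z in P.cyl, (2 * |P.residual g z| ^ 2 + 2 * (C * δ) ^ 2) := by
    refine setIntegral_mono_on (P.integrableOn_residual_sq hv) (hg2.add hcst)
      P.isCompact_cyl.measurableSet fun z hz => ?_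
    have h1 := hC _ z hz δ (hδ z hz).abs_le (fun k => (hδ z hz).abs_partialD_le hvg k)
      (fun i j => (hδ z hz).abs_partialD_partialD_le hvg i j)
    rw [P.residual_sub hv hg] at h1
    have h2 := pow_le_pow_left₀ (abs_nonneg _) h1 2
    rw [sq_abs] at h2 ⊢
    rw [sq_abs]
    nlinarith [sq_nonneg (P.residual v z - 2 * P.residual g z)]
  rw [integral_add hg2 hcst, integral_const_mul, setIntegral_const, smul_eq_mul] at h
  have h' : P.pdeRisk v ≤ 2 * P.pdeRisk g + volume.real P.cyl * (2 * (C * δ) ^ 2) := h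
  linarith

theorem exists_bcRisk_le (hsol : P.IsSolution φ ψ u) : ∃ K, 0 ≤ K ∧ ∀ v : Spacetime d → ℝ, ∀ δ,
    (∀ z ∈ P.cyl, |v z - u z| ≤ δ) → P.bcRisk ψ v ≤ K * δ ^ 2 := by
  refine ⟨∑ i : Fin d, ∑ _c ∈ ({P.lo i, P.hi i} : Finset ℝ),
    volume.real (Set.Icc (fun j : Fin d => P.zlo (i.castSucc.succAbove j))
        (fun j : Fin d => P.zhi (i.castSucc.succAbove j))),
    Finset.sum_nonneg fun i _ => Finset.sum_nonneg fun c _ => measureReal_nonneg,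
    fun v δ hδ => ?_⟩
  simp only [bcRisk, Finset.sum_mul]
  refine Finset.sum_le_sum fun i _ => Finset.sum_le_sum fun c hc => ?_
  have hc' : c = P.lo i ∨ c = P.hi i := by simpa using hc
  rw [mul_comm]
  refine (Real.le_norm_self _).trans (norm_setIntegral_le_of_norm_le_const
    isCompact_Icc.measure_lt_top fun y hy => ?_)
  have hz : (i.castSucc.insertNth (α := fun _ => ℝ) c y) ∈ P.cyl := by
    refine Fin.insertNth_mem_Icc.2 ⟨?_, hy⟩
    have h1 : P.zlo i.castSucc = P.lo i := by simp [zlo]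
    have h2 : P.zhi i.castSucc = P.hi i := by simp [zhi]
    rw [h1, h2]
    rcases hc' with rfl | rfl
    · exact ⟨le_rfl, (P.lo_lt_hi i).le⟩
    · exact ⟨(P.lo_lt_hi i).le, le_rfl⟩
  rw [← hsol.2.2.2 _ hz ⟨i, by simpa using hc'⟩, Real.norm_eq_abs, abs_pow, abs_abs]
  exact pow_le_pow_left₀ (abs_nonneg _) (hδ _ hz) 2

/-- The initial condition is known only on the open box, which has full measure in the closed one.
-/
theorem exists_icRisk_le (hsol : P.IsSolution φ ψ u) : ∃ K, 0 ≤ K ∧ ∀ v : Spacetime d → ℝ, ∀ δ,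
    (∀ z ∈ P.cyl, |v z - u z| ≤ δ) → P.icRisk φ v ≤ K * δ ^ 2 := by
  refine ⟨volume.real (Set.pi Set.univ fun k => Set.Ioo (P.lo k) (P.hi k)), measureReal_nonneg,
    fun v δ hδ => ?_⟩
  have e : volume.restrict (Set.pi Set.univ fun k => Set.Ioo (P.lo k) (P.hi k))
      = volume.restrict (Set.Icc P.lo P.hi) :=
    Measure.restrict_congr_set Measure.univ_pi_Ioo_ae_eq_Icc
  rw [icRisk, ← e, mul_comm]
  refine (Real.le_norm_self _).trans (norm_setIntegral_le_of_norm_le_const ?_ fun x hx => ?_)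
  · rw [← Measure.restrict_apply_univ, e, Measure.restrict_apply_univ]
    exact isCompact_Icc.measure_lt_top
  have hz : Fin.snoc (α := fun _ => ℝ) x 0 ∈ P.cyl := by
    constructor <;> refine fun k => Fin.lastCases ?_ (fun i => ?_) k
    · simp [zlo]
    · simpa [zlo] using (hx i trivial).1.le
    · simpa [zhi] using P.T_pos.le
    · simpa [zhi] using (hx i trivial).2.le
  rw [← hsol.2.2.1 x fun i => hx i trivial, Real.norm_eq_abs, abs_pow, abs_abs]
  exact pow_le_pow_left₀ (abs_nonneg _) (hδ _ hz) 2

/-- Stability of the structural risk: it is controlled by the PDE risk of a reference function `g`,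
the `C²` distance to `g`, and the uniform distance from `g` to the solution. -/
theorem exists_structuralRisk_le (hsol : P.IsSolution φ ψ u) (hF : P.IsConserved F)
    (hF' : F.IsFirstOrder ∨ F.IsAffine) {lam₁ lam₂ lam₃ lam₄ : ℝ}
    (h₁ : 0 ≤ lam₁) (h₂ : 0 ≤ lam₂) (h₃ : 0 ≤ lam₃) (h₄ : 0 ≤ lam₄) (C : ℝ) :
    ∃ K, 0 ≤ K ∧ ∀ v g : Spacetime d → ℝ, ContDiff ℝ ∞ v → ContDiff ℝ ∞ g →
      (∀ z ∈ P.cyl, JetBound 1 C g z) → ∀ δ ≤ 1, ∀ η,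
      (∀ z ∈ P.cyl, JetBound 1 δ (fun y => v y - g y) z) → (∀ z ∈ P.cyl, |g z - u z| ≤ η) →
      P.structuralRisk φ ψ F lam₁ lam₂ lam₃ lam₄ v ≤ K * (P.pdeRisk g + η ^ 2 + δ ^ 2) := by
  obtain ⟨K₁, hK₁, H₁⟩ := P.exists_pdeRisk_le
  obtain ⟨K₂, hK₂, H₂⟩ := P.exists_bcRisk_le hsol
  obtain ⟨K₃, hK₃, H₃⟩ := P.exists_icRisk_le hsol
  -- The jets of `v` are bounded by `C + 1`, since `v` stays within `δ ≤ 1` of `g` in `C²`; hence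
  -- `M` does not depend on `v`.
  obtain ⟨M, hM, H₄⟩ := P.exists_lieRisk_le hF hF' (C + 1)
  refine ⟨(lam₁ + lam₄ * M) * (2 + K₁) + (lam₂ * K₂ + lam₃ * K₃) * 2, by positivity,
    fun v g hv hg hgC δ hδ1 η hδ hη => ?_⟩
  have hv2 : ContDiff ℝ 2 v := hv.of_le (WithTop.coe_le_coe.2 le_top)
  have hg2 : ContDiff ℝ 2 g := hg.of_le (WithTop.coe_le_coe.2 le_top)
  have hvu : ∀ z ∈ P.cyl, |v z - u z| ≤ δ + η := fun z hz => by
    have := abs_add_le (v z - g z) (g z - u z)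
    rw [sub_add_sub_cancel] at this
    linarith [(hδ z hz).abs_le, hη z hz]
  have hvC : ∀ z ∈ P.cyl, JetBound 1 (C + 1) v z := fun z hz => by
    have h := ((hgC z hz).add hg2 (hv2.sub hg2) (hδ z hz)).mono zero_le_one
      (add_le_add_right hδ1 C)
    simpa using h
  have r₁ := H₁ v g hv2 hg2 δ hδ
  have r₂ := H₂ v _ hvu
  have r₃ := H₃ v _ hvu
  have r₄ := H₄ v hv fun z hz => ⟨(hvC z hz).abs_le, (hvC z hz).abs_partialD_le hv2,
    (hvC z hz).abs_partialD_partialD_le hv2⟩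
  have h0 := P.pdeRisk_nonneg g
  set S := P.pdeRisk g + η ^ 2 + δ ^ 2 with hS
  have s₁ : P.pdeRisk v ≤ (2 + K₁) * S := by
    nlinarith [sq_nonneg η, sq_nonneg δ, mul_nonneg hK₁ h0, mul_nonneg hK₁ (sq_nonneg η)]
  have s₂ : (δ + η) ^ 2 ≤ 2 * S := by nlinarith [sq_nonneg (δ - η)]
  have t₁ := mul_le_mul_of_nonneg_left s₁ h₁
  have t₂ := mul_le_mul_of_nonneg_left (r₂.trans (mul_le_mul_of_nonneg_left s₂ hK₂)) h₂
  have t₃ := mul_le_mul_of_nonneg_left (r₃.trans (mul_le_mul_of_nonneg_left s₂ hK₃)) h₃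
  have t₄ := mul_le_mul_of_nonneg_left (r₄.trans (mul_le_mul_of_nonneg_left s₁ hM)) h₄
  rw [structuralRisk]
  linarith

/-- A sequence of smooth functions approximating the solution. -/
theorem exists_smooth_approx_solution {s : ℕ} (hs : 2 ≤ s) (hu : MemSobolevInfty s P.cylInt u)
    (hsol : P.IsSolution φ ψ u) : ∃ C, ∀ ε : ℝ, 0 < ε → ∃ g : Spacetime d → ℝ, ContDiff ℝ ∞ g ∧
      (∀ z ∈ P.cyl, ∀ k ≤ s, ‖iteratedFDeriv ℝ k g z‖ ≤ C) ∧ P.pdeRisk g ≤ ε ∧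
      ∀ z ∈ P.cyl, |g z - u z| ≤ ε := by
  obtain ⟨huc, ⟨D, H, hD, hH, heq⟩, -, -⟩ := hsol
  obtain ⟨C, G, hG, hGC, hGu, hGl⟩ := exists_smooth_approx P.zlo_lt_zhi hu huc
  obtain ⟨CP, hCP0, hCP⟩ := P.exists_abs_residual_le
  have hG2 : ∀ m, ContDiff ℝ 2 (G m) := fun m => (hG m).of_le (WithTop.coe_le_coe.2 le_top)
  have hjet : ∀ m, ∀ z ∈ P.cyl, JetBound 1 C (G m) z := fun m z hz k hk => by
    simpa using hGC m z hz k (hk.trans hs)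
  have hlim : Tendsto (fun m => P.pdeRisk (G m)) atTop (𝓝 0) := by
    have : IsFiniteMeasure (volume.restrict P.cyl) :=
      isFiniteMeasure_restrict.2 P.isCompact_cyl.measure_ne_top
    have h0 : (0 : ℝ) = ∫ _z in P.cyl, (0 : ℝ) := by simp
    rw [h0]
    -- The residuals are uniformly bounded and converge almost everywhere to that of `u`, which is
    -- zero.
    refine tendsto_integral_of_dominated_convergence (fun _ => (CP * C) ^ 2)
      (fun m => (P.integrableOn_residual_sq (hG2 m)).aestronglyMeasurable)
      (integrable_const _) (fun m => ?_) ?_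
    · refine (ae_restrict_iff' P.isCompact_cyl.measurableSet).2 (Eventually.of_forall fun z hz => ?_)
      rw [Real.norm_eq_abs, abs_pow, abs_abs]
      exact pow_le_pow_left₀ (abs_nonneg _) (hCP _ z hz C (hjet m z hz).abs_le
        ((hjet m z hz).abs_partialD_le (hG2 m))
        ((hjet m z hz).abs_partialD_partialD_le (hG2 m))) 2
    · rw [← P.restrict_cylInt]
      have hDl := ae_all_iff.2 fun k => hGl [k] (by simp; omega) _ (hD k)
      have hHl := ae_all_iff.2 fun i => ae_all_iff.2 fun j =>
        hGl [Fin.castSucc i, Fin.castSucc j] (by simpa using hs) _ (hH i j)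
      have hmem : ∀ᵐ z ∂volume.restrict P.cylInt, z ∈ P.cylInt :=
        ae_restrict_mem (isOpen_set_pi Set.finite_univ fun _ _ => isOpen_Ioo).measurableSet
      filter_upwards [hDl, hHl, heq, hmem] with z h1 h2 h3 hz
      have h4 := hGu.tendsto_at (P.cylInt_subset_cyl hz)
      have h5 : Tendsto (fun m => P.residual (G m) z) atTop (𝓝 (D (Fin.last d) z -
          ((∑ i, ∑ j, P.A i j z * H i j z) + (∑ i, P.μ i z * D (Fin.castSucc i) z)
            + P.υ z * u z))) :=
        (h1 _).sub (((tendsto_finsetSum _ fun i _ => tendsto_finsetSum _ fun j _ =>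
          (h2 i j).const_mul _).add (tendsto_finsetSum _ fun i _ => (h1 _).const_mul _)).add
          (h4.const_mul _))
      rw [h3, sub_self] at h5
      simpa using h5.abs.pow 2
  refine ⟨C, fun ε hε => ?_⟩
  obtain ⟨m, h1, h2⟩ := ((hlim.eventually (gt_mem_nhds hε)).and
    (Metric.tendstoUniformlyOn_iff.1 hGu ε hε)).exists
  refine ⟨G m, hG m, hGC m, h1.le, fun z hz => ?_⟩
  rw [← Real.dist_eq, dist_comm]
  exact (h2 z hz).le

end LinearPDE

/-- Takes `N = ⌈x ^ (1 / (2k))⌉`: a squared error `N ^ (-2k)` of size `1 / x` needs about `x ^ (n /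
(2k))` grid points. Rounding up at most doubles the base, which gives `2 ^ n`. -/
theorem exists_nat_pow_ge_of_rate {k : ℕ} (hk : 1 ≤ k) {n : ℕ} {q : ℝ}
    (hq : (n : ℝ) / (2 * k) ≤ q) {x : ℝ} (hx : 1 ≤ x) :
    ∃ N : ℕ, 1 ≤ N ∧ x ≤ ((N : ℝ) ^ k) ^ 2 ∧ (N : ℝ) ^ n ≤ 2 ^ n * x ^ q := by
  have hk0 : (0 : ℝ) < 2 * k := by positivity
  have hx0 : 0 ≤ x := zero_le_one.trans hx
  set y : ℝ := x ^ (1 / (2 * k : ℝ)) with hy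
  have hy1 : 1 ≤ y := Real.one_le_rpow hx (by positivity)
  refine ⟨⌈y⌉₊, Nat.one_le_ceil_iff.2 (by linarith), ?_, ?_⟩
  · have e : x = y ^ (2 * k) := by
      rw [hy, ← Real.rpow_natCast, ← Real.rpow_mul hx0]
      push_cast
      rw [one_div_mul_cancel hk0.ne', Real.rpow_one]
    rw [← pow_mul, mul_comm k 2]
    nth_rewrite 1 [e]
    exact pow_le_pow_left₀ (by linarith) (Nat.le_ceil y) _
  · have h1 : (⌈y⌉₊ : ℝ) ≤ 2 * y := by
      have := Nat.ceil_lt_add_one (show 0 ≤ y by linarith)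
      linarith
    refine (pow_le_pow_left₀ (Nat.cast_nonneg _) h1 n).trans ?_
    rw [mul_pow]
    refine mul_le_mul_of_nonneg_left ?_ (by positivity)
    rw [hy, ← Real.rpow_natCast, ← Real.rpow_mul hx0]
    refine Real.rpow_le_rpow_of_exponent_le hx ?_
    rwa [one_div_mul_eq_div]

/-! ### Existence of networks of small risk, without and with a rate. -/

namespace LinearPDE

variable {d : ℕ} (P : LinearPDE d) {F : Flux d} {φ : (Fin d → ℝ) → ℝ} {ψ u : Spacetime d → ℝ}

/-- For `s = 2` the uniform bound `C` gives no decay in `N`. Instead the third derivatives of the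
smooth function `g` are used; their bound depends on `ε`, hence no rate. -/
theorem exists_tanhNet_structuralRisk_le {s : ℕ} (hs : 2 ≤ s) (hu : MemSobolevInfty s P.cylInt u)
    (hsol : P.IsSolution φ ψ u) (hF : P.IsConserved F) (hF' : F.IsFirstOrder ∨ F.IsAffine)
    {lam₁ lam₂ lam₃ lam₄ : ℝ} (h₁ : 0 ≤ lam₁) (h₂ : 0 ≤ lam₂) (h₃ : 0 ≤ lam₃) (h₄ : 0 ≤ lam₄)
    {ε : ℝ} (hε : 0 < ε) : ∃ N₁ N₂ : ℕ, 0 < N₁ ∧ 0 < N₂ ∧ ∃ θ : TanhNet (d + 1) N₁ N₂,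
      P.structuralRisk φ ψ F lam₁ lam₂ lam₃ lam₄ θ.eval ≤ ε := by
  obtain ⟨C, hC⟩ := P.exists_smooth_approx_solution hs hu hsol
  obtain ⟨K, hK, H⟩ := P.exists_structuralRisk_le hsol hF hF' h₁ h₂ h₃ h₄ C
  set κ : ℝ := min 1 (ε / (3 * (K + 1))) with hκ
  have hκ0 : 0 < κ := by positivity
  have hκ1 : κ ≤ 1 := min_le_left _ _
  have hκ2 : κ ^ 2 ≤ κ := by nlinarith
  have hκε : K * (3 * κ) ≤ ε := by
    have h : κ ≤ ε / (3 * (K + 1)) := min_le_right _ _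
    rw [le_div_iff₀ (by positivity)] at h
    nlinarith
  obtain ⟨g, hg, hgC, hgR, hgu⟩ := hC κ hκ0
  have hg2 : ContDiff ℝ 2 g := hg.of_le (WithTop.coe_le_coe.2 le_top)
  have hg3 : ContDiff ℝ (3 : ℕ) g := contDiff_infty.1 hg 3
  obtain ⟨W, C₁, hC₁, hW⟩ := exists_tanhNet_rate P.zlo_lt_zhi (Nat.le_add_left 1 d)
    (s := 3) (by norm_num)
  obtain ⟨C₃, hC₃⟩ := P.isCompact_cyl.exists_bound_of_continuousOn
    (hg3.continuous_iteratedFDeriv le_rfl).continuousOn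
  obtain ⟨N, hN⟩ := exists_nat_gt ((C₃ * C₁ + 1) / κ)
  obtain ⟨N₁, N₂, hN₁, -, hN₂, -, θ, hθ⟩ := hW g hg3 C₃ hC₃ (N + 1) (by omega)
  refine ⟨N₁, N₂, hN₁, hN₂, θ, ?_⟩
  have hδ : (C₃ * C₁ + 1) / ((N + 1 : ℕ) : ℝ) ^ (3 - 2) ≤ κ := by
    rw [div_lt_iff₀ hκ0] at hN
    rw [show 3 - 2 = 1 from rfl, pow_one, div_le_iff₀ (by positivity)]
    push_cast
    nlinarith
  refine (H θ.eval g θ.contDiff_eval hg (fun z hz k hk => by simpa using hgC z hz k (hk.trans hs))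
    κ hκ1 κ (fun z hz => (hθ z hz).mono zero_le_one hδ) hgu).trans (le_trans ?_ hκε)
  exact mul_le_mul_of_nonneg_left (by linarith) hK

/-- Here `C` bounds the derivatives of order `s` of every regularisation `g`, so the network
constants are independent of `ε` and only `N` varies with it. -/
theorem exists_tanhNet_structuralRisk_le_rate {s γ : ℕ} (hd : 1 ≤ d) (hs : 2 + γ < s)
    (hu : MemSobolevInfty s P.cylInt u)
    (hsol : P.IsSolution φ ψ u) (hF : P.IsConserved F) (hF' : F.IsFirstOrder ∨ F.IsAffine)
    {lam₁ lam₂ lam₃ lam₄ : ℝ} (h₁ : 0 ≤ lam₁) (h₂ : 0 ≤ lam₂) (h₃ : 0 ≤ lam₃) (h₄ : 0 ≤ lam₄) :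
    ∃ c : ℝ, ∀ ε : ℝ, 0 < ε → ε < 1 → ∃ w N₁ N₂ : ℕ,
      (w : ℝ) ≤ c * ε ^ (-((d : ℝ) / ((s : ℝ) - 2 - (γ : ℝ)))) ∧
      0 < N₁ ∧ N₁ ≤ w ∧ 0 < N₂ ∧ N₂ ≤ w ∧ ∃ θ : TanhNet (d + 1) N₁ N₂,
        P.structuralRisk φ ψ F lam₁ lam₂ lam₃ lam₄ θ.eval ≤ ε := by
  have hs2 : 2 ≤ s := by omega
  obtain ⟨C, hC⟩ := P.exists_smooth_approx_solution hs2 hu hsol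
  obtain ⟨K, hK, H⟩ := P.exists_structuralRisk_le hsol hF hF' h₁ h₂ h₃ h₄ C
  obtain ⟨W, C₁, hC₁, hW⟩ := exists_tanhNet_rate P.zlo_lt_zhi (Nat.le_add_left 1 d) hs2
  have hC0 : 0 ≤ C := by
    obtain ⟨g, -, hg, -⟩ := hC 1 one_pos
    exact (norm_nonneg _).trans
      (hg P.zlo ⟨le_rfl, fun i => (P.zlo_lt_zhi i).le⟩ 0 (Nat.zero_le _))
  set q : ℝ := (d : ℝ) / ((s : ℝ) - 2 - (γ : ℝ)) with hq
  set D : ℝ := C * C₁ + 1 with hD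
  -- With `N ^ (2(s-2)) ≥ E / ε`, the squared network error is at most `ε / (3K + 1)`: it is below
  -- 1, and `K` times it is at most `ε / 3`. The remaining two thirds go to `κ`.
  set E : ℝ := (3 * K + 1) * D ^ 2 with hE
  have hD1 : 1 ≤ D := by rw [hD]; nlinarith [mul_nonneg hC0 hC₁]
  have hE1 : 1 ≤ E := by rw [hE]; nlinarith [mul_nonneg hK (sq_nonneg D)]
  have hsγ : (2 : ℝ) + γ + 1 ≤ s := by exact_mod_cast hs
  -- The exponent obtained is no worse than the claimed one because `d + 1 ≤ 2d` and `s - 2 - γ ≤ s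
  -- - 2`.
  have hq' : ((d + 1 : ℕ) : ℝ) / (2 * ((s - 2 : ℕ) : ℝ)) ≤ q := by
    have hd' : (1 : ℝ) ≤ d := by exact_mod_cast hd
    have hγ : (0 : ℝ) ≤ γ := Nat.cast_nonneg γ
    rw [hq, Nat.cast_sub hs2]
    push_cast
    rw [div_le_div_iff₀ (by linarith) (by linarith)]
    nlinarith [mul_nonneg (show (0 : ℝ) ≤ d + 1 by linarith) hγ,
      mul_nonneg (sub_nonneg.2 hd') (show (0 : ℝ) ≤ s - 2 by linarith)]
  refine ⟨W * (2 ^ (d + 1) * E ^ q), fun ε hε hε1 => ?_⟩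
  obtain ⟨N, hN1, hNx, hNw⟩ := exists_nat_pow_ge_of_rate (k := s - 2) (by omega) hq'
    (x := E / ε) (by rw [le_div_iff₀ hε]; linarith)
  set κ : ℝ := min 1 (ε / (3 * (K + 1))) with hκ
  have hκ0 : 0 < κ := by positivity
  have hκ1 : κ ≤ 1 := min_le_left _ _
  have hκ2 : κ ^ 2 ≤ κ := by nlinarith
  have hκε : 3 * (K * κ) ≤ ε := by
    have h : κ ≤ ε / (3 * (K + 1)) := min_le_right _ _
    rw [le_div_iff₀ (by positivity)] at h
    nlinarith
  obtain ⟨g, hg, hgC, hgR, hgu⟩ := hC κ hκ0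
  obtain ⟨N₁, N₂, hN₁, hN₁W, hN₂, hN₂W, θ, hθ⟩ :=
    hW g (contDiff_infty.1 hg s) C (fun z hz => hgC z hz s le_rfl) N hN1
  have hNk : (0 : ℝ) < (N : ℝ) ^ (s - 2) := by positivity
  have hδ2 : (D / (N : ℝ) ^ (s - 2)) ^ 2 * (3 * K + 1) ≤ ε := by
    rw [div_le_iff₀ hε] at hNx
    rw [div_pow, div_mul_eq_mul_div, div_le_iff₀ (by positivity)]
    linarith
  have hδ0 := sq_nonneg (D / (N : ℝ) ^ (s - 2))
  have hδ1 : D / (N : ℝ) ^ (s - 2) ≤ 1 := by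
    refine (sq_le_one_iff₀ (by positivity)).1 ?_
    nlinarith [mul_nonneg hK hδ0]
  refine ⟨W * N ^ (d + 1), N₁, N₂, ?_, hN₁, hN₁W, hN₂, hN₂W, θ, ?_⟩
  · push_cast
    rw [mul_assoc, mul_assoc]
    refine mul_le_mul_of_nonneg_left (hNw.trans (le_of_eq ?_)) (Nat.cast_nonneg _)
    rw [Real.div_rpow (by linarith) hε.le, Real.rpow_neg hε.le, div_eq_mul_inv]
  · refine (H θ.eval g θ.contDiff_eval hg (fun z hz k hk => by
      simpa using hgC z hz k (hk.trans hs2)) _ hδ1 κ hθ hgu).trans ?_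
    nlinarith [mul_le_mul_of_nonneg_left hgR hK, mul_le_mul_of_nonneg_left hκ2 hK]

end LinearPDE

end

theorem mainTheorem4 {d : ℕ} (hd : 1 ≤ d) (γ s : ℕ) (hs : 2 + γ ≤ s)
    (P : LinearPDE d) (φ : (Fin d → ℝ) → ℝ) (ψ u : Spacetime d → ℝ)
    (hu : MemSobolevInfty s P.cylInt u) (hsol : P.IsSolution φ ψ u)
    (F : Flux d) (hF : P.IsConserved F) (hF' : F.IsFirstOrder ∨ F.IsAffine)
    (lam₁ lam₂ lam₃ lam₄ : ℝ)
    (h₁ : 0 ≤ lam₁) (h₂ : 0 ≤ lam₂) (h₃ : 0 ≤ lam₃) (h₄ : 0 ≤ lam₄) :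
    -- networks of the stated width and of arbitrarily small structural risk
    (∃ w : ℝ → ℕ,
      (∀ ε : ℝ, 0 < ε → ∃ N₁ N₂ : ℕ, 0 < N₁ ∧ N₁ ≤ w ε ∧ 0 < N₂ ∧ N₂ ≤ w ε ∧
        ∃ θ : TanhNet (d + 1) N₁ N₂,
          P.structuralRisk φ ψ F lam₁ lam₂ lam₃ lam₄ θ.eval ≤ ε) ∧
      (2 + γ < s →
        (fun ε : ℝ => (w ε : ℝ)) =O[𝓝[>] 0]
          (fun ε : ℝ => ε ^ (-((d : ℝ) / ((s : ℝ) - 2 - (γ : ℝ))))))) ∧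
    -- the Lie residual is controlled by the PDE residual
    (F.IsAffine → ∃ M : ℝ, 0 < M ∧ ∀ v : Spacetime d → ℝ, ContDiff ℝ 3 v →
      (∀ z ∈ P.cyl, |F.lieResidual v z| ^ 2 ≤ M * |P.residual v z| ^ 2) ∧
      P.lieRisk F v ≤ M * P.pdeRisk v) ∧
    -- the same with an explicit constant for Black-Scholes and `x ∂/∂x`
    (∀ (r σ xmin xmax T a : ℝ) (l g : ℝ → ℝ) (_ : 0 < σ) (_ : 0 < xmin)
      (hx : xmin < xmax) (hT : 0 < T) (_ : ContDiff ℝ 3 l) (_ : ContDiff ℝ 2 g),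
      (∀ b : ℝ, (blackScholes r σ xmin xmax T hx hT).IsConserved (blackScholesFlux r σ a b l g)) ∧
      ∀ v : Spacetime 1 → ℝ, ContDiff ℝ 2 v →
        (∀ z ∈ (blackScholes r σ xmin xmax T hx hT).cyl,
          |(blackScholesFlux r σ a xmin l g).lieResidual v z| ^ 2
            ≤ (2 * max 1 (Real.exp (-(r * T))) / σ ^ 2) ^ 2
              * |(blackScholes r σ xmin xmax T hx hT).residual v z| ^ 2) ∧
        (blackScholes r σ xmin xmax T hx hT).lieRisk (blackScholesFlux r σ a xmin l g) v
          ≤ (2 * max 1 (Real.exp (-(r * T))) / σ ^ 2) ^ 2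
            * (blackScholes r σ xmin xmax T hx hT).pdeRisk v) := by
  refine ⟨?_, fun hA => ?_, fun r σ xmin xmax T a l g hσ hxmin hx hT hl hg => ⟨fun b =>
    blackScholes_isConserved hσ.ne' hxmin a b hl hg, fun v hv => ?_⟩⟩
  -- The least admissible width serves both claims: it is attained for every `ε`, and every upper
  -- bound for small `ε` applies to it.
  · let good : ℝ → Set ℕ := fun ε => {w | ∃ N₁ N₂ : ℕ, 0 < N₁ ∧ N₁ ≤ w ∧ 0 < N₂ ∧ N₂ ≤ w ∧
      ∃ θ : TanhNet (d + 1) N₁ N₂, P.structuralRisk φ ψ F lam₁ lam₂ lam₃ lam₄ θ.eval ≤ ε}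
    have hs2 : 2 ≤ s := by omega
    refine ⟨fun ε => sInf (good ε), fun ε hε => Nat.sInf_mem (s := good ε) ?_, fun hs' => ?_⟩
    · obtain ⟨N₁, N₂, hN₁, hN₂, θ, hθ⟩ :=
        P.exists_tanhNet_structuralRisk_le hs2 hu hsol hF hF' h₁ h₂ h₃ h₄ hε
      exact ⟨max N₁ N₂, N₁, N₂, hN₁, le_max_left _ _, hN₂, le_max_right _ _, θ, hθ⟩
    · obtain ⟨c, hc⟩ :=
        P.exists_tanhNet_structuralRisk_le_rate hd hs' hu hsol hF hF' h₁ h₂ h₃ h₄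
      refine Asymptotics.IsBigO.of_bound c ?_
      filter_upwards [Ioo_mem_nhdsGT (zero_lt_one' ℝ)] with ε hε
      obtain ⟨w, N₁, N₂, hw, h⟩ := hc ε hε.1 hε.2
      have hle : sInf (good ε) ≤ w := Nat.sInf_le ⟨N₁, N₂, h⟩
      rw [Real.norm_of_nonneg (Nat.cast_nonneg _),
        Real.norm_of_nonneg (Real.rpow_nonneg hε.1.le _)]
      exact (Nat.cast_le.2 hle).trans hw
  · obtain ⟨L, hL0, hL⟩ := P.exists_abs_lieResidual_le_of_isAffine hF hA
    have h : ∀ v : Spacetime d → ℝ, ContDiff ℝ 3 v → ∀ z ∈ P.cyl,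
        |F.lieResidual v z| ^ 2 ≤ (L + 1) ^ 2 * |P.residual v z| ^ 2 := fun v hv z hz => by
      rw [← mul_pow]
      refine pow_le_pow_left₀ (abs_nonneg _) ((hL v hv z hz).trans ?_) 2
      exact mul_le_mul_of_nonneg_right (by linarith) (abs_nonneg _)
    -- `L` may be zero; adding one makes the constant positive.
    exact ⟨(L + 1) ^ 2, by positivity, fun v hv => ⟨h v hv,
      P.lieRisk_le (hv.of_le (by norm_num)) fun z hz => h v hv z (P.cylInt_subset_cyl hz)⟩⟩
  · exact ⟨fun z hz => blackScholes_sq_lieResidual_le hσ hxmin a hl hg hv hz,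
      LinearPDE.lieRisk_le _ hv fun z hz => blackScholes_sq_lieResidual_le hσ hxmin a hl hg hv
        (LinearPDE.cylInt_subset_cyl _ hz)⟩
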